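/- Let $G$ be a connected complex Lie group whose Lie algebra $\mathfrak g$ is simple (equivalently, a connected complex simple algebraic group), $\mathfrak h\subset\mathfrak g$ a Cartan subalgebra, $\Delta$ its root system, $W$ its Weyl group, $\mathfrak h_{\mathbb R}$ the real span of the coroots, $\kappa$ the Killing form, and $s\in W$. *Data attached to $s$.* Let $\mathfrak h_{\mathbb R}=\bigoplus_{i=0}^{K}\mathfrak h_i$ be any orthogonal decomposition into $s$-invariant subspaces such that $\mathfrak h_0$ is the fixed space of $s$ in $\mathfrak h_{\mathbb R}$ and, for $i\ge 1$, $\mathfrak h_i$ is either a line on which $s=-1$ or a plane on which $s$ is a rotation through an angle $\theta_i$, $0<\theta_i\le\pi$. Let $h_i\in\mathfrak h_i$ be such that $\alpha(h_i)\ne 0$ for every $\alpha\in\Delta$ not vanishing identically on $\mathfrak h_i$. Put $\overline\Delta_i=\{\alpha\in\Delta:\alpha(h_j)=0\text{ for }j>i,\ \alpha(h_i)\neq0\}$, and let $0=i_0<i_1<\dots<i_M$ be the index $0$ together with all $i>0$ with $\overline\Delta_i\ne\emptyset$. Assume that $|\alpha(h_{i_k})|>\bigl|\sum_{l\le j<k}\alpha(h_{i_j})\bigr|$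 for all $k$, all $\alpha\in\overline\Delta_{i_k}$ and all $l<k$. Let $\bar h=\sum_{k=0}^M h_{i_k}$ (a regular element) and $\bar h_0=\sum_{k=1}^M h_{i_k}$; let $\mathfrak p=\bigoplus_{m\le0}\{x:[\bar h_0,x]=mx\}$, with nilradical $\mathfrak n=\bigoplus_{m<0}\{x:[\bar h_0,x]=mx\}$, and let $N\subset G$ be the connected subgroup with Lie algebra $\mathfrak n$, generated by $\exp\mathfrak n$. Let $\mathfrak k$ and $\overline{\mathfrak k}$ be the sums of the root spaces with $\alpha(\bar h)<0$ and with $\alpha(\bar h)>0$, respectively. Let $\mathfrak h^s=\{x\in\mathfrak h: sx=x\}$, let $\mathfrak h_0^\perp$ be its $\kappa$-orthogonal complement in $\mathfrak h$, and let $$r=P_{\mathfrak k}-P_{\overline{\mathfrak k}}+\frac{1+s}{1-s}P_{\mathfrak h_0^\perp},$$ where the $P$'s are the projections of the decomposition $\mathfrak g=\mathfrak k\oplus\overline{\mathfrak k}\oplus\mathfrak h_0^\perp\oplus\mathfrak h^s$. Put $r_\pm=\frac12(r\pm\mathrm{id})$. *Brackets on $G$.* For an invariant form $\langle\cdot,\cdot\rangle$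 on $\mathfrak g$, let the gradients $\nabla\varphi,\nabla'\varphi:G\to\mathfrak g$ be given by $\langle\nabla\varphi(x),\xi\rangle=\frac{d}{dt}\big|_{0}\varphi(e^{t\xi}x)$ and $\langle\nabla'\varphi(x),\xi\rangle=\frac{d}{dt}\big|_{0}\varphi(xe^{t\xi})$, and put $$\{\varphi,\psi\}=\tfrac12\langle r\nabla\varphi,\nabla\psi\rangle-\tfrac12\langle r\nabla'\varphi,\nabla'\psi\rangle,$$ $$\{\varphi,\psi\}_*=\langle r\nabla\varphi,\nabla\psi\rangle+\langle r\nabla'\varphi,\nabla'\psi\rangle-2\langle r_+\nabla'\varphi,\nabla\psi\rangle-2\langle r_-\nabla\varphi,\nabla'\psi\rangle.$$ There are two settings: (a) complex manifolds, holomorphic functions and $\langle\cdot,\cdot\rangle=\kappa$; (b) $G$ regarded as a real Lie group, smooth real manifolds, real-valued $C^\infty$ functions and $\langle\cdot,\cdot\rangle=\operatorname{Re}\kappa$. In either setting "smooth function" means a function of the indicated class, and a Poisson structure on a manifold is a skew-symmetric contravariant 2-tensor whose bracket preserves smoothness and satisfies the Jacobi identity on every open set. **Lemma.** In each of the settings (a)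 and (b): 1. $G$ with the bracket $\{\cdot,\cdot\}$ is a Poisson–Lie group, i.e. this is a Poisson structure for which the multiplication $G\times G\to G$ is a Poisson map. 2. $N$ is an admissible subgroup of this Poisson–Lie group: for every (finite-dimensional) Poisson manifold $M$ with an action of $G$ such that $G\times M\to M$ is a Poisson map, the $N$-invariant smooth functions on $M$ are closed under the Poisson bracket of $M$. 3. The smooth functions on $G$ which are invariant under conjugation by $N$ are closed under the bracket $\{\cdot,\cdot\}_*$. -/

import Mathlib

open scoped Manifold ContDiff

noncomputable section

set_option linter.unusedSectionVars false

universe u v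

namespace PoissonSlices

/-! ## Root-theoretic data -/

section Algebra

open LieAlgebra LieAlgebra.IsKilling LieModule

variable {L : Type*} [LieRing L] [LieAlgebra ℂ L] [FiniteDimensional ℂ L] [IsKilling ℂ L]

/-- The Weyl group of `(L, H)` in its natural action on `H`: the group generated by the
reflections `x ↦ x - α(x) α^∨`, where `α` runs through the roots. -/
def weylGroup (H : LieSubalgebra ℂ L) [H.IsCartanSubalgebra] : Subgroup (H ≃ₗ[ℂ] H) :=
  Subgroup.closure (Set.range (rootSystem H).coreflection)

/-- The real form of the Cartan subalgebra: the real span of the coroots. -/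
def realCartan (H : LieSubalgebra ℂ L) [H.IsCartanSubalgebra] : Submodule ℝ H :=
  Submodule.span ℝ (Set.range (rootSystem H).coroot)

variable {H : LieSubalgebra ℂ L} [H.IsCartanSubalgebra]

/-- `s` acts on the real subspace `V` of `H` either as minus the identity of a line, or as the
rotation of a plane through an angle `θ`, `0 < θ ≤ π` (in some orthonormal basis with respect to
the Killing form). -/
def ActsAsRotation (s : H ≃ₗ[ℂ] H) (V : Submodule ℝ H) : Prop :=
  (Module.finrank ℝ V = 1 ∧ ∀ x ∈ V, s x = -x) ∨
  (Module.finrank ℝ V = 2 ∧ ∃ θ : ℝ, 0 < θ ∧ θ ≤ Real.pi ∧ ∃ e ∈ V, ∃ f ∈ V,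
    killingForm ℂ L e e = 1 ∧ killingForm ℂ L f f = 1 ∧ killingForm ℂ L e f = 0 ∧
    s e = Real.cos θ • e + Real.sin θ • f ∧ s f = -(Real.sin θ) • e + Real.cos θ • f)

/-- For real subspaces with chosen elements `h 0, …, h K` of `H`, the set of roots
`Δ̄ i = {α | h j (α) = 0 for j > i, h i (α) ≠ 0}`. -/
def layer {K : ℕ} (h : Fin (K + 1) → H) (i : Fin (K + 1)) : Set (Weight ℂ H L) :=
  {α | α.IsNonZero ∧ (∀ j, i < j → α (h j) = 0) ∧ α (h i) ≠ 0}

open Classical in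
/-- The indices `i_0 < i_1 < … < i_M`: the index `0`, together with those `i > 0` for which
`Δ̄ i` is not empty. -/
def indices {K : ℕ} (h : Fin (K + 1) → H) : Finset (Fin (K + 1)) :=
  Finset.univ.filter fun i ↦ i = 0 ∨ (layer h i).Nonempty

/-- The choices made in order to attach a parabolic subalgebra to a Weyl group element `s`. -/
structure SliceDatum (H : LieSubalgebra ℂ L) [H.IsCartanSubalgebra] (s : weylGroup H) where
  /-- The number of nontrivial summands of the real Cartan subalgebra. -/
  K : ℕ
  /-- The summands; the order of the summands with positive index is arbitrary. -/
  V : Fin (K + 1) → Submodule ℝ H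
  iSup_eq : ⨆ i, V i = realCartan H
  indep : iSupIndep V
  orthogonal : ∀ i j, i ≠ j → ∀ x ∈ V i, ∀ y ∈ V j, killingForm ℂ L x y = 0
  mem_zero : ∀ x, x ∈ V 0 ↔ x ∈ realCartan H ∧ s.1 x = x
  invariant : ∀ i, ∀ x ∈ V i, s.1 x ∈ V i
  rotation : ∀ i, i ≠ 0 → ActsAsRotation s.1 (V i)
  /-- The chosen elements of the summands. -/
  h : Fin (K + 1) → H
  h_mem : ∀ i, h i ∈ V i
  h_generic : ∀ i, ∀ α : Weight ℂ H L, α.IsNonZero → (∃ x ∈ V i, α x ≠ 0) → α (h i) ≠ 0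
  /-- `|h_{i_k}(α)| > |∑_{l ≤ j < k} h_{i_j}(α)|` for `α` in `Δ̄_{i_k}` and `l < k`. -/
  dominance : ∀ i ∈ indices h, ∀ α ∈ layer h i, ∀ l ∈ indices h, l < i →
    ‖∑ j ∈ (indices h).filter (fun j ↦ l ≤ j ∧ j < i), α (h j)‖ < ‖α (h i)‖

namespace SliceDatum

variable {s : weylGroup H} (D : SliceDatum H s)

/-- The element `h̄ = ∑_{k ≥ 0} h_{i_k}`, which determines the Weyl chamber. -/
def hBar : H := ∑ i ∈ indices D.h, D.h i

/-- The element `h̄₀ = ∑_{k ≥ 1} h_{i_k}`, which determines the parabolic subalgebra. -/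
def hBarZero : H := ∑ i ∈ (indices D.h).erase 0, D.h i

/-- The nilradical `𝔫 = ⨁_{m < 0} {x | [h̄₀, x] = m x}` of the parabolic subalgebra
`𝔭 = ⨁_{m ≤ 0} {x | [h̄₀, x] = m x}`, as a subspace. -/
def nilradical : Submodule ℂ L :=
  ⨆ m : {m : ℝ // m < 0}, (ad ℂ L (D.hBarZero : L)).eigenspace ((m : ℝ) : ℂ)

end SliceDatum

/-- The sum of the root spaces with root in `S`. -/
def rootSum (S : Set (Weight ℂ H L)) : Submodule ℂ L :=
  ⨆ α : {α : Weight ℂ H L // α.IsNonZero ∧ α ∈ S}, (rootSpace H α.1).toSubmodule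

lemma cartan_eq_rootSpace_zero :
    H.toSubmodule = (rootSpace H (0 : H → ℂ)).toSubmodule := by
  rw [LieAlgebra.rootSpace_zero_eq]; rfl

lemma indep_rootSpaces :
    iSupIndep fun χ : H → ℂ ↦ (rootSpace H χ).toSubmodule :=
  LieSubmodule.iSupIndep_toSubmodule.mpr (iSupIndep_genWeightSpace ℂ H L)

lemma rootSum_eq (S : Set (Weight ℂ H L)) :
    rootSum S = ⨆ χ ∈ {χ : H → ℂ | ∃ α : Weight ℂ H L, α.IsNonZero ∧ α ∈ S ∧ (α : H → ℂ) = χ},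
      (rootSpace H χ).toSubmodule := by
  apply le_antisymm
  · refine iSup_le fun α ↦ ?_
    exact le_iSup₂_of_le (α.1 : H → ℂ) ⟨α.1, α.2.1, α.2.2, rfl⟩ le_rfl
  · refine iSup₂_le fun χ hχ ↦ ?_
    obtain ⟨α, h1, h2, rfl⟩ := hχ
    exact le_iSup (fun α : {α : Weight ℂ H L // α.IsNonZero ∧ α ∈ S} ↦
      (rootSpace H α.1).toSubmodule) ⟨α, h1, h2⟩

lemma isCompl_rootSum (S T : Set (Weight ℂ H L))
    (hST : ∀ α : Weight ℂ H L, α.IsNonZero → (α ∈ S ↔ α ∉ T)) :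
    IsCompl (rootSum S) (rootSum T ⊔ H.toSubmodule) := by
  constructor
  · rw [rootSum_eq, rootSum_eq, cartan_eq_rootSpace_zero]
    refine (indep_rootSpaces.disjoint_biSup_biSup
      (s := {χ | ∃ α : Weight ℂ H L, α.IsNonZero ∧ α ∈ S ∧ (α : H → ℂ) = χ})
      (t := {χ | ∃ α : Weight ℂ H L, α.IsNonZero ∧ α ∈ T ∧ (α : H → ℂ) = χ} ∪ {0}) ?_).mono_right ?_
    · rw [Set.disjoint_left]
      rintro χ ⟨α, h1, h2, rfl⟩ (⟨β, h3, h4, h5⟩ | h5)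
      · obtain rfl : β = α := by ext x; exact congrFun h5 x
        exact (hST β h1).1 h2 h4
      · exact h1 h5
    · rw [iSup_union, iSup_singleton]
  · rw [codisjoint_iff_le_sup, ← LieSubmodule.iSup_toSubmodule_eq_top.mpr
      (iSup_genWeightSpace_eq_top' ℂ H L)]
    refine iSup_le fun α ↦ ?_
    by_cases h0 : α.IsZero
    · refine le_sup_of_le_right (le_sup_of_le_right ?_)
      rw [cartan_eq_rootSpace_zero]
      exact le_of_eq (by rw [h0.eq])
    · by_cases hS : α ∈ S
      · exact le_sup_of_le_left (le_iSup (fun α : {α : Weight ℂ H L // α.IsNonZero ∧ α ∈ S} ↦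
          (rootSpace H α.1).toSubmodule) ⟨α, h0, hS⟩)
      · have hT : α ∈ T := by by_contra h; exact hS ((hST α h0).2 h)
        exact le_sup_of_le_right (le_sup_of_le_left
          (le_iSup (fun α : {α : Weight ℂ H L // α.IsNonZero ∧ α ∈ T} ↦
            (rootSpace H α.1).toSubmodule) ⟨α, h0, hT⟩))

/-- The fixed space of `s` in `H`. -/
def fixedSpace (s : weylGroup H) : Submodule ℂ H := LinearMap.ker (s.1.toLinearMap - 1)

/-- The orthogonal complement of the fixed space of `s` in `H` with respect to the Killing form
of `L`. -/
def movedSpace (s : weylGroup H) : Submodule ℂ H :=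
  LinearMap.BilinForm.orthogonal ((killingForm ℂ L).restrict H.toSubmodule) (fixedSpace s)

lemma mem_fixedSpace {s : weylGroup H} {x : H} : x ∈ fixedSpace s ↔ s.1 x = x := by
  simp [fixedSpace, sub_eq_zero]

lemma mem_movedSpace {s : weylGroup H} {x : H} :
    x ∈ movedSpace s ↔ ∀ y : H, s.1 y = y → killingForm ℂ L y x = 0 := by
  simp only [movedSpace, LinearMap.BilinForm.mem_orthogonal_iff, mem_fixedSpace]
  rfl

lemma killingForm_weyl (s : weylGroup H) (x y : H) :
    killingForm ℂ L (s.1 x) (s.1 y) = killingForm ℂ L x y := by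
  obtain ⟨s, hs⟩ := s
  have key : ∀ z w : H, (rootSystem H).CorootForm z w = killingForm ℂ L z w := by
    intro z w; rw [corootForm_rootSystem_eq_killing]; rfl
  simp only [← key]
  induction hs using Subgroup.closure_induction generalizing x y with
  | mem g hg =>
    obtain ⟨i, rfl⟩ := hg
    exact (rootSystem H).flip.rootForm_reflection_reflection_apply i x y
  | one => rfl
  | mul g₁ g₂ _ _ h₁ h₂ => exact (h₁ (g₂ x) (g₂ y)).trans (h₂ x y)
  | inv g _ h =>
    have := h (g⁻¹ x) (g⁻¹ y)
    rw [← LinearEquiv.mul_apply, ← LinearEquiv.mul_apply, mul_inv_cancel] at this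
    exact this.symm

lemma movedSpace_invariant (s : weylGroup H) :
    ∀ x ∈ movedSpace s, s.1.toLinearMap x ∈ movedSpace s := by
  intro x hx
  rw [mem_movedSpace] at hx ⊢
  intro y hy
  rw [← hx y hy]
  conv_lhs => rw [← hy]
  exact killingForm_weyl s y x

lemma exists_pow_eq_one (s : weylGroup H) : ∃ n : ℕ, 0 < n ∧ s.1 ^ n = 1 := by
  have key : ∃ σ : Equiv.Perm H.root, ∀ j,
      s.1 ((rootSystem H).coroot j) = (rootSystem H).coroot (σ j) := by
    obtain ⟨s, hs⟩ := s
    induction hs using Subgroup.closure_induction with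
    | mem g hg =>
      obtain ⟨i, rfl⟩ := hg
      exact ⟨(rootSystem H).reflectionPerm i, fun j ↦
        ((rootSystem H).coroot_reflectionPerm i j).symm⟩
    | one => exact ⟨1, fun j ↦ rfl⟩
    | mul g₁ g₂ _ _ h₁ h₂ =>
      obtain ⟨σ, hσ⟩ := h₁
      obtain ⟨τ, hτ⟩ := h₂
      refine ⟨σ * τ, fun j ↦ ?_⟩
      change g₁ (g₂ _) = _
      rw [hτ, hσ]; rfl
    | inv g _ h =>
      obtain ⟨σ, hσ⟩ := h
      refine ⟨σ⁻¹, fun j ↦ ?_⟩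
      apply g.injective
      rw [hσ, ← LinearEquiv.mul_apply, mul_inv_cancel]
      simp
  obtain ⟨σ, hσ⟩ := key
  have hpow : ∀ (n : ℕ) j, (s.1 ^ n) ((rootSystem H).coroot j) =
      (rootSystem H).coroot ((σ ^ n) j) := by
    intro n
    induction n with
    | zero => intro j; rfl
    | succ n ih =>
      intro j
      rw [pow_succ, pow_succ, LinearEquiv.mul_apply, hσ, ih]; rfl
  refine ⟨orderOf σ, orderOf_pos σ, ?_⟩
  apply LinearEquiv.toLinearMap_injective
  apply LinearMap.ext_on_range (v := (rootSystem H).coroot)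
    (RootPairing.IsRootSystem.span_coroot_eq_top)
  intro j
  change (s.1 ^ orderOf σ) _ = _
  rw [hpow, pow_orderOf_eq_one]; rfl

lemma isCompl_movedSpace (s : weylGroup H) : IsCompl (movedSpace s) (fixedSpace s) := by
  have hrefl : ((killingForm ℂ L).restrict H.toSubmodule).IsRefl :=
    fun x y h ↦ by
      change killingForm ℂ L y x = 0
      rw [LieModule.traceForm_comm]; exact h
  refine IsCompl.symm ?_
  refine (LinearMap.BilinForm.isCompl_orthogonal_iff_disjoint hrefl).2 ?_
  rw [Submodule.disjoint_def]
  intro x hx hx'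
  have hx1 := mem_fixedSpace.1 hx
  have hx2 := mem_movedSpace.1 hx'
  obtain ⟨n, hn, hsn⟩ := exists_pow_eq_one s
  have hfix : ∀ k : ℕ, (s.1 ^ k) x = x := by
    intro k
    induction k with
    | zero => rfl
    | succ k ih => rw [pow_succ, LinearEquiv.mul_apply, hx1, ih]
  have hinv : ∀ (k : ℕ) (y : H),
      killingForm ℂ L x ((s.1 ^ k) y : H) = killingForm ℂ L x y := by
    intro k y
    have := killingForm_weyl (s ^ k) x y
    rw [show (s ^ k).1 = s.1 ^ k from rfl, hfix] at this
    exact this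
  have hall : ∀ y : H, killingForm ℂ L x y = 0 := by
    intro y
    have hf : s.1 (∑ k ∈ Finset.range n, (s.1 ^ k) y) = ∑ k ∈ Finset.range n, (s.1 ^ k) y := by
      have e : ∀ k : ℕ, s.1 ((s.1 ^ k) y) = (s.1 ^ (k + 1)) y := fun k ↦ by
        rw [pow_succ', LinearEquiv.mul_apply]
      rw [map_sum]
      simp only [e]
      have h1 := Finset.sum_range_succ (fun k ↦ (s.1 ^ k) y) n
      have h2 := Finset.sum_range_succ' (fun k ↦ (s.1 ^ k) y) n
      simp only [hsn, pow_zero] at h1 h2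
      exact add_right_cancel (h2.symm.trans h1)
    have h0 := hx2 _ hf
    rw [LieModule.traceForm_comm] at h0
    have h3 : killingForm ℂ L x (((∑ k ∈ Finset.range n, (s.1 ^ k) y : H)) : L) =
        n * killingForm ℂ L x y := by
      rw [AddSubmonoidClass.coe_finsetSum, map_sum]
      simp only [hinv]
      simp
    rw [h3] at h0
    exact (mul_eq_zero.1 h0).resolve_left (by exact_mod_cast hn.ne')
  have hnd := LieAlgebra.IsKilling.traceForm_cartan_nondegenerate ℂ L H
  refine hnd.1 x fun y ↦ ?_
  exact hall y

/-- The action of `s` on the orthogonal complement of its fixed space. -/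
def onMoved (s : weylGroup H) : Module.End ℂ (movedSpace s) :=
  s.1.toLinearMap.restrict (movedSpace_invariant s)

lemma isUnit_one_sub_onMoved (s : weylGroup H) : IsUnit (1 - onMoved s) := by
  rw [LinearMap.isUnit_iff_ker_eq_bot, LinearMap.ker_eq_bot']
  intro x hx
  have h1 : s.1 x = (x : H) := (congrArg Subtype.val (sub_eq_zero.1 hx)).symm
  have := (isCompl_movedSpace s).disjoint
  rw [Submodule.disjoint_def] at this
  exact Subtype.ext (this x x.2 (mem_fixedSpace.2 h1))

/-- The operator `r₀ = (1 + s) / (1 - s) ∘ P` on `H`, where `P` is the orthogonal projection onto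
the orthogonal complement of the fixed space of `s`; `1 - s` is invertible on that complement. -/
def cayley (s : weylGroup H) : Module.End ℂ H :=
  (movedSpace s).subtype ∘ₗ ((1 + onMoved s) * Ring.inverse (1 - onMoved s)) ∘ₗ
    (movedSpace s).projectionOnto (fixedSpace s) (isCompl_movedSpace s)

namespace SliceDatum

variable {s : weylGroup H} (D : SliceDatum H s)

/-- The positive roots with respect to the Weyl chamber of `h̄` (on which roots are real). -/
def positiveRoots : Set (Weight ℂ H L) := {α | α.IsNonZero ∧ 0 < (α D.hBar).re}

/-- The negative roots with respect to the Weyl chamber of `h̄`. -/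
def negativeRoots : Set (Weight ℂ H L) := {α | α.IsNonZero ∧ (α D.hBar).re < 0}

lemma im_eq_zero (α : Weight ℂ H L) (x : H) (hx : x ∈ realCartan H) : (α x).im = 0 := by
  induction hx using Submodule.span_induction with
  | mem x hx =>
    obtain ⟨β, rfl⟩ := hx
    rw [rootSystem_coroot_apply, apply_coroot_eq_cast]
    exact Complex.intCast_im _
  | zero =>
    have : α (0 : H) = 0 := map_zero α.toLinear
    rw [this]; rfl
  | add x y _ _ hx hy =>
    have : α (x + y) = α x + α y := map_add α.toLinear x y
    rw [this, Complex.add_im, hx, hy, add_zero]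
  | smul a x _ hx =>
    have : α (a • x) = (a : ℂ) * α x := map_smul α.toLinear (a : ℂ) x
    rw [this]; simp [hx]

lemma hmem (i) : D.h i ∈ realCartan H := by
  rw [← D.iSup_eq]; exact Submodule.mem_iSup_of_mem i (D.h_mem i)

/-- The element `h̄` is regular. -/
lemma re_hBar_ne_zero (α : Weight ℂ H L) (hα : α.IsNonZero) : (α D.hBar).re ≠ 0 := by
  classical
  have hsum : ∀ S : Finset (Fin (D.K + 1)), α (∑ j ∈ S, D.h j) = ∑ j ∈ S, α (D.h j) :=
    fun S ↦ map_sum α.toLinear _ _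
  have hex : ∃ i, α (D.h i) ≠ 0 := by
    by_contra! hcon
    have hV : ∀ i, ∀ x ∈ D.V i, α x = 0 := by
      intro i x hx
      by_contra h
      exact D.h_generic i α hα ⟨x, hx, h⟩ (hcon i)
    have hle : realCartan H ≤ (LinearMap.ker α.toLinear).restrictScalars ℝ := by
      rw [← D.iSup_eq]
      exact iSup_le fun i x hx ↦ hV i x hx
    have h2 := hle (Submodule.subset_span
      (Set.mem_range_self (⟨α, by simpa using hα⟩ : H.root)))
    have h3 : α (coroot α) = 0 := h2
    rw [root_apply_coroot hα] at h3
    exact two_ne_zero h3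
  obtain ⟨i, hi, hmax⟩ : ∃ i, α (D.h i) ≠ 0 ∧ ∀ j, i < j → α (D.h j) = 0 := by
    obtain ⟨i, hi, hm⟩ := Finset.exists_max_image
      (Finset.univ.filter fun i ↦ α (D.h i) ≠ 0) id (by
        obtain ⟨i, hi⟩ := hex; exact ⟨i, by simpa using hi⟩)
    refine ⟨i, by simpa using hi, fun j hj ↦ ?_⟩
    by_contra h
    exact absurd (hm j (by simpa using h)) (not_le.2 hj)
  have hlay : α ∈ layer D.h i := ⟨hα, hmax, hi⟩
  have hind : i ∈ indices D.h := by
    simp only [indices, Finset.mem_filter, Finset.mem_univ, true_and]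
    exact Or.inr ⟨α, hlay⟩
  have hsplit : α D.hBar = α (D.h i) +
      ∑ j ∈ (indices D.h).filter (fun j ↦ 0 ≤ j ∧ j < i), α (D.h j) := by
    rw [hBar, hsum, ← Finset.add_sum_erase _ _ hind]
    congr 1
    symm
    apply Finset.sum_subset
    · intro j hj
      simp only [Finset.mem_filter, Finset.mem_erase] at hj ⊢
      exact ⟨hj.2.2.ne, hj.1⟩
    · intro j hj hj'
      simp only [Finset.mem_filter, Finset.mem_erase] at hj hj'
      apply hmax
      rcases lt_trichotomy j i with h | h | h
      · exact absurd ⟨hj.2, Fin.zero_le j, h⟩ hj'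
      · exact absurd h hj.1
      · exact h
  have hne : α D.hBar ≠ 0 := by
    by_cases h0 : i = 0
    · rw [hsplit, Finset.sum_eq_zero, add_zero]
      · exact hi
      · intro j hj
        simp only [Finset.mem_filter, h0] at hj
        exact absurd hj.2.2 (not_lt.2 (Fin.zero_le j))
    · have hd := D.dominance i hind α hlay 0 (by simp [indices]) (Fin.pos_iff_ne_zero.2 h0)
      intro h
      rw [hsplit, add_eq_zero_iff_eq_neg] at h
      rw [h, norm_neg] at hd
      exact lt_irrefl _ hd
  have him : (α D.hBar).im = 0 :=
    im_eq_zero α _ (Submodule.sum_mem _ fun i _ ↦ D.hmem i)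
  intro hre
  exact hne (Complex.ext hre him)

/-- The nilradical `𝔨` of the Borel subalgebra which contains `H` and the negative root
vectors. -/
def borelNilradical : Submodule ℂ L := rootSum D.negativeRoots

/-- The nilradical of the opposite Borel subalgebra. -/
def oppositeNilradical : Submodule ℂ L := rootSum D.positiveRoots

lemma isCompl_borelNilradical :
    IsCompl D.borelNilradical (D.oppositeNilradical ⊔ H.toSubmodule) :=
  isCompl_rootSum _ _ fun α hα ↦ by
    have := D.re_hBar_ne_zero α hα
    exact ⟨fun h h' ↦ lt_asymm h.2 h'.2, fun h ↦
      ⟨hα, lt_of_le_of_ne (not_lt.1 fun h' ↦ h ⟨hα, h'⟩) this⟩⟩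

lemma isCompl_oppositeNilradical :
    IsCompl D.oppositeNilradical (D.borelNilradical ⊔ H.toSubmodule) :=
  isCompl_rootSum _ _ fun α hα ↦ by
    have := D.re_hBar_ne_zero α hα
    exact ⟨fun h h' ↦ lt_asymm h.2 h'.2, fun h ↦
      ⟨hα, lt_of_le_of_ne (not_lt.1 fun h' ↦ h ⟨hα, h'⟩) this.symm⟩⟩

lemma isCompl_cartan :
    IsCompl H.toSubmodule (D.borelNilradical ⊔ D.oppositeNilradical) := by
  have h0 : rootSum (∅ : Set (Weight ℂ H L)) = ⊥ := by
    refine le_bot_iff.1 (iSup_le fun α ↦ ?_)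
    exact absurd α.2.2 (Set.notMem_empty _)
  have h1 := isCompl_rootSum (H := H) (L := L) Set.univ ∅ fun α _ ↦
    ⟨fun _ h ↦ h, fun _ ↦ Set.mem_univ _⟩
  rw [h0, bot_sup_eq] at h1
  have h2 : D.borelNilradical ⊔ D.oppositeNilradical =
      rootSum (Set.univ : Set (Weight ℂ H L)) := by
    apply le_antisymm
    · exact sup_le (iSup_le fun α ↦ le_iSup (fun α : {α : Weight ℂ H L // α.IsNonZero ∧
          α ∈ Set.univ} ↦ (rootSpace H α.1).toSubmodule) ⟨α.1, α.2.1, Set.mem_univ _⟩)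
        (iSup_le fun α ↦ le_iSup (fun α : {α : Weight ℂ H L // α.IsNonZero ∧
          α ∈ Set.univ} ↦ (rootSpace H α.1).toSubmodule) ⟨α.1, α.2.1, Set.mem_univ _⟩)
    · refine iSup_le fun α ↦ ?_
      rcases lt_or_gt_of_ne (D.re_hBar_ne_zero α.1 α.2.1) with h | h
      · exact le_sup_of_le_left (le_iSup (fun α : {α : Weight ℂ H L // α.IsNonZero ∧
          α ∈ D.negativeRoots} ↦ (rootSpace H α.1).toSubmodule) ⟨α.1, α.2.1, α.2.1, h⟩)
      · exact le_sup_of_le_right (le_iSup (fun α : {α : Weight ℂ H L // α.IsNonZero ∧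
          α ∈ D.positiveRoots} ↦ (rootSpace H α.1).toSubmodule) ⟨α.1, α.2.1, α.2.1, h⟩)
  rw [h2]
  exact h1.symm

/-- The r-matrix `r = P_𝔨 - P_𝔨̄ + r₀`, the projections being those of the decomposition
`L = 𝔨 ⊕ 𝔨̄ ⊕ H` (and of `H` into the fixed space of `s` and its orthogonal complement). -/
def rMatrix : Module.End ℂ L :=
  D.borelNilradical.projection _ D.isCompl_borelNilradical -
    D.oppositeNilradical.projection _ D.isCompl_oppositeNilradical +
    H.toSubmodule.subtype ∘ₗ cayley s ∘ₗ H.toSubmodule.projectionOnto _ D.isCompl_cartan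

end SliceDatum

end Algebra

/-! ## Poisson geometry

Everything is done over `𝕜 = ℝ` (smooth manifolds and smooth real functions) and over `𝕜 = ℂ`
(complex manifolds and holomorphic functions) at the same time. -/

section Geometry

variable {𝕜 : Type*} [RCLike 𝕜]
  {E : Type*} [NormedAddCommGroup E] [NormedSpace 𝕜 E]
  {H : Type*} [TopologicalSpace H] {I : ModelWithCorners 𝕜 E H}
  {M : Type*} [TopologicalSpace M] [ChartedSpace H M]
  {E' : Type*} [NormedAddCommGroup E'] [NormedSpace 𝕜 E']
  {H' : Type*} [TopologicalSpace H'] {J : ModelWithCorners 𝕜 E' H'}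
  {M' : Type*} [TopologicalSpace M'] [ChartedSpace H' M']

variable (I) in
/-- The cotangent space of `M` at `x`. -/
abbrev Cotangent (x : M) : Type _ := TangentSpace I x →L[𝕜] 𝕜

variable (I) in
/-- The differential of a function at `x`, as a cotangent vector. -/
def differential (f : M → 𝕜) (x : M) : Cotangent I x := mfderiv I 𝓘(𝕜, 𝕜) f x

variable (I M) in
/-- A (not yet smooth or skew-symmetric) contravariant tensor of rank two: a bilinear form on every
cotangent space. -/
abbrev Tensor : Type _ := ∀ x : M, Cotangent I x →ₗ[𝕜] Cotangent I x →ₗ[𝕜] 𝕜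

/-- The bracket `{f, g}(x) = π_x(df, dg)` of functions. -/
def bracket (π : Tensor I M) (f g : M → 𝕜) (x : M) : 𝕜 :=
  π x (differential I f x) (differential I g x)

/-- `π` is a Poisson structure: it is skew-symmetric, and on every open set the bracket maps pairs
of smooth functions to smooth functions and satisfies the Jacobi identity. -/
structure IsPoisson (π : Tensor I M) : Prop where
  skew : ∀ x α β, π x α β = -π x β α
  smooth : ∀ U : Set M, IsOpen U → ∀ f g : M → 𝕜,
    ContMDiffOn I 𝓘(𝕜, 𝕜) ∞ f U → ContMDiffOn I 𝓘(𝕜, 𝕜) ∞ g U →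
      ContMDiffOn I 𝓘(𝕜, 𝕜) ∞ (bracket π f g) U
  jacobi : ∀ U : Set M, IsOpen U → ∀ f g h : M → 𝕜,
    ContMDiffOn I 𝓘(𝕜, 𝕜) ∞ f U → ContMDiffOn I 𝓘(𝕜, 𝕜) ∞ g U →
    ContMDiffOn I 𝓘(𝕜, 𝕜) ∞ h U → ∀ x ∈ U,
      bracket π f (bracket π g h) x + bracket π g (bracket π h f) x +
        bracket π h (bracket π f g) x = 0

/-- The product structure on `M × M'`. -/
def prodTensor (π : Tensor I M) (ρ : Tensor J M') : Tensor (I.prod J) (M × M') := fun p ↦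
  (π p.1).compl₁₂
    (ContinuousLinearMap.precomp 𝕜 (ContinuousLinearMap.inl 𝕜 E E')).toLinearMap
    (ContinuousLinearMap.precomp 𝕜 (ContinuousLinearMap.inl 𝕜 E E')).toLinearMap +
  (ρ p.2).compl₁₂
    (ContinuousLinearMap.precomp 𝕜 (ContinuousLinearMap.inr 𝕜 E E')).toLinearMap
    (ContinuousLinearMap.precomp 𝕜 (ContinuousLinearMap.inr 𝕜 E E')).toLinearMap

/-- `φ` is a Poisson map: it is smooth and intertwines the two tensors. -/
structure IsPoissonMap (π : Tensor I M) (ρ : Tensor J M') (φ : M → M') : Prop where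
  smooth : ContMDiff I J ∞ φ
  map_eq : ∀ (x : M) (α β : Cotangent J (φ x)),
    ρ (φ x) α β = π x (α.comp (mfderiv I J φ x)) (β.comp (mfderiv I J φ x))

/-- For a map `a : A → M → M` (an action of `A`) and a subset `K` of `A`: the `K`-invariant smooth
functions on `M` form a subalgebra of the smooth functions with respect to the bracket of `π`. -/
def InvariantsClosed {A : Type*} (a : A → M → M) (K : Set A) (π : Tensor I M) : Prop :=
  ∀ f g : M → 𝕜, ContMDiff I 𝓘(𝕜, 𝕜) ∞ f → ContMDiff I 𝓘(𝕜, 𝕜) ∞ g →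
    (∀ k ∈ K, ∀ x, f (a k x) = f x) → (∀ k ∈ K, ∀ x, g (a k x) = g x) →
    ContMDiff I 𝓘(𝕜, 𝕜) ∞ (bracket π f g) ∧
      ∀ k ∈ K, ∀ x, bracket π f g (a k x) = bracket π f g x

/-- The Lie group `G`, with the structure `π`, is a Poisson–Lie group. -/
structure IsPoissonLie {G : Type*} [TopologicalSpace G] [ChartedSpace H G] [Group G]
    (π : Tensor I G) : Prop where
  poisson : IsPoisson π
  mul : IsPoissonMap (prodTensor π π) π fun p : G × G ↦ p.1 * p.2

/-- The subgroup `K` of the Poisson–Lie group `(G, π)` is admissible: for every Poisson action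
of `G` on a Poisson manifold `M`, the `K`-invariant functions form a Poisson subalgebra. -/
def IsAdmissible {G : Type*} [TopologicalSpace G] [ChartedSpace H G] [Group G]
    (π : Tensor I G) (K : Subgroup G) : Prop :=
  ∀ (F : Type u) [NormedAddCommGroup F] [NormedSpace 𝕜 F] [FiniteDimensional 𝕜 F]
    (M : Type v) [TopologicalSpace M] [ChartedSpace F M] [IsManifold 𝓘(𝕜, F) ∞ M]
    [MulAction G M] (ρ : Tensor 𝓘(𝕜, F) M),
    IsPoisson ρ → IsPoissonMap (prodTensor π ρ) ρ (fun p : G × M ↦ p.1 • p.2) →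
      InvariantsClosed (fun (g : G) (x : M) ↦ g • x) (K : Set G) ρ

end Geometry

section Group

variable {𝕜 : Type*} [RCLike 𝕜] {E : Type*} [NormedAddCommGroup E] [NormedSpace 𝕜 E]
  {G : Type*} [TopologicalSpace G] [ChartedSpace E G] [Group G]

instance [FiniteDimensional 𝕜 E] : FiniteDimensional 𝕜 (GroupLieAlgebra 𝓘(𝕜, E) G) :=
  inferInstanceAs (FiniteDimensional 𝕜 E)

/-- The map `ξ ↦ d/dt|₀ e^{tξ} x`. -/
def rightTranslation (x : G) : GroupLieAlgebra 𝓘(𝕜, E) G →L[𝕜] TangentSpace 𝓘(𝕜, E) x :=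
  mfderiv 𝓘(𝕜, E) 𝓘(𝕜, E) (fun y : G ↦ y * x) 1

/-- The map `ξ ↦ d/dt|₀ x e^{tξ}`. -/
def leftTranslation (x : G) : GroupLieAlgebra 𝓘(𝕜, E) G →L[𝕜] TangentSpace 𝓘(𝕜, E) x :=
  mfderiv 𝓘(𝕜, E) 𝓘(𝕜, E) (fun y : G ↦ x * y) 1

variable [FiniteDimensional 𝕜 E]
  (B : LinearMap.BilinForm 𝕜 (GroupLieAlgebra 𝓘(𝕜, E) G)) (hB : B.Nondegenerate)

/-- The left gradient at `x`: the vector `∇` with `B(∇, ξ) = α(d/dt|₀ e^{tξ} x)` for all `ξ`, where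
`α` is the differential of the function at `x`. -/
def leftGradient (x : G) : Cotangent 𝓘(𝕜, E) x →ₗ[𝕜] GroupLieAlgebra 𝓘(𝕜, E) G where
  toFun α := (B.toDual hB).symm (α.comp (rightTranslation x)).toLinearMap
  map_add' α β := by
    rw [← map_add]; congr 1
  map_smul' c α := by
    rw [RingHom.id_apply, ← map_smul]; congr 1

/-- The right gradient at `x`: the vector `∇'` with `B(∇', ξ) = α(d/dt|₀ x e^{tξ})` for all `ξ`,
where `α` is the differential of the function at `x`. -/
def rightGradient (x : G) : Cotangent 𝓘(𝕜, E) x →ₗ[𝕜] GroupLieAlgebra 𝓘(𝕜, E) G where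
  toFun α := (B.toDual hB).symm (α.comp (leftTranslation x)).toLinearMap
  map_add' α β := by
    rw [← map_add]; congr 1
  map_smul' c α := by
    rw [RingHom.id_apply, ← map_smul]; congr 1

variable (r : Module.End 𝕜 (GroupLieAlgebra 𝓘(𝕜, E) G))

/-- The bracket `{φ, ψ} = ½ ⟨r ∇φ, ∇ψ⟩ - ½ ⟨r ∇'φ, ∇'ψ⟩` on `G`. -/
def poissonLieTensor : Tensor 𝓘(𝕜, E) G := fun x ↦
  (1 / 2 : 𝕜) • B.compl₁₂ (r ∘ₗ leftGradient B hB x) (leftGradient B hB x) -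
  (1 / 2 : 𝕜) • B.compl₁₂ (r ∘ₗ rightGradient B hB x) (rightGradient B hB x)

/-- The bracket
`{φ, ψ}_* = ⟨r ∇φ, ∇ψ⟩ + ⟨r ∇'φ, ∇'ψ⟩ - 2 ⟨r₊ ∇'φ, ∇ψ⟩ - 2 ⟨r₋ ∇φ, ∇'ψ⟩` on `G`, where
`r₊ = ½ (r + id)` and `r₋ = ½ (r - id)`. -/
def dualTensor : Tensor 𝓘(𝕜, E) G := fun x ↦
  B.compl₁₂ (r ∘ₗ leftGradient B hB x) (leftGradient B hB x) +
  B.compl₁₂ (r ∘ₗ rightGradient B hB x) (rightGradient B hB x) -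
  (2 : 𝕜) • B.compl₁₂ (((1 / 2 : 𝕜) • (r + 1)) ∘ₗ rightGradient B hB x) (leftGradient B hB x) -
  (2 : 𝕜) • B.compl₁₂ (((1 / 2 : 𝕜) • (r - 1)) ∘ₗ leftGradient B hB x) (rightGradient B hB x)

end Group

section ComplexGroup

variable {E : Type*} [NormedAddCommGroup E] [NormedSpace ℂ E]
  {G : Type*} [TopologicalSpace G] [ChartedSpace E G] [Group G]

/-- The exponential relation: `g = exp v`, that is, `g = γ 1` for the integral curve `γ`
with `γ 0 = 1` of the left-invariant vector field with value `v` at the unit element. Here `G` is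
regarded as a real manifold. -/
def IsExp (v : GroupLieAlgebra 𝓘(ℝ, E) G) (g : G) : Prop :=
  ∃ γ : ℝ → G, γ 0 = 1 ∧ IsMIntegralCurve (I := 𝓘(ℝ, E)) γ (mulInvariantVectorField v) ∧ γ 1 = g

/-- The connected Lie subgroup of `G` with Lie algebra `n`: the subgroup generated by the elements
`exp v` with `v` in `n`. -/
def lieSubgroup (n : Submodule ℂ (GroupLieAlgebra 𝓘(ℂ, E) G)) : Subgroup G :=
  Subgroup.closure {g | ∃ v ∈ n, IsExp v g}

variable [FiniteDimensional ℂ E]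

/-- The real part of a complex bilinear form on the Lie algebra of `G`, as a real bilinear form on
the tangent space at the unit element of the real Lie group underlying `G`. -/
def realForm (B : LinearMap.BilinForm ℂ (GroupLieAlgebra 𝓘(ℂ, E) G)) :
    LinearMap.BilinForm ℝ (GroupLieAlgebra 𝓘(ℝ, E) G) :=
  let B' : LinearMap.BilinForm ℂ E := B
  show LinearMap.BilinForm ℝ E from
  LinearMap.mk₂ ℝ (fun X Y : E ↦ (B' X Y).re)
    (fun X X' Y ↦ by rw [map_add, LinearMap.add_apply, Complex.add_re])
    (fun c X Y ↦ by
      rw [← Complex.coe_smul, map_smul, LinearMap.smul_apply, smul_eq_mul, Complex.re_ofReal_mul,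
        smul_eq_mul])
    (fun X Y Y' ↦ by rw [map_add, Complex.add_re])
    (fun c X Y ↦ by
      rw [← Complex.coe_smul, map_smul, smul_eq_mul, Complex.re_ofReal_mul, smul_eq_mul])

lemma realForm_nondegenerate {B : LinearMap.BilinForm ℂ (GroupLieAlgebra 𝓘(ℂ, E) G)}
    (hB : B.Nondegenerate) : (realForm B).Nondegenerate := by
  have aux : ∀ z w : ℂ, z.re = 0 → w.re = 0 → w = Complex.I * z → z = 0 := by
    rintro ⟨a, b⟩ w h1 h2 rfl
    simp only [Complex.mul_re, Complex.I_re, Complex.I_im] at h1 h2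
    exact Complex.ext h1 (by simpa using h2)
  constructor
  · intro X hX
    refine hB.1 X fun Y ↦ ?_
    exact aux _ _ (hX Y) (hX ((Complex.I • (Y : E) : E))) (map_smul (B X) Complex.I Y)
  · intro Y hY
    refine hB.2 Y fun X ↦ ?_
    exact aux _ _ (hY X) (hY ((Complex.I • (X : E) : E)))
      (by change B (Complex.I • X) Y = _; rw [map_smul]; rfl)

/-- A complex-linear operator on the Lie algebra of `G`, regarded as a real-linear one. -/
def realEnd (r : Module.End ℂ (GroupLieAlgebra 𝓘(ℂ, E) G)) :
    Module.End ℝ (GroupLieAlgebra 𝓘(ℝ, E) G) where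
  toFun := r
  map_add' X Y := r.map_add X Y
  map_smul' c X := r.map_smul (c : ℂ) X

variable [CompleteSpace E] [LieGroup 𝓘(ℂ, E) ω G]
  [LieAlgebra.IsSimple ℂ (GroupLieAlgebra 𝓘(ℂ, E) G)]

variable (E G) in
/-- The Killing form of the Lie algebra of `G`. -/
abbrev killing : LinearMap.BilinForm ℂ (GroupLieAlgebra 𝓘(ℂ, E) G) :=
  killingForm ℂ (GroupLieAlgebra 𝓘(ℂ, E) G)

variable (E G) in
lemma killing_nondegenerate : (killing E G).Nondegenerate :=
  LieAlgebra.IsKilling.killingForm_nondegenerate ℂ _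

namespace SliceDatum

variable {H : LieSubalgebra ℂ (GroupLieAlgebra 𝓘(ℂ, E) G)} [H.IsCartanSubalgebra]
  {s : weylGroup H} (D : SliceDatum H s)

/-- The unipotent radical `N`: the connected subgroup of `G` with Lie algebra `𝔫`. -/
def unipotentRadical : Subgroup G := lieSubgroup D.nilradical

/-- The Poisson–Lie structure of the complex Lie group `G` defined by the r-matrix and the Killing
form. -/
def complexPoisson : Tensor 𝓘(ℂ, E) G :=
  poissonLieTensor (killing E G) (killing_nondegenerate E G) D.rMatrix

/-- The structure of `G_*`, in the complex setting. -/
def complexDual : Tensor 𝓘(ℂ, E) G :=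
  dualTensor (killing E G) (killing_nondegenerate E G) D.rMatrix

/-- The Poisson–Lie structure of the real Lie group `G` defined by the r-matrix and the real part
of the Killing form. -/
def realPoisson : Tensor 𝓘(ℝ, E) G :=
  poissonLieTensor (realForm (killing E G)) (realForm_nondegenerate (killing_nondegenerate E G))
    (realEnd D.rMatrix)

/-- The structure of `G_*`, in the real setting. -/
def realDual : Tensor 𝓘(ℝ, E) G :=
  dualTensor (realForm (killing E G)) (realForm_nondegenerate (killing_nondegenerate E G))
    (realEnd D.rMatrix)

end SliceDatum

end ComplexGroup

end PoissonSlices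

/-! Everything reduces to algebra of two kinds of derivatives on `G`: `rightDer` (along `e^{tξ}x`)
and `leftDer` (along `xe^{tξ}`). They commute with each other, represent the Lie bracket up to sign,
and are related by `leftDer f x = rightDer f x ∘ Ad x`. With `A = sharp B hB r`, the operator `r`
composed with the identification of functionals and vectors by `B`, the bracket is `½ d^R g (A d^R
f) - ½ d^L g (A d^L f)`.

Poisson–Lie property. Because `A` is skew, the Jacobiator at `x` is a quarter of the Schouten square
of `A` on left differentials minus the same on right differentials (`translationBracket_jacobi`).
The modified Yang–Baxter equation turns the square into minus the invariant trilinear form `B(Z, [X,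
Y])` (`IsRMatrix.cyclic`), and `Ad`-invariance makes the difference zero. Multiplicativity is a
cancellation: the left term at `x` and the right term at `y` coincide on functionals pulled back by
`(x, y) ↦ xy`.

Admissibility. If `f` and `g` are `N`-invariant on `M`, then `{f, g}(kx)` equals `{f, g}(x)` plus
the bracket at `k` of the orbit functions `y ↦ f(yx)` and `y ↦ g(yx)`. Their right gradients at `k`
lie in `𝔫^⊥`. There `Ad k` is the identity modulo `𝔫`, while `𝔫` is isotropic and `r`-stable, so
both halves of the bracket agree (`IsRMatrix.pairing_comp_adj`). For the conjugation action, the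
dual bracket splits into an `r`-term depending only on `d^R - d^L`, to which the same lemma applies,
and terms that are manifestly `Ad`-invariant.

The structure of `s` enters in two places. Skewness of the Cayley transform on the Cartan subalgebra
makes `r` skew. The dominance condition shows that roots negative on `h̄₀` are negative on `h̄`
(`SliceDatum.re_hBar_neg`), so that `𝔫 ⊆ 𝔨` and `r` is the identity on `𝔫`. That `Ad k` moves `𝔫^⊥`
only by `𝔫` follows from `Ad (exp v) = exp (ad v)` and `[𝔫, 𝔫^⊥] ⊆ 𝔫`.

The geometry is carried out over a field `𝕜` that is `ℝ` or `ℂ`, under the hypotheses `IsRMatrix`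
and `IsIsotropicSubgroup`; these are checked for the Killing form over `ℂ` and for its real part
over `ℝ`. -/

namespace PoissonSlices

open Set Filter Topology

/-! ### Second-order calculus in normed spaces -/

section Calculus

variable {𝕜 : Type*} [RCLike 𝕜] {E : Type*} [NormedAddCommGroup E] [NormedSpace 𝕜 E]
  {F : Type*} [NormedAddCommGroup F] [NormedSpace 𝕜 F]

/-- The commutator of two vector fields, as derivations, is their Lie bracket. -/
theorem fderiv_lieBracket {f : E → F} {a : E} (hf : ContDiffAt 𝕜 2 f a) {V W : E → E}
    (hV : DifferentiableAt 𝕜 V a) (hW : DifferentiableAt 𝕜 W a) :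
    fderiv 𝕜 (fun y ↦ fderiv 𝕜 f y (W y)) a (V a) -
      fderiv 𝕜 (fun y ↦ fderiv 𝕜 f y (V y)) a (W a) =
    fderiv 𝕜 f a (VectorField.lieBracket 𝕜 V W a) := by
  have hd : DifferentiableAt 𝕜 (fderiv 𝕜 f) a :=
    (hf.fderiv_right (m := 1) (by norm_num)).differentiableAt (by norm_num)
  have hs : IsSymmSndFDerivAt 𝕜 f a := hf.isSymmSndFDerivAt (by simp)
  rw [fderiv_clm_apply hd hW, fderiv_clm_apply hd hV]
  simp only [VectorField.lieBracket, add_apply,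
    ContinuousLinearMap.comp_apply, ContinuousLinearMap.flip_apply, map_sub]
  rw [hs (V a) (W a)]
  abel

/-- Mixed partial derivatives commute. -/
theorem fderiv_fderiv_comm {E' : Type*} [NormedAddCommGroup E'] [NormedSpace 𝕜 E']
    {Φ : E × E' → F} {a : E} {b : E'} (hΦ : ContDiffAt 𝕜 2 Φ (a, b)) (ξ : E) (η : E') :
    fderiv 𝕜 (fun x ↦ fderiv 𝕜 (fun y ↦ Φ (x, y)) b η) a ξ =
      fderiv 𝕜 (fun y ↦ fderiv 𝕜 (fun x ↦ Φ (x, y)) a ξ) b η := by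
  have hd : DifferentiableAt 𝕜 (fderiv 𝕜 Φ) (a, b) :=
    (hΦ.fderiv_right (m := 1) (by norm_num)).differentiableAt (by norm_num)
  have hs : IsSymmSndFDerivAt 𝕜 Φ (a, b) := hΦ.isSymmSndFDerivAt (by simp)
  have hev : ∀ᶠ p in 𝓝 (a, b), DifferentiableAt 𝕜 Φ p :=
    ((hΦ.eventually (by simp)).mono fun p hp ↦ hp.differentiableAt (by norm_num))
  have hl : ∀ b : E', ∀ x, HasFDerivAt (fun x : E ↦ (x, b)) (ContinuousLinearMap.inl 𝕜 E E') x :=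
    fun b x ↦ hasFDerivAt_prodMk_left x b
  have hr : ∀ a : E, ∀ y, HasFDerivAt (fun y : E' ↦ (a, y)) (ContinuousLinearMap.inr 𝕜 E E') y :=
    fun a y ↦ hasFDerivAt_prodMk_right a y
  have h1 : (fun x ↦ fderiv 𝕜 (fun y ↦ Φ (x, y)) b η) =ᶠ[𝓝 a]
      fun x ↦ fderiv 𝕜 Φ (x, b) (0, η) := by
    have : Tendsto (fun x : E ↦ (x, b)) (𝓝 a) (𝓝 (a, b)) :=
      (hl b a).continuousAt
    filter_upwards [this.eventually hev] with x hx
    have := hx.hasFDerivAt.comp b (hr x b)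
    rw [show (fun y ↦ Φ (x, y)) = Φ ∘ fun y ↦ (x, y) from rfl, this.fderiv]
    simp
  have h2 : (fun y ↦ fderiv 𝕜 (fun x ↦ Φ (x, y)) a ξ) =ᶠ[𝓝 b]
      fun y ↦ fderiv 𝕜 Φ (a, y) (ξ, 0) := by
    have : Tendsto (fun y : E' ↦ (a, y)) (𝓝 b) (𝓝 (a, b)) :=
      (hr a b).continuousAt
    filter_upwards [this.eventually hev] with y hy
    have := hy.hasFDerivAt.comp a (hl y a)
    rw [show (fun x ↦ Φ (x, y)) = Φ ∘ fun x ↦ (x, y) from rfl, this.fderiv]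
    simp
  rw [h1.fderiv_eq, h2.fderiv_eq]
  have e1 : HasFDerivAt (fun x ↦ fderiv 𝕜 Φ (x, b) (0, η))
      ((ContinuousLinearMap.apply 𝕜 F ((0, η) : E × E')).comp
        ((fderiv 𝕜 (fderiv 𝕜 Φ) (a, b)).comp (ContinuousLinearMap.inl 𝕜 E E'))) a :=
    (ContinuousLinearMap.apply 𝕜 F ((0, η) : E × E')).hasFDerivAt.comp a
      (hd.hasFDerivAt.comp a (hl b a))
  have e2 : HasFDerivAt (fun y ↦ fderiv 𝕜 Φ (a, y) (ξ, 0))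
      ((ContinuousLinearMap.apply 𝕜 F ((ξ, 0) : E × E')).comp
        ((fderiv 𝕜 (fderiv 𝕜 Φ) (a, b)).comp (ContinuousLinearMap.inr 𝕜 E E'))) b :=
    (ContinuousLinearMap.apply 𝕜 F ((ξ, 0) : E × E')).hasFDerivAt.comp b
      (hd.hasFDerivAt.comp b (hr a b))
  rw [e1.fderiv, e2.fderiv]
  simp only [ContinuousLinearMap.comp_apply, ContinuousLinearMap.apply_apply,
    ContinuousLinearMap.inl_apply, ContinuousLinearMap.inr_apply]
  exact hs (ξ, 0) (0, η)

end Calculus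

/-! ### Derivatives and Lie brackets of vector fields on manifolds -/

section Manifold

variable {𝕜 : Type*} [RCLike 𝕜] {E : Type*} [NormedAddCommGroup E] [NormedSpace 𝕜 E]
  [CompleteSpace E]
  {F : Type*} [NormedAddCommGroup F] [NormedSpace 𝕜 F]
  {M : Type*} [TopologicalSpace M] [ChartedSpace E M] [IsManifold 𝓘(𝕜, E) ω M]

variable (𝕜 E) in
/-- The derivative at `x` of a function `f` with values in a normed space. -/
def totalDeriv (f : M → F) (x : M) : E →L[𝕜] F := mfderiv 𝓘(𝕜, E) 𝓘(𝕜, F) f x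

theorem totalDeriv_eq_fderiv {f : M → F} {x : M} (hf : MDifferentiableAt 𝓘(𝕜, E) 𝓘(𝕜, F) f x) :
    totalDeriv 𝕜 E f x = fderiv 𝕜 (f ∘ (extChartAt 𝓘(𝕜, E) x).symm) (extChartAt 𝓘(𝕜, E) x x) := by
  have h : HasFDerivWithinAt (f ∘ (extChartAt 𝓘(𝕜, E) x).symm) (totalDeriv 𝕜 E f x)
      (range 𝓘(𝕜, E)) (extChartAt 𝓘(𝕜, E) x x) := hf.hasMFDerivAt.2
  rw [modelWithCornersSelf_coe, range_id, hasFDerivWithinAt_univ] at h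
  exact h.fderiv.symm

theorem contDiffAt_comp_extChartAt_symm {E : Type*} [NormedAddCommGroup E] [NormedSpace 𝕜 E]
    {H : Type*} [TopologicalSpace H] {I : ModelWithCorners 𝕜 E H} [I.Boundaryless]
    {M : Type*} [TopologicalSpace M] [ChartedSpace H M] {n : ℕ∞ω} {f : M → F} {x : M}
    (hf : ContMDiffAt I 𝓘(𝕜, F) n f x) :
    ContDiffAt 𝕜 n (f ∘ (extChartAt I x).symm) (extChartAt I x x) := by
  have h : ContDiffWithinAt 𝕜 n (f ∘ (extChartAt I x).symm) (range I)
    (extChartAt I x x) := (contMDiffAt_iff.1 hf).2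
  rwa [I.range_eq_univ, contDiffWithinAt_univ] at h

theorem eventually_target {x : M} :
    ∀ᶠ y in 𝓝 (extChartAt 𝓘(𝕜, E) x x), y ∈ (extChartAt 𝓘(𝕜, E) x).target :=
  (isOpen_extChartAt_target x).mem_nhds (mem_extChartAt_target x)

theorem totalDeriv_comp_extChartAt {H : E → F} {x : M}
    (hH : DifferentiableAt 𝕜 H (extChartAt 𝓘(𝕜, E) x x)) :
    totalDeriv 𝕜 E (H ∘ extChartAt 𝓘(𝕜, E) x) x = fderiv 𝕜 H (extChartAt 𝓘(𝕜, E) x x) := by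
  have h1 : MDifferentiableAt 𝓘(𝕜, E) 𝓘(𝕜, F) (H ∘ extChartAt 𝓘(𝕜, E) x) x :=
    hH.mdifferentiableAt.comp x (mdifferentiableAt_extChartAt (mem_chart_source E x))
  rw [totalDeriv_eq_fderiv h1]
  apply Filter.EventuallyEq.fderiv_eq
  filter_upwards [eventually_target (𝕜 := 𝕜) (x := x)] with y hy
  rw [Function.comp_apply, Function.comp_apply, (extChartAt 𝓘(𝕜, E) x).right_inv hy]

theorem eventuallyEq_comp_extChartAt {u : M → F} {H : E → F} {x : M}
    (h : u ∘ (extChartAt 𝓘(𝕜, E) x).symm =ᶠ[𝓝 (extChartAt 𝓘(𝕜, E) x x)] H) :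
    u =ᶠ[𝓝 x] H ∘ extChartAt 𝓘(𝕜, E) x := by
  have h1 := (continuousAt_extChartAt (I := 𝓘(𝕜, E)) x).eventually h
  filter_upwards [h1, extChartAt_source_mem_nhds (I := 𝓘(𝕜, E)) x] with y hy hy'
  rw [Function.comp_apply, ← hy, Function.comp_apply, (extChartAt 𝓘(𝕜, E) x).left_inv hy']

theorem totalDeriv_congr {f g : M → F} {x : M} (h : f =ᶠ[𝓝 x] g) :
    totalDeriv 𝕜 E f x = totalDeriv 𝕜 E g x := by
  have := h.mfderiv_eq (I := 𝓘(𝕜, E)) (I' := 𝓘(𝕜, F))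
  exact this

/-- The derivative of the inverse chart cancels against its inverse in the pullback, so
differentiating along a vector field may be done in the chart. -/
theorem fderiv_comp_extChartAt_symm {f : M → F} {x : M} {y : E}
    (hy : y ∈ (extChartAt 𝓘(𝕜, E) x).target)
    (hf : MDifferentiableAt 𝓘(𝕜, E) 𝓘(𝕜, F) f ((extChartAt 𝓘(𝕜, E) x).symm y))
    (V : ∀ z : M, TangentSpace 𝓘(𝕜, E) z) :
    fderiv 𝕜 (f ∘ (extChartAt 𝓘(𝕜, E) x).symm) y
      (VectorField.mpullbackWithin 𝓘(𝕜, E) 𝓘(𝕜, E) (extChartAt 𝓘(𝕜, E) x).symm V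
        (range 𝓘(𝕜, E)) y) =
      totalDeriv 𝕜 E f ((extChartAt 𝓘(𝕜, E) x).symm y) (V ((extChartAt 𝓘(𝕜, E) x).symm y)) := by
  have h1 := mdifferentiableWithinAt_extChartAt_symm hy
  have hinv := isInvertible_mfderivWithin_extChartAt_symm hy
  rw [VectorField.mpullbackWithin_apply]
  have h2 : mfderivWithin 𝓘(𝕜, E) 𝓘(𝕜, F) (f ∘ (extChartAt 𝓘(𝕜, E) x).symm) (range 𝓘(𝕜, E)) y =
      (mfderiv 𝓘(𝕜, E) 𝓘(𝕜, F) f ((extChartAt 𝓘(𝕜, E) x).symm y)).comp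
      (mfderivWithin 𝓘(𝕜, E) 𝓘(𝕜, E) (extChartAt 𝓘(𝕜, E) x).symm (range 𝓘(𝕜, E)) y) :=
    mfderiv_comp_mfderivWithin y hf h1 (by simpa using uniqueMDiffWithinAt_univ _)
  have h3 : mfderivWithin 𝓘(𝕜, E) 𝓘(𝕜, F) (f ∘ (extChartAt 𝓘(𝕜, E) x).symm)
      (range 𝓘(𝕜, E)) y = fderiv 𝕜 (f ∘ (extChartAt 𝓘(𝕜, E) x).symm) y := by
    simp only [modelWithCornersSelf_coe, range_id, mfderivWithin_univ, mfderiv_eq_fderiv]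
    rfl
  rw [← h3, h2]
  have h4 := hinv.self_apply_inverse (V ((extChartAt 𝓘(𝕜, E) x).symm y))
  exact congrArg (totalDeriv 𝕜 E f ((extChartAt 𝓘(𝕜, E) x).symm y)) h4

/-- The commutator of two vector fields on a manifold, as derivations, is their Lie bracket. -/
theorem totalDeriv_mlieBracket {f : M → F} {x : M}
    (hf : ContMDiffAt 𝓘(𝕜, E) 𝓘(𝕜, F) 2 f x) {V W : ∀ z : M, TangentSpace 𝓘(𝕜, E) z}
    (hV : MDifferentiableAt 𝓘(𝕜, E) 𝓘(𝕜, E).tangent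
      (fun z ↦ (V z : TangentBundle 𝓘(𝕜, E) M)) x)
    (hW : MDifferentiableAt 𝓘(𝕜, E) 𝓘(𝕜, E).tangent
      (fun z ↦ (W z : TangentBundle 𝓘(𝕜, E) M)) x) :
    totalDeriv 𝕜 E (fun y ↦ totalDeriv 𝕜 E f y (W y)) x (V x) -
      totalDeriv 𝕜 E (fun y ↦ totalDeriv 𝕜 E f y (V y)) x (W x) =
    totalDeriv 𝕜 E f x (VectorField.mlieBracket 𝓘(𝕜, E) V W x) := by
  set φ := extChartAt 𝓘(𝕜, E) x with hφ
  have hf' := contDiffAt_comp_extChartAt_symm hf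
  -- Both fields are read in the one chart at `x`. Its derivative at `x` is the identity, so values
  -- at `x` are unchanged, and iterated derivatives become iterated derivatives in the model space.
  have key : ∀ U : ∀ z : M, TangentSpace 𝓘(𝕜, E) z, MDifferentiableAt 𝓘(𝕜, E) 𝓘(𝕜, E).tangent
      (fun z ↦ (U z : TangentBundle 𝓘(𝕜, E) M)) x → ∃ Û : E → E,
      Û = VectorField.mpullbackWithin 𝓘(𝕜, E) 𝓘(𝕜, E) φ.symm U (range 𝓘(𝕜, E)) ∧
      DifferentiableAt 𝕜 Û (φ x) ∧ Û (φ x) = U x ∧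
      totalDeriv 𝕜 E (fun y ↦ totalDeriv 𝕜 E f y (U y)) x =
        fderiv 𝕜 (fun y ↦ fderiv 𝕜 (f ∘ φ.symm) y (Û y)) (φ x) := by
    intro U hU
    obtain ⟨Û, hÛ⟩ : ∃ Û : E → E, Û =
      VectorField.mpullbackWithin 𝓘(𝕜, E) 𝓘(𝕜, E) φ.symm U (range 𝓘(𝕜, E)) := ⟨_, rfl⟩
    have hU' : DifferentiableWithinAt 𝕜 Û (φ.symm ⁻¹' univ ∩ range 𝓘(𝕜, E)) (φ x) := by
      rw [hÛ]
      exact (mdifferentiableWithinAt_univ.2 hU)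
        |>.differentiableWithinAt_mpullbackWithin_vectorField
    rw [preimage_univ, univ_inter, modelWithCornersSelf_coe, range_id,
      differentiableWithinAt_univ] at hU'
    refine ⟨Û, hÛ, hU', ?_, ?_⟩
    · have h := mfderivWithin_extChartAt_symm_inverse_apply (I := 𝓘(𝕜, E)) (x := x) (U x)
      rw [hÛ, VectorField.mpullbackWithin_apply]
      have e : φ.symm (φ x) = x := extChartAt_to_inv x
      have : ∀ z : M, z = x → (U z : E) = U x := by rintro z rfl; rfl
      exact (congrArg (fun v : E ↦ (mfderivWithin 𝓘(𝕜, E) 𝓘(𝕜, E) φ.symm (range 𝓘(𝕜, E))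
        (φ x)).inverse v) (this _ e)).trans h
    · rw [← totalDeriv_comp_extChartAt]
      · apply totalDeriv_congr
        apply eventuallyEq_comp_extChartAt
        have h2 : ∀ᶠ z in 𝓝 x, MDifferentiableAt 𝓘(𝕜, E) 𝓘(𝕜, F) f z :=
          ((contMDiffAt_iff_contMDiffAt_nhds (by simp)).1 hf).mono
            fun z hz ↦ hz.mdifferentiableAt (by norm_num)
        have h3 : Tendsto φ.symm (𝓝 (φ x)) (𝓝 x) := by
          have := continuousAt_extChartAt_symm (I := 𝓘(𝕜, E)) x
          rwa [ContinuousAt, extChartAt_to_inv] at this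
        filter_upwards [eventually_target (𝕜 := 𝕜) (x := x), h3.eventually h2] with y hy hy'
        rw [hÛ]
        exact (fderiv_comp_extChartAt_symm hy hy' U).symm
      · exact DifferentiableAt.clm_apply
          (((hf'.fderiv_right (m := 1) (by norm_num)).differentiableAt (by norm_num))) hU'
  obtain ⟨V', hV1, hV2, hV3, hV4⟩ := key V hV
  obtain ⟨W', hW1, hW2, hW3, hW4⟩ := key W hW
  rw [hV4, hW4, ← hV3, ← hW3, fderiv_lieBracket hf' hV2 hW2,
    totalDeriv_eq_fderiv (hf.mdifferentiableAt (by norm_num))]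
  congr 1
  rw [VectorField.mlieBracket, VectorField.mlieBracketWithin_apply, mfderiv_extChartAt_self]
  rw [← hφ, ← hV1, ← hW1, preimage_univ, univ_inter, modelWithCornersSelf_coe, range_id,
    VectorField.lieBracketWithin_univ]
  exact (congrArg (fun L : E →L[𝕜] E ↦ L (VectorField.lieBracket 𝕜 V' W' (φ x)))
    (ContinuousLinearMap.inverse_id (R := 𝕜) (M := E))).symm

end Manifold

/-! ### Partial derivatives on a product of manifolds -/

section Parameters

variable {𝕜 : Type*} [RCLike 𝕜] {E : Type*} [NormedAddCommGroup E] [NormedSpace 𝕜 E] [CompleteSpace E]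
  {E' : Type*} [NormedAddCommGroup E'] [NormedSpace 𝕜 E'] [CompleteSpace E']
  {F : Type*} [NormedAddCommGroup F] [NormedSpace 𝕜 F]
  {M : Type*} [TopologicalSpace M] [ChartedSpace E M] [IsManifold 𝓘(𝕜, E) ω M]
  {N : Type*} [TopologicalSpace N] [ChartedSpace E' N] [IsManifold 𝓘(𝕜, E') ω N]

theorem contDiffAt_comp_extChartAt_symm_prod {Φ : M → N → F} {x : M} {y : N}
    (hΦ : ContMDiffAt (𝓘(𝕜, E).prod 𝓘(𝕜, E')) 𝓘(𝕜, F) ∞ (Function.uncurry Φ) (x, y)) :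
    ContDiffAt 𝕜 ∞ (fun p : E × E' ↦ Φ ((extChartAt 𝓘(𝕜, E) x).symm p.1)
      ((extChartAt 𝓘(𝕜, E') y).symm p.2))
      (extChartAt 𝓘(𝕜, E) x x, extChartAt 𝓘(𝕜, E') y y) := by
  have := contDiffAt_comp_extChartAt_symm hΦ
  simp only [extChartAt_prod] at this
  exact this

theorem eventually_mdifferentiableAt_right {Φ : M → N → F} {x : M} {y : N}
    (hΦ : ContMDiffAt (𝓘(𝕜, E).prod 𝓘(𝕜, E')) 𝓘(𝕜, F) ∞ (Function.uncurry Φ) (x, y)) :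
    ∀ᶠ z in 𝓝 x, MDifferentiableAt 𝓘(𝕜, E') 𝓘(𝕜, F) (Φ z) y := by
  have h1 := (contMDiffAt_iff_contMDiffAt_nhds (n := 1) (by simp)).1
    (hΦ.of_le (by norm_cast))
  have h2 : Tendsto (fun z : M ↦ (z, y)) (𝓝 x) (𝓝 (x, y)) :=
    (continuous_id.prodMk continuous_const).tendsto x
  filter_upwards [h2.eventually h1] with z hz
  have h3 : MDifferentiableAt 𝓘(𝕜, E') (𝓘(𝕜, E).prod 𝓘(𝕜, E')) (fun w : N ↦ (z, w)) y :=
    mdifferentiableAt_const.prodMk mdifferentiableAt_id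
  exact (hz.mdifferentiableAt (by norm_num)).comp y h3

/-- Since the point `y` at which the derivative is taken stays fixed, a single chart of `N` serves
for all nearby parameters. -/
theorem totalDeriv_param_eventuallyEq {Φ : M → N → F} {x : M} {y : N}
    (hΦ : ContMDiffAt (𝓘(𝕜, E).prod 𝓘(𝕜, E')) 𝓘(𝕜, F) ∞ (Function.uncurry Φ) (x, y)) :
    (fun z ↦ totalDeriv 𝕜 E' (Φ z) y) =ᶠ[𝓝 x]
      (fun a ↦ fderiv 𝕜 (fun b ↦ Φ ((extChartAt 𝓘(𝕜, E) x).symm a)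
        ((extChartAt 𝓘(𝕜, E') y).symm b)) (extChartAt 𝓘(𝕜, E') y y)) ∘ extChartAt 𝓘(𝕜, E) x := by
  filter_upwards [eventually_mdifferentiableAt_right hΦ,
    extChartAt_source_mem_nhds (I := 𝓘(𝕜, E)) x] with z hz hz'
  rw [totalDeriv_eq_fderiv hz, Function.comp_apply, (extChartAt 𝓘(𝕜, E) x).left_inv hz']
  rfl

theorem contDiffAt_fderiv_param {Φ : M → N → F} {x : M} {y : N}
    (hΦ : ContMDiffAt (𝓘(𝕜, E).prod 𝓘(𝕜, E')) 𝓘(𝕜, F) ∞ (Function.uncurry Φ) (x, y)) :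
    ContDiffAt 𝕜 ∞ (fun a ↦ fderiv 𝕜 (fun b ↦ Φ ((extChartAt 𝓘(𝕜, E) x).symm a)
        ((extChartAt 𝓘(𝕜, E') y).symm b)) (extChartAt 𝓘(𝕜, E') y y))
        (extChartAt 𝓘(𝕜, E) x x) :=
  ContDiffAt.fderiv (f := fun a b ↦ Φ ((extChartAt 𝓘(𝕜, E) x).symm a)
        ((extChartAt 𝓘(𝕜, E') y).symm b)) (n := ∞)
    (contDiffAt_comp_extChartAt_symm_prod hΦ) contDiffAt_const (by simp)

/-- The derivative with respect to one variable depends smoothly on the other one. -/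
theorem contMDiffAt_totalDeriv_param {Φ : M → N → F} {x : M} {y : N}
    (hΦ : ContMDiffAt (𝓘(𝕜, E).prod 𝓘(𝕜, E')) 𝓘(𝕜, F) ∞ (Function.uncurry Φ) (x, y)) :
    ContMDiffAt 𝓘(𝕜, E) 𝓘(𝕜, E' →L[𝕜] F) ∞ (fun z ↦ totalDeriv 𝕜 E' (Φ z) y) x := by
  refine ContMDiffAt.congr_of_eventuallyEq ?_ (totalDeriv_param_eventuallyEq hΦ)
  exact (contDiffAt_fderiv_param hΦ).contMDiffAt.comp x contMDiffAt_extChartAt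

theorem contMDiffAt_uncurry_swap {Φ : M → N → F} {x : M} {y : N}
    (hΦ : ContMDiffAt (𝓘(𝕜, E).prod 𝓘(𝕜, E')) 𝓘(𝕜, F) ∞ (Function.uncurry Φ) (x, y)) :
    ContMDiffAt (𝓘(𝕜, E').prod 𝓘(𝕜, E)) 𝓘(𝕜, F) ∞
      (Function.uncurry fun w z ↦ Φ z w) (y, x) :=
  ContMDiffAt.comp (y, x) (g := Function.uncurry Φ) (f := Prod.swap) hΦ
    (contMDiffAt_snd.prodMk contMDiffAt_fst)

/-- Mixed partial derivatives on a product of manifolds commute. -/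
theorem totalDeriv_comm {Φ : M → N → F} {x : M} {y : N}
    (hΦ : ContMDiffAt (𝓘(𝕜, E).prod 𝓘(𝕜, E')) 𝓘(𝕜, F) ∞ (Function.uncurry Φ) (x, y))
    (ξ : E) (η : E') :
    totalDeriv 𝕜 E (fun z ↦ totalDeriv 𝕜 E' (Φ z) y η) x ξ =
      totalDeriv 𝕜 E' (fun w ↦ totalDeriv 𝕜 E (fun z ↦ Φ z w) x ξ) y η := by
  have hΦ' := contMDiffAt_uncurry_swap hΦ
  have h1 := (totalDeriv_param_eventuallyEq hΦ).fun_comp (fun L ↦ L η)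
  have h2 := (totalDeriv_param_eventuallyEq hΦ').fun_comp (fun L ↦ L ξ)
  have d1 := (contDiffAt_fderiv_param hΦ).differentiableAt (by simp)
  have d2 := (contDiffAt_fderiv_param hΦ').differentiableAt (by simp)
  have e1 := totalDeriv_congr (𝕜 := 𝕜) (E := E) h1
  have e2 := totalDeriv_congr (𝕜 := 𝕜) (E := E') h2
  refine (congrArg (· ξ) e1).trans (Eq.trans ?_ (congrArg (· η) e2).symm)
  have f1 := totalDeriv_comp_extChartAt (x := x) (H := fun a ↦ fderiv 𝕜 (fun b ↦
      Φ ((extChartAt 𝓘(𝕜, E) x).symm a) ((extChartAt 𝓘(𝕜, E') y).symm b))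
      (extChartAt 𝓘(𝕜, E') y y) η) (d1.clm_apply (differentiableAt_const η))
  have f2 := totalDeriv_comp_extChartAt (x := y) (H := fun b ↦ fderiv 𝕜 (fun a ↦
      Φ ((extChartAt 𝓘(𝕜, E) x).symm a) ((extChartAt 𝓘(𝕜, E') y).symm b))
      (extChartAt 𝓘(𝕜, E) x x) ξ) (d2.clm_apply (differentiableAt_const ξ))
  refine (congrArg (· ξ) f1).trans (Eq.trans ?_ (congrArg (· η) f2).symm)
  exact fderiv_fderiv_comm ((contDiffAt_comp_extChartAt_symm_prod hΦ).of_le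
    (by norm_cast)) ξ η

end Parameters

/-! ### Derivatives along left and right translations -/

section GroupCalculus

variable {𝕜 : Type*} [RCLike 𝕜] {E : Type*} [NormedAddCommGroup E] [NormedSpace 𝕜 E]
  [CompleteSpace E] {F : Type*} [NormedAddCommGroup F] [NormedSpace 𝕜 F]
  {F' : Type*} [NormedAddCommGroup F'] [NormedSpace 𝕜 F']
  {G : Type*} [TopologicalSpace G] [ChartedSpace E G] [Group G] [LieGroup 𝓘(𝕜, E) ω G]

variable (𝕜 E) in
/-- The derivative `d/dt|₀ f(x e^{tξ})` as a linear map in `ξ`. -/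
def leftDer (f : G → F) (x : G) : E →L[𝕜] F := totalDeriv 𝕜 E (fun y ↦ f (x * y)) 1

variable (𝕜 E) in
/-- The derivative `d/dt|₀ f(e^{tξ} x)` as a linear map in `ξ`. -/
def rightDer (f : G → F) (x : G) : E →L[𝕜] F := totalDeriv 𝕜 E (fun y ↦ f (y * x)) 1

variable (𝕜 E) in
/-- `f` is smooth at `x`. -/
abbrev SmoothAt (f : G → F) (x : G) : Prop := ContMDiffAt 𝓘(𝕜, E) 𝓘(𝕜, F) ∞ f x

theorem SmoothAt.mdiff {f : G → F} {x : G} (hf : SmoothAt 𝕜 E f x) :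
    MDifferentiableAt 𝓘(𝕜, E) 𝓘(𝕜, F) f x := hf.mdifferentiableAt (by simp)

theorem SmoothAt.comp {f : G → F} {x : G} {h : G → G} {y : G} (hf : SmoothAt 𝕜 E f x)
    (hh : ContMDiff 𝓘(𝕜, E) 𝓘(𝕜, E) ∞ h) (hxy : h y = x) : SmoothAt 𝕜 E (fun z ↦ f (h z)) y := by
  subst hxy
  exact ContMDiffAt.comp y hf hh.contMDiffAt

theorem contMDiff_mul_left' (x : G) : ContMDiff 𝓘(𝕜, E) 𝓘(𝕜, E) ∞ (x * ·) := contMDiff_mul_left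

theorem contMDiff_mul_right' (x : G) : ContMDiff 𝓘(𝕜, E) 𝓘(𝕜, E) ∞ (· * x) :=
  contMDiff_mul_right

theorem contMDiff_conj (x : G) : ContMDiff 𝓘(𝕜, E) 𝓘(𝕜, E) ∞ (fun y : G ↦ x * y * x⁻¹) :=
  (contMDiff_mul_right' x⁻¹).comp (contMDiff_mul_left' x)

theorem smoothAt_uncurry_mul {f : G → F} {x y : G} (hf : SmoothAt 𝕜 E f (x * y)) :
    ContMDiffAt (𝓘(𝕜, E).prod 𝓘(𝕜, E)) 𝓘(𝕜, F) ∞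
      (Function.uncurry fun z w ↦ f (z * w)) (x, y) :=
  ContMDiffAt.comp (x, y) (g := f) (f := fun p : G × G ↦ p.1 * p.2) hf
    (contMDiff_mul 𝓘(𝕜, E) ∞).contMDiffAt

theorem smoothAt_uncurry_conj {f : G → F} {x : G} (hf : SmoothAt 𝕜 E f 1) :
    ContMDiffAt (𝓘(𝕜, E).prod 𝓘(𝕜, E)) 𝓘(𝕜, F) ∞
      (Function.uncurry fun z w ↦ f (z * w * z⁻¹)) (x, 1) := by
  have h : ContMDiff (𝓘(𝕜, E).prod 𝓘(𝕜, E)) 𝓘(𝕜, E) ∞ fun p : G × G ↦ p.1 * p.2 * p.1⁻¹ :=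
    (contMDiff_fst.mul contMDiff_snd).mul contMDiff_fst.inv
  refine ContMDiffAt.comp (x, 1) (g := f) (f := fun p : G × G ↦ p.1 * p.2 * p.1⁻¹) ?_ h.contMDiffAt
  simpa using hf

theorem SmoothAt.leftDer {f : G → F} {x : G} (hf : SmoothAt 𝕜 E f x) :
    SmoothAt 𝕜 E (leftDer 𝕜 E f) x :=
  contMDiffAt_totalDeriv_param (Φ := fun z w ↦ f (z * w)) (smoothAt_uncurry_mul (by simpa using hf))

theorem SmoothAt.rightDer {f : G → F} {x : G} (hf : SmoothAt 𝕜 E f x) :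
    SmoothAt 𝕜 E (rightDer 𝕜 E f) x :=
  contMDiffAt_totalDeriv_param (Φ := fun z w ↦ f (w * z))
    (contMDiffAt_uncurry_swap (Φ := fun w z ↦ f (w * z)) (smoothAt_uncurry_mul (by simpa using hf)))

theorem SmoothAt.clm_apply {T : G → F →L[𝕜] F'} {a : G → F} {x : G} (hT : SmoothAt 𝕜 E T x)
    (ha : SmoothAt 𝕜 E a x) : SmoothAt 𝕜 E (fun y ↦ T y (a y)) x :=
  ContMDiffAt.clm_apply hT ha

theorem SmoothAt.apply_const {T : G → F →L[𝕜] F'} {x : G} (hT : SmoothAt 𝕜 E T x) (v : F) :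
    SmoothAt 𝕜 E (fun y ↦ T y v) x := hT.clm_apply contMDiffAt_const

theorem totalDeriv_clm_comp {L : F →L[𝕜] F'} {a : G → F} {x : G} (ha : SmoothAt 𝕜 E a x) (v : E) :
    totalDeriv 𝕜 E (fun y ↦ L (a y)) x v = L (totalDeriv 𝕜 E a x v) := by
  have h := ha.mdiff.hasMFDerivAt
  have h2 : HasMFDerivAt 𝓘(𝕜, E) 𝓘(𝕜, F') (L ∘ a) x _ := (L.hasMFDerivAt (x := a x)).comp x h
  have h3 := h2.mfderiv
  exact congrArg (fun T : E →L[𝕜] F' ↦ T v) h3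

theorem totalDeriv_clm_apply {T : G → F →L[𝕜] F'} {a : G → F} {x : G} (hT : SmoothAt 𝕜 E T x)
    (ha : SmoothAt 𝕜 E a x) (v : E) :
    totalDeriv 𝕜 E (fun y ↦ T y (a y)) x v =
      totalDeriv 𝕜 E T x v (a x) + T x (totalDeriv 𝕜 E a x v) := by
  rw [totalDeriv_eq_fderiv (hT.clm_apply ha).mdiff, totalDeriv_eq_fderiv hT.mdiff,
    totalDeriv_eq_fderiv ha.mdiff]
  have h1 := (contDiffAt_comp_extChartAt_symm hT).differentiableAt (by simp)
  have h2 := (contDiffAt_comp_extChartAt_symm ha).differentiableAt (by simp)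
  have h3 := fderiv_clm_apply h1 h2
  have e := extChartAt_to_inv (I := 𝓘(𝕜, E)) x
  refine (congrArg (fun T : E →L[𝕜] F' ↦ T v) h3).trans ?_
  simp only [add_apply, ContinuousLinearMap.comp_apply, ContinuousLinearMap.flip_apply,
    Function.comp_apply, e]
  rw [add_comm]

theorem totalDeriv_add {a b : G → F} {x : G} (ha : SmoothAt 𝕜 E a x)
    (hb : SmoothAt 𝕜 E b x) :
    totalDeriv 𝕜 E (fun y ↦ a y + b y) x = totalDeriv 𝕜 E a x + totalDeriv 𝕜 E b x := by
  change totalDeriv 𝕜 E (a + b) x = _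
  rw [totalDeriv_eq_fderiv (ContMDiffAt.mdifferentiableAt (ha.add hb) (by simp)), totalDeriv_eq_fderiv ha.mdiff,
    totalDeriv_eq_fderiv hb.mdiff]
  exact fderiv_add ((contDiffAt_comp_extChartAt_symm ha).differentiableAt (by simp))
    ((contDiffAt_comp_extChartAt_symm hb).differentiableAt (by simp))

theorem leftDer_congr {f g : G → F} {x : G} (h : f =ᶠ[𝓝 x] g) : leftDer 𝕜 E f x = leftDer 𝕜 E g x := by
  refine totalDeriv_congr ?_
  have : Tendsto (fun y : G ↦ x * y) (𝓝 1) (𝓝 x) := by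
    have h1 := (contMDiff_mul_left' (𝕜 := 𝕜) (E := E) x).continuous.tendsto 1
    rwa [mul_one] at h1
  exact this.eventually h

theorem leftDer_eq {f : G → F} {x : G} (hf : MDifferentiableAt 𝓘(𝕜, E) 𝓘(𝕜, F) f x) (ξ : E) :
    leftDer 𝕜 E f x ξ = totalDeriv 𝕜 E f x (leftTranslation (𝕜 := 𝕜) (E := E) x ξ) := by
  have h1 : MDifferentiableAt 𝓘(𝕜, E) 𝓘(𝕜, E) (fun y : G ↦ x * y) 1 :=
    (contMDiff_mul_left' x).mdifferentiableAt (by simp)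
  have h2 := mfderiv_comp_of_eq (x := 1) (y := x) hf h1 (mul_one x)
  -- The chain rule lands at `x * 1`; all tangent spaces are the model space, so the base point can
  -- be replaced by `x`.
  have e : ∀ z : G, z = x → totalDeriv 𝕜 E f z = totalDeriv 𝕜 E f x := by rintro z rfl; rfl
  refine (congrArg (fun T : E →L[𝕜] F ↦ T ξ) h2).trans ?_
  exact congrArg (fun T : E →L[𝕜] F ↦ T (leftTranslation (𝕜 := 𝕜) (E := E) x ξ)) (e _ (mul_one x))

theorem rightDer_eq {f : G → F} {x : G} (hf : MDifferentiableAt 𝓘(𝕜, E) 𝓘(𝕜, F) f x) (ξ : E) :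
    rightDer 𝕜 E f x ξ = totalDeriv 𝕜 E f x (rightTranslation (𝕜 := 𝕜) (E := E) x ξ) := by
  have h1 : MDifferentiableAt 𝓘(𝕜, E) 𝓘(𝕜, E) (fun y : G ↦ y * x) 1 :=
    (contMDiff_mul_right' x).mdifferentiableAt (by simp)
  have h2 := mfderiv_comp_of_eq (x := 1) (y := x) hf h1 (one_mul x)
  have e : ∀ z : G, z = x → totalDeriv 𝕜 E f z = totalDeriv 𝕜 E f x := by rintro z rfl; rfl
  refine (congrArg (fun T : E →L[𝕜] F ↦ T ξ) h2).trans ?_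
  exact congrArg (fun T : E →L[𝕜] F ↦ T (rightTranslation (𝕜 := 𝕜) (E := E) x ξ)) (e _ (one_mul x))

theorem leftDer_one (f : G → F) : leftDer 𝕜 E f 1 = totalDeriv 𝕜 E f 1 := by simp [leftDer]

theorem rightDer_one (f : G → F) : rightDer 𝕜 E f 1 = totalDeriv 𝕜 E f 1 := by simp [rightDer]

theorem eventually_smoothAt {f : G → F} {x : G} (hf : SmoothAt 𝕜 E f x) :
    ∀ᶠ y in 𝓝 x, MDifferentiableAt 𝓘(𝕜, E) 𝓘(𝕜, F) f y :=
  ((contMDiffAt_iff_contMDiffAt_nhds (n := 1) (by simp)).1 (hf.of_le (by norm_cast))).mono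
    fun y hy ↦ hy.mdifferentiableAt (by norm_num)

variable (𝕜 G) in
/-- The Lie bracket of the Lie algebra of `G`, on the model space. -/
def lieE (v w : E) : E :=
  (⁅(show GroupLieAlgebra 𝓘(𝕜, E) G from v), (show GroupLieAlgebra 𝓘(𝕜, E) G from w)⁆ :
    GroupLieAlgebra 𝓘(𝕜, E) G)

theorem lieE_skew (v w : E) : lieE 𝕜 G w v = -lieE 𝕜 G v w := by
  have := lie_skew (show GroupLieAlgebra 𝓘(𝕜, E) G from w)
    (show GroupLieAlgebra 𝓘(𝕜, E) G from v)
  exact this.symm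

/-- `leftDer` differentiates along left-invariant vector fields, and the bracket of two such fields
is again left-invariant. -/
theorem leftDer_leftDer {f : G → F} {x : G} (hf : SmoothAt 𝕜 E f x) (v w : E) :
    leftDer 𝕜 E (fun y ↦ leftDer 𝕜 E f y w) x v - leftDer 𝕜 E (fun y ↦ leftDer 𝕜 E f y v) x w =
      leftDer 𝕜 E f x (lieE 𝕜 G v w) := by
  have h1 : ∀ u : E, (fun y ↦ leftDer 𝕜 E f y u) =ᶠ[𝓝 x]
      fun y ↦ totalDeriv 𝕜 E f y (mulInvariantVectorField (I := 𝓘(𝕜, E)) u y) := fun u ↦ by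
    filter_upwards [eventually_smoothAt hf] with y hy
    exact leftDer_eq hy u
  have h2 : ∀ u u' : E, leftDer 𝕜 E (fun y ↦ leftDer 𝕜 E f y u) x u' =
      totalDeriv 𝕜 E (fun y ↦ totalDeriv 𝕜 E f y (mulInvariantVectorField (I := 𝓘(𝕜, E)) u y)) x
        (mulInvariantVectorField (I := 𝓘(𝕜, E)) u' x) := fun u u' ↦ by
    rw [leftDer_eq (hf.leftDer.apply_const u).mdiff, totalDeriv_congr (h1 u)]
    rfl
  rw [h2, h2, leftDer_eq hf.mdiff]
  have h3 := totalDeriv_mlieBracket (x := x) (f := f) (hf.of_le (by norm_cast))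
    (mdifferentiableAt_mulInvariantVectorField (I := 𝓘(𝕜, E)) (G := G) v)
    (mdifferentiableAt_mulInvariantVectorField (I := 𝓘(𝕜, E)) (G := G) w)
  refine h3.trans ?_
  congr 1
  exact (congrFun (mulInvariantVector_mlieBracket (I := 𝓘(𝕜, E)) (G := G) v w) x).symm

/-- Left and right translations commute: both sides are mixed partial derivatives of `(z, w) ↦
f(zxw)` at the unit. -/
theorem leftDer_rightDer {f : G → F} {x : G} (hf : SmoothAt 𝕜 E f x) (v w : E) :
    leftDer 𝕜 E (fun y ↦ rightDer 𝕜 E f y w) x v = rightDer 𝕜 E (fun y ↦ leftDer 𝕜 E f y v) x w := by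
  have h : ContMDiffAt (𝓘(𝕜, E).prod 𝓘(𝕜, E)) 𝓘(𝕜, F) ∞
      (Function.uncurry fun z w : G ↦ f (z * x * w)) (1, 1) :=
    ContMDiffAt.comp ((1 : G), (1 : G)) (g := f) (f := fun p : G × G ↦ p.1 * x * p.2)
      (by simpa using hf)
      ((contMDiff_fst.mul contMDiff_const).mul contMDiff_snd).contMDiffAt
  have := totalDeriv_comm h w v
  simp only [leftDer, rightDer, mul_assoc] at this ⊢
  exact this.symm

/-- Two derivatives from the left of `x` are mixed partials of `f(wzx)`. Read as derivatives of `y ↦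
f(yx)` along left-invariant fields they occur in the opposite order, whence the sign. -/
theorem rightDer_rightDer {f : G → F} {x : G} (hf : SmoothAt 𝕜 E f x) (v w : E) :
    rightDer 𝕜 E (fun y ↦ rightDer 𝕜 E f y w) x v - rightDer 𝕜 E (fun y ↦ rightDer 𝕜 E f y v) x w =
      -rightDer 𝕜 E f x (lieE 𝕜 G v w) := by
  have hφ : SmoothAt 𝕜 E (fun y ↦ f (y * x)) 1 := hf.comp (contMDiff_mul_right' x) (one_mul x)
  have key : ∀ v w : E, rightDer 𝕜 E (fun y ↦ rightDer 𝕜 E f y w) x v =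
      leftDer 𝕜 E (fun y ↦ leftDer 𝕜 E (fun y ↦ f (y * x)) y v) 1 w := fun v w ↦ by
    have h := totalDeriv_comm (Φ := fun z w : G ↦ f (w * z * x)) (x := 1) (y := 1)
      (ContMDiffAt.comp ((1 : G), (1 : G)) (g := f) (f := fun p : G × G ↦ p.2 * p.1 * x)
      (by simpa using hf)
      ((contMDiff_snd.mul contMDiff_fst).mul contMDiff_const).contMDiffAt) v w
    simp only [leftDer, rightDer, mul_assoc, one_mul] at h ⊢
    exact h
  rw [key, key, leftDer_leftDer hφ, lieE_skew, map_neg]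
  simp [leftDer, rightDer]

end GroupCalculus

/-! ### The adjoint representation -/

section Adjoint

variable {𝕜 : Type*} [RCLike 𝕜] {E : Type*} [NormedAddCommGroup E] [NormedSpace 𝕜 E]
  [CompleteSpace E] {F : Type*} [NormedAddCommGroup F] [NormedSpace 𝕜 F]
  {G : Type*} [TopologicalSpace G] [ChartedSpace E G] [Group G] [LieGroup 𝓘(𝕜, E) ω G]

variable (𝕜 E) in
/-- The adjoint representation. -/
def adj (g : G) : E →L[𝕜] E := mfderiv 𝓘(𝕜, E) 𝓘(𝕜, E) (fun y : G ↦ g * y * g⁻¹) 1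

theorem totalDeriv_adj {f : G → F} (hf : MDifferentiableAt 𝓘(𝕜, E) 𝓘(𝕜, F) f 1) (g : G) (ξ : E) :
    totalDeriv 𝕜 E f 1 (adj 𝕜 E g ξ) = totalDeriv 𝕜 E (fun y ↦ f (g * y * g⁻¹)) 1 ξ := by
  have h1 : MDifferentiableAt 𝓘(𝕜, E) 𝓘(𝕜, E) (fun y : G ↦ g * y * g⁻¹) 1 :=
    (contMDiff_conj g).mdifferentiableAt (by simp)
  have e1 : g * 1 * g⁻¹ = 1 := by simp
  have h2 := mfderiv_comp_of_eq (x := 1) (y := 1) hf h1 e1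
  have e : ∀ z : G, z = 1 → totalDeriv 𝕜 E f z = totalDeriv 𝕜 E f 1 := by rintro z rfl; rfl
  refine Eq.trans ?_ (congrArg (fun T : E →L[𝕜] F ↦ T ξ) h2).symm
  exact congrArg (fun T : E →L[𝕜] F ↦ T (adj 𝕜 E g ξ)) (e _ e1).symm

variable (𝕜 E G) in
/-- The preferred chart at the unit element. -/
def unitChart : G → E := extChartAt 𝓘(𝕜, E) (1 : G)

theorem smoothAt_unitChart : SmoothAt 𝕜 E (unitChart 𝕜 E G) 1 :=
  contMDiffAt_extChartAt

theorem totalDeriv_unitChart (ξ : E) : totalDeriv 𝕜 E (unitChart 𝕜 E G) 1 ξ = ξ :=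
  congrArg (fun T : E →L[𝕜] E ↦ T ξ) (mfderiv_extChartAt_self (I := 𝓘(𝕜, E)) (x := (1 : G)))

theorem mdifferentiableAt_comp_smooth {f : G → F} {x : G} {h : G → G} {y : G}
    (hf : MDifferentiableAt 𝓘(𝕜, E) 𝓘(𝕜, F) f x)
    (hh : ContMDiff 𝓘(𝕜, E) 𝓘(𝕜, E) ∞ h) (hxy : h y = x) :
    MDifferentiableAt 𝓘(𝕜, E) 𝓘(𝕜, F) (fun z ↦ f (h z)) y := by
  subst hxy
  exact hf.comp y (hh.mdifferentiableAt (by simp))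

theorem adj_eq (g : G) (ξ : E) :
    adj 𝕜 E g ξ = totalDeriv 𝕜 E (fun y ↦ unitChart 𝕜 E G (g * y * g⁻¹)) 1 ξ := by
  rw [← totalDeriv_adj (smoothAt_unitChart).mdiff, totalDeriv_unitChart]

/-- This is `(g y g⁻¹) g = g y`, differentiated at `y = 1`. -/
theorem rightDer_adj {f : G → F} {g : G} (hf : MDifferentiableAt 𝓘(𝕜, E) 𝓘(𝕜, F) f g) (ξ : E) :
    rightDer 𝕜 E f g (adj 𝕜 E g ξ) = leftDer 𝕜 E f g ξ := by
  have h : MDifferentiableAt 𝓘(𝕜, E) 𝓘(𝕜, F) (fun y ↦ f (y * g)) 1 :=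
    mdifferentiableAt_comp_smooth hf (contMDiff_mul_right' g) (one_mul g)
  rw [rightDer, totalDeriv_adj h]
  simp [leftDer]

theorem adj_one (ξ : E) : adj 𝕜 E (1 : G) ξ = ξ := by
  rw [adj_eq]
  simpa using totalDeriv_unitChart (𝕜 := 𝕜) (G := G) ξ

theorem adj_mul (g h : G) (ξ : E) : adj 𝕜 E (g * h) ξ = adj 𝕜 E g (adj 𝕜 E h ξ) := by
  have h1 : SmoothAt 𝕜 E (fun y ↦ unitChart 𝕜 E G (g * y * g⁻¹)) 1 :=
    (smoothAt_unitChart).comp (contMDiff_conj g) (by simp)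
  rw [adj_eq, adj_eq g, totalDeriv_adj h1.mdiff]
  simp [mul_assoc]

theorem adj_inv_adj (g : G) (ξ : E) : adj 𝕜 E g⁻¹ (adj 𝕜 E g ξ) = ξ := by
  rw [← adj_mul, inv_mul_cancel, adj_one]

theorem adj_adj_inv (g : G) (ξ : E) : adj 𝕜 E g (adj 𝕜 E g⁻¹ ξ) = ξ := by
  rw [← adj_mul, mul_inv_cancel, adj_one]

theorem leftDer_conj {f : G → F} {g y : G}
    (hf : MDifferentiableAt 𝓘(𝕜, E) 𝓘(𝕜, F) f (g * y * g⁻¹)) (ξ : E) :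
    leftDer 𝕜 E (fun y ↦ f (g * y * g⁻¹)) y ξ = leftDer 𝕜 E f (g * y * g⁻¹) (adj 𝕜 E g ξ) := by
  have h : MDifferentiableAt 𝓘(𝕜, E) 𝓘(𝕜, F) (fun z ↦ f (g * y * g⁻¹ * z)) 1 :=
    mdifferentiableAt_comp_smooth hf (contMDiff_mul_left' _) (mul_one _)
  rw [leftDer, leftDer, totalDeriv_adj h]
  simp [mul_assoc]

theorem rightDer_conj {f : G → F} {g y : G}
    (hf : MDifferentiableAt 𝓘(𝕜, E) 𝓘(𝕜, F) f (g * y * g⁻¹)) (ξ : E) :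
    rightDer 𝕜 E (fun y ↦ f (g * y * g⁻¹)) y ξ = rightDer 𝕜 E f (g * y * g⁻¹) (adj 𝕜 E g ξ) := by
  have h : MDifferentiableAt 𝓘(𝕜, E) 𝓘(𝕜, F) (fun z ↦ f (z * (g * y * g⁻¹))) 1 :=
    mdifferentiableAt_comp_smooth hf (contMDiff_mul_right' _) (one_mul _)
  rw [rightDer, rightDer, totalDeriv_adj h]
  simp [mul_assoc]

/-- The chart has identity derivative at the unit, so applying the commutator formula to it recovers
the bracket itself. This expresses the bracket by second derivatives of one function, which is what
permits transport by conjugation and comparison of scalar fields. -/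
theorem lieE_eq (v w : E) : lieE 𝕜 G v w =
    leftDer 𝕜 E (fun y ↦ leftDer 𝕜 E (unitChart 𝕜 E G) y w) 1 v -
      leftDer 𝕜 E (fun y ↦ leftDer 𝕜 E (unitChart 𝕜 E G) y v) 1 w := by
  rw [leftDer_leftDer (smoothAt_unitChart), leftDer_one, totalDeriv_unitChart]

theorem adj_lieE (g : G) (v w : E) :
    adj 𝕜 E g (lieE 𝕜 G v w) = lieE 𝕜 G (adj 𝕜 E g v) (adj 𝕜 E g w) := by
  set χ : G → E := unitChart 𝕜 E G with hχ
  have h0 : SmoothAt 𝕜 E χ 1 := smoothAt_unitChart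
  have hc : SmoothAt 𝕜 E (fun y ↦ χ (g * y * g⁻¹)) 1 := h0.comp (contMDiff_conj g) (by simp)
  have hev : ∀ u : E, (fun y ↦ leftDer 𝕜 E (fun y ↦ χ (g * y * g⁻¹)) y u) =ᶠ[𝓝 1]
      fun y ↦ leftDer 𝕜 E χ (g * y * g⁻¹) (adj 𝕜 E g u) := fun u ↦ by
    have : Tendsto (fun y : G ↦ g * y * g⁻¹) (𝓝 1) (𝓝 1) := by
      have := (contMDiff_conj (𝕜 := 𝕜) (E := E) g).continuous.tendsto 1
      simpa using this
    filter_upwards [this.eventually (eventually_smoothAt h0)] with y hy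
    exact leftDer_conj hy u
  have key : ∀ u u' : E, leftDer 𝕜 E (fun y ↦ leftDer 𝕜 E (fun y ↦ χ (g * y * g⁻¹)) y u) 1 u' =
      leftDer 𝕜 E (fun y ↦ leftDer 𝕜 E χ y (adj 𝕜 E g u)) 1 (adj 𝕜 E g u') := fun u u' ↦ by
    rw [leftDer_congr (hev u), leftDer_conj (f := fun y ↦ leftDer 𝕜 E χ y (adj 𝕜 E g u))]
    · simp
    · have := (SmoothAt.leftDer h0).apply_const (adj 𝕜 E g u)
      simpa using this.mdiff
  rw [adj_eq, lieE_eq (adj 𝕜 E g v), ← hχ, ← key, ← key, leftDer_leftDer hc, leftDer_one]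

/-- In the chart at the unit, `Ad z` is the partial derivative of `z w z⁻¹` in `w` at `w = 1`, and
such derivatives depend smoothly on `z`. -/
theorem smoothAt_adj (g : G) : SmoothAt 𝕜 E (adj 𝕜 E : G → E →L[𝕜] E) g := by
  have h := contMDiffAt_totalDeriv_param
    (smoothAt_uncurry_conj (x := g) (smoothAt_unitChart (𝕜 := 𝕜) (E := E) (G := G)))
  have : (adj 𝕜 E : G → E →L[𝕜] E) = fun z ↦
      totalDeriv 𝕜 E (fun w ↦ unitChart 𝕜 E G (z * w * z⁻¹)) 1 := by
    ext g ξ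
    exact adj_eq g ξ
  rw [SmoothAt, this]
  exact h

/-- Differentiate `d^L χ(y) w = d^R χ(y) (Ad y w)` at the unit, for the chart `χ`. The product rule
isolates the derivative of `Ad`; exchanging the left and right derivatives in the other term leaves
the commutator of `lieE_eq`. -/
theorem leftDer_adj_one (v w : E) : leftDer 𝕜 E (fun y : G ↦ adj 𝕜 E y w) 1 v = lieE 𝕜 G v w := by
  set χ : G → E := unitChart 𝕜 E G with hχ
  have h0 : SmoothAt 𝕜 E χ 1 := smoothAt_unitChart
  have hev : (fun y ↦ leftDer 𝕜 E χ y w) =ᶠ[𝓝 1] fun y ↦ rightDer 𝕜 E χ y (adj 𝕜 E y w) := by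
    filter_upwards [eventually_smoothAt h0] with y hy
    exact (rightDer_adj hy w).symm
  have h1 : leftDer 𝕜 E (fun y ↦ rightDer 𝕜 E χ y (adj 𝕜 E y w)) 1 v =
      leftDer 𝕜 E (fun y ↦ rightDer 𝕜 E χ y w) 1 v + leftDer 𝕜 E (fun y : G ↦ adj 𝕜 E y w) 1 v := by
    have hr : SmoothAt 𝕜 E (rightDer 𝕜 E χ) 1 := SmoothAt.rightDer h0
    have ha : SmoothAt 𝕜 E (fun y : G ↦ adj 𝕜 E y w) 1 := (smoothAt_adj 1).apply_const w
    simp only [leftDer_one]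
    rw [totalDeriv_clm_apply hr ha, adj_one, rightDer_one, hχ, totalDeriv_unitChart, ← hχ,
      totalDeriv_clm_apply hr contMDiffAt_const]
    congr 1
    have : totalDeriv 𝕜 E (fun _ : G ↦ w) 1 = 0 :=
      mfderiv_const (I := 𝓘(𝕜, E)) (I' := 𝓘(𝕜, E)) (x := (1 : G)) (c := w)
    simp [this]
  rw [lieE_eq, ← hχ, leftDer_congr hev, h1, leftDer_rightDer h0]
  simp only [leftDer_one, rightDer_one]
  abel

theorem leftDer_adj (g : G) (v w : E) :
    leftDer 𝕜 E (fun y : G ↦ adj 𝕜 E y w) g v = adj 𝕜 E g (lieE 𝕜 G v w) := by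
  rw [← leftDer_adj_one, leftDer, leftDer_one]
  simp only [adj_mul]
  exact totalDeriv_clm_comp ((smoothAt_adj 1).apply_const w) v

end Adjoint

/-! ### The Jacobi identity for brackets built from translations -/

section Derivation

variable {𝕜 : Type*} [RCLike 𝕜] {E : Type*} [NormedAddCommGroup E] [NormedSpace 𝕜 E]
  [CompleteSpace E]
  {G : Type*} [TopologicalSpace G] [ChartedSpace E G] [Group G] [LieGroup 𝓘(𝕜, E) ω G]

theorem totalDeriv_const_mul {f : G → 𝕜} {x : G} (hf : SmoothAt 𝕜 E f x) (c : 𝕜) (v : E) :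
    totalDeriv 𝕜 E (fun y ↦ c * f y) x v = c * totalDeriv 𝕜 E f x v :=
  totalDeriv_clm_comp (L := ContinuousLinearMap.mul 𝕜 𝕜 c) hf v

theorem smoothAt_const_mul {f : G → 𝕜} {x : G} (hf : SmoothAt 𝕜 E f x) (c : 𝕜) :
    SmoothAt 𝕜 E (fun y ↦ c * f y) x :=
  ContMDiffAt.clm_apply (g := fun _ ↦ ContinuousLinearMap.mul 𝕜 𝕜 c) contMDiffAt_const hf

theorem totalDeriv_sub {f g : G → 𝕜} {x : G} (hf : SmoothAt 𝕜 E f x) (hg : SmoothAt 𝕜 E g x)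
    (v : E) :
    totalDeriv 𝕜 E (fun y ↦ f y - g y) x v = totalDeriv 𝕜 E f x v - totalDeriv 𝕜 E g x v := by
  have h := totalDeriv_add hf (smoothAt_const_mul hg (-1))
  simp only [neg_mul, one_mul, ← sub_eq_add_neg] at h
  rw [h, add_apply]
  have h2 := totalDeriv_const_mul hg (-1) v
  simp only [neg_mul, one_mul] at h2
  rw [h2, sub_eq_add_neg]

theorem smoothAt_sub {f g : G → 𝕜} {x : G} (hf : SmoothAt 𝕜 E f x) (hg : SmoothAt 𝕜 E g x) :
    SmoothAt 𝕜 E (fun y ↦ f y - g y) x :=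
  ContMDiffAt.sub hf hg

/-- The derivative of `h` along the vector field `½ a^R - ½ b^L`. -/
def frozen (a b : E) (h : G → 𝕜) (y : G) : 𝕜 :=
  (1 / 2) * rightDer 𝕜 E h y a - (1 / 2) * leftDer 𝕜 E h y b

theorem smoothAt_frozen {h : G → 𝕜} {x : G} (hh : SmoothAt 𝕜 E h x) (a b : E) :
    SmoothAt 𝕜 E (frozen a b h) x :=
  smoothAt_sub (smoothAt_const_mul ((SmoothAt.rightDer hh).apply_const a) _)
    (smoothAt_const_mul ((SmoothAt.leftDer hh).apply_const b) _)

theorem totalDeriv_frozen {h : G → 𝕜} {x : G} (hh : SmoothAt 𝕜 E h x) (a b w : E) :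
    totalDeriv 𝕜 E (frozen a b h) x w =
      (1 / 2) * totalDeriv 𝕜 E (fun y ↦ rightDer 𝕜 E h y a) x w -
        (1 / 2) * totalDeriv 𝕜 E (fun y ↦ leftDer 𝕜 E h y b) x w := by
  have h1 := (SmoothAt.rightDer hh).apply_const a
  have h2 := (SmoothAt.leftDer hh).apply_const b
  rw [← totalDeriv_const_mul h1, ← totalDeriv_const_mul h2]
  exact totalDeriv_sub (smoothAt_const_mul h1 _) (smoothAt_const_mul h2 _) w

/-- The mixed left-right terms cancel in the commutator. The left-left and right-right terms give
brackets with opposite signs. -/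
theorem frozen_frozen {h : G → 𝕜} {x : G} (hh : SmoothAt 𝕜 E h x) (a b c d : E) :
    frozen a b (frozen c d h) x - frozen c d (frozen a b h) x =
      (1 / 4) * (leftDer 𝕜 E h x (lieE 𝕜 G b d) - rightDer 𝕜 E h x (lieE 𝕜 G a c)) := by
  have key : ∀ a b c d : E, frozen a b (frozen c d h) x =
      (1 / 4) * (rightDer 𝕜 E (fun y ↦ rightDer 𝕜 E h y c) x a
        - rightDer 𝕜 E (fun y ↦ leftDer 𝕜 E h y d) x a
        - leftDer 𝕜 E (fun y ↦ rightDer 𝕜 E h y c) x b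
        + leftDer 𝕜 E (fun y ↦ leftDer 𝕜 E h y d) x b) := by
    intro a b c d
    have h1 := (SmoothAt.rightDer hh).apply_const c
    have h2 := (SmoothAt.leftDer hh).apply_const d
    have h3 := smoothAt_frozen hh c d
    conv_lhs => rw [frozen]
    rw [rightDer_eq h3.mdiff, leftDer_eq h3.mdiff, rightDer_eq h1.mdiff, rightDer_eq h2.mdiff,
      leftDer_eq h1.mdiff, leftDer_eq h2.mdiff]
    have e1 := totalDeriv_frozen hh c d (rightTranslation (𝕜 := 𝕜) (E := E) x a)
    have e2 := totalDeriv_frozen hh c d (leftTranslation (𝕜 := 𝕜) (E := E) x b)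
    rw [e1, e2]
    ring
  rw [key, key, leftDer_rightDer hh b c, leftDer_rightDer hh d a]
  have h1 := leftDer_leftDer hh b d
  have h2 := rightDer_rightDer hh a c
  linear_combination (1 / 4) * h1 + (1 / 4) * h2

variable (A : (E →L[𝕜] 𝕜) →L[𝕜] E)

/-- The function `½ d^R g (A (d^R f)) - ½ d^L g (A (d^L f))`. -/
def translationBracket (f g : G → 𝕜) (x : G) : 𝕜 :=
  (1 / 2) * rightDer 𝕜 E g x (A (rightDer 𝕜 E f x)) -
    (1 / 2) * leftDer 𝕜 E g x (A (leftDer 𝕜 E f x))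

theorem smoothAt_pairing {S T : G → E →L[𝕜] 𝕜} {x : G} (hS : SmoothAt 𝕜 E S x)
    (hT : SmoothAt 𝕜 E T x) : SmoothAt 𝕜 E (fun y ↦ T y (A (S y))) x :=
  hT.clm_apply (SmoothAt.clm_apply (T := fun _ ↦ A) contMDiffAt_const hS)

theorem smoothAt_translationBracket {f g : G → 𝕜} {x : G} (hf : SmoothAt 𝕜 E f x)
    (hg : SmoothAt 𝕜 E g x) : SmoothAt 𝕜 E (translationBracket A f g) x :=
  smoothAt_sub (smoothAt_const_mul (smoothAt_pairing A (SmoothAt.rightDer hf)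
      (SmoothAt.rightDer hg)) _)
    (smoothAt_const_mul (smoothAt_pairing A (SmoothAt.leftDer hf) (SmoothAt.leftDer hg)) _)

variable {A}

/-- In the product rule, skewness rewrites the term where `S` is differentiated with the roles of
`S` and `T` exchanged, so each term differentiates one functional against a vector frozen at `x`. -/
theorem totalDeriv_pairing (hA : ∀ S T : E →L[𝕜] 𝕜, T (A S) = -S (A T)) {S T : G → E →L[𝕜] 𝕜} {x : G}
    (hS : SmoothAt 𝕜 E S x) (hT : SmoothAt 𝕜 E T x) (w : E) :
    totalDeriv 𝕜 E (fun y ↦ T y (A (S y))) x w =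
      totalDeriv 𝕜 E (fun y ↦ T y (A (S x))) x w - totalDeriv 𝕜 E (fun y ↦ S y (A (T x))) x w := by
  have h1 := totalDeriv_clm_apply (a := fun y ↦ A (S y)) hT
    (SmoothAt.clm_apply (T := fun _ ↦ A) contMDiffAt_const hS) w
  have h0 : ∀ v : E, totalDeriv 𝕜 E (fun _ : G ↦ v) x = 0 := fun v ↦
    mfderiv_const (I := 𝓘(𝕜, E)) (I' := 𝓘(𝕜, E)) (x := x) (c := v)
  have h2 := totalDeriv_clm_apply (a := fun _ ↦ A (S x)) hT contMDiffAt_const w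
  have h3 := totalDeriv_clm_apply (a := fun _ ↦ A (T x)) hS contMDiffAt_const w
  rw [h1, h2, h3, totalDeriv_clm_comp hS, hA _ (T x), h0, h0]
  simp [sub_eq_add_neg]

theorem totalDeriv_translationBracket (hA : ∀ S T : E →L[𝕜] 𝕜, T (A S) = -S (A T)) {g h : G → 𝕜} {x : G}
    (hg : SmoothAt 𝕜 E g x) (hh : SmoothAt 𝕜 E h x) (w : E) :
    totalDeriv 𝕜 E (translationBracket A g h) x w =
      totalDeriv 𝕜 E (frozen (A (rightDer 𝕜 E g x)) (A (leftDer 𝕜 E g x)) h) x w -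
      totalDeriv 𝕜 E (frozen (A (rightDer 𝕜 E h x)) (A (leftDer 𝕜 E h x)) g) x w := by
  have s1 := smoothAt_pairing A (SmoothAt.rightDer hg) (SmoothAt.rightDer hh)
  have s2 := smoothAt_pairing A (SmoothAt.leftDer hg) (SmoothAt.leftDer hh)
  have e := totalDeriv_sub (smoothAt_const_mul s1 (1 / 2)) (smoothAt_const_mul s2 (1 / 2)) w
  rw [totalDeriv_const_mul s1, totalDeriv_const_mul s2,
    totalDeriv_pairing hA (SmoothAt.rightDer hg) (SmoothAt.rightDer hh),
    totalDeriv_pairing hA (SmoothAt.leftDer hg) (SmoothAt.leftDer hh)] at e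
  refine Eq.trans e ?_
  rw [totalDeriv_frozen hh, totalDeriv_frozen hg]
  ring

/-- At `x`, the bracket with `f` is the derivative along a field with coefficients frozen at `x`. By
skewness the inner bracket also differentiates through frozen fields only, so no derivative of their
coefficients remains. -/
theorem translationBracket_translationBracket (hA : ∀ S T : E →L[𝕜] 𝕜, T (A S) = -S (A T)) {f g h : G → 𝕜}
    {x : G} (hg : SmoothAt 𝕜 E g x) (hh : SmoothAt 𝕜 E h x) :
    translationBracket A f (translationBracket A g h) x =
      frozen (A (rightDer 𝕜 E f x)) (A (leftDer 𝕜 E f x))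
        (frozen (A (rightDer 𝕜 E g x)) (A (leftDer 𝕜 E g x)) h) x -
      frozen (A (rightDer 𝕜 E f x)) (A (leftDer 𝕜 E f x))
        (frozen (A (rightDer 𝕜 E h x)) (A (leftDer 𝕜 E h x)) g) x := by
  have s := smoothAt_translationBracket A hg hh
  have s1 := smoothAt_frozen hh (A (rightDer 𝕜 E g x)) (A (leftDer 𝕜 E g x))
  have s2 := smoothAt_frozen hg (A (rightDer 𝕜 E h x)) (A (leftDer 𝕜 E h x))
  conv_lhs => rw [translationBracket]
  conv_rhs => rw [frozen, frozen]
  rw [rightDer_eq s.mdiff, leftDer_eq s.mdiff, rightDer_eq s1.mdiff, leftDer_eq s1.mdiff,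
    rightDer_eq s2.mdiff, leftDer_eq s2.mdiff]
  have e1 := totalDeriv_translationBracket hA hg hh
    (rightTranslation (𝕜 := 𝕜) (E := E) x (A (rightDer 𝕜 E f x)))
  have e2 := totalDeriv_translationBracket hA hg hh
    (leftTranslation (𝕜 := 𝕜) (E := E) x (A (leftDer 𝕜 E f x)))
  rw [e1, e2]
  ring

theorem leftDer_eq_rightDer_comp_adj {f : G → 𝕜} {x : G}
    (hf : MDifferentiableAt 𝓘(𝕜, E) 𝓘(𝕜, 𝕜) f x) :
    leftDer 𝕜 E f x = (rightDer 𝕜 E f x).comp (adj 𝕜 E x) := by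
  ext ξ
  exact (rightDer_adj hf ξ).symm

/-- The Jacobi identity, for a skew-symmetric `A` whose Schouten square is invariant. -/
theorem translationBracket_jacobi (hA : ∀ S T : E →L[𝕜] 𝕜, T (A S) = -S (A T))
    (hinv : ∀ (g : G) (S T U : E →L[𝕜] 𝕜),
      U.comp (adj 𝕜 E g) (lieE 𝕜 G (A (S.comp (adj 𝕜 E g))) (A (T.comp (adj 𝕜 E g)))) +
      S.comp (adj 𝕜 E g) (lieE 𝕜 G (A (T.comp (adj 𝕜 E g))) (A (U.comp (adj 𝕜 E g)))) +
      T.comp (adj 𝕜 E g) (lieE 𝕜 G (A (U.comp (adj 𝕜 E g))) (A (S.comp (adj 𝕜 E g)))) =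
      U (lieE 𝕜 G (A S) (A T)) + S (lieE 𝕜 G (A T) (A U)) + T (lieE 𝕜 G (A U) (A S)))
    {f g h : G → 𝕜} {x : G} (hf : SmoothAt 𝕜 E f x) (hg : SmoothAt 𝕜 E g x)
    (hh : SmoothAt 𝕜 E h x) :
    translationBracket A f (translationBracket A g h) x +
      translationBracket A g (translationBracket A h f) x +
      translationBracket A h (translationBracket A f g) x = 0 := by
  rw [translationBracket_translationBracket hA hg hh, translationBracket_translationBracket hA hh hf,
    translationBracket_translationBracket hA hf hg]
  -- The six second-order terms of the cyclic sum pair up into three commutators of frozen fields,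
  -- one acting on each of `f`, `g`, `h`.
  have h1 := frozen_frozen hh (A (rightDer 𝕜 E f x)) (A (leftDer 𝕜 E f x))
    (A (rightDer 𝕜 E g x)) (A (leftDer 𝕜 E g x))
  have h2 := frozen_frozen hf (A (rightDer 𝕜 E g x)) (A (leftDer 𝕜 E g x))
    (A (rightDer 𝕜 E h x)) (A (leftDer 𝕜 E h x))
  have h3 := frozen_frozen hg (A (rightDer 𝕜 E h x)) (A (leftDer 𝕜 E h x))
    (A (rightDer 𝕜 E f x)) (A (leftDer 𝕜 E f x))
  have h4 := hinv x (rightDer 𝕜 E f x) (rightDer 𝕜 E g x) (rightDer 𝕜 E h x)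
  rw [← leftDer_eq_rightDer_comp_adj hf.mdiff, ← leftDer_eq_rightDer_comp_adj hg.mdiff,
    ← leftDer_eq_rightDer_comp_adj hh.mdiff] at h4
  linear_combination h1 + h2 + h3 + (1 / 4) * h4

end Derivation

/-! ### The Poisson structure of an r-matrix -/

section PoissonLie

variable {𝕜 : Type*} [RCLike 𝕜] {E : Type*} [NormedAddCommGroup E] [NormedSpace 𝕜 E]
  [FiniteDimensional 𝕜 E] [CompleteSpace E]
  {G : Type*} [TopologicalSpace G] [ChartedSpace E G] [Group G] [LieGroup 𝓘(𝕜, E) ω G]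
  (B : LinearMap.BilinForm 𝕜 E) (hB : B.Nondegenerate) (r : Module.End 𝕜 E)

/-- The vector `v` with `B(v, ·) = S`. -/
def sharpₗ : (E →L[𝕜] 𝕜) →ₗ[𝕜] E where
  toFun S := (B.toDual hB).symm S.toLinearMap
  map_add' S T := by rw [← map_add]; rfl
  map_smul' c S := by rw [RingHom.id_apply, ← map_smul]; rfl

/-- The operator `S ↦ r v`, where `v` is the vector with `B(v, ·) = S`. -/
def sharp : (E →L[𝕜] 𝕜) →L[𝕜] E :=
  LinearMap.toContinuousLinearMap (r ∘ₗ sharpₗ B hB)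

theorem sharp_eq (S : E →L[𝕜] 𝕜) : sharp B hB r S = r (sharp B hB 1 S) := rfl

theorem apply_sharp_one (S : E →L[𝕜] 𝕜) (v : E) : B (sharp B hB 1 S) v = S v :=
  LinearMap.BilinForm.apply_toDual_symm_apply (B := B) (hB := hB) (f := S.toLinearMap) (v := v)

variable (G) in
/-- The conditions on an invariant form and a skew-symmetric solution of the modified classical
Yang-Baxter equation. -/
structure IsRMatrix (B : LinearMap.BilinForm 𝕜 E) (r : Module.End 𝕜 E) : Prop where
  symm : ∀ a b : E, B a b = B b a
  inv : ∀ a b c : E, B (lieE 𝕜 G a b) c = B a (lieE 𝕜 G b c)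
  inv_adj : ∀ (g : G) (a b : E), B (adj 𝕜 E g a) (adj 𝕜 E g b) = B a b
  skew : ∀ a b : E, B (r a) b = -B a (r b)
  yangBaxter : ∀ a b : E, lieE 𝕜 G (r a) (r b) - r (lieE 𝕜 G (r a) b) - r (lieE 𝕜 G a (r b)) =
    -lieE 𝕜 G a b

variable {B} {r}

/-- The functional `ξ ↦ α(d/dt|₀ e^{tξ} x)`. -/
def rightPull (x : G) (α : Cotangent 𝓘(𝕜, E) x) : E →L[𝕜] 𝕜 := α.comp (rightTranslation x)

/-- The functional `ξ ↦ α(d/dt|₀ x e^{tξ})`. -/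
def leftPull (x : G) (α : Cotangent 𝓘(𝕜, E) x) : E →L[𝕜] 𝕜 := α.comp (leftTranslation x)

theorem rightDer_eq_rightPull {f : G → 𝕜} {x : G}
    (hf : MDifferentiableAt 𝓘(𝕜, E) 𝓘(𝕜, 𝕜) f x) :
    rightDer 𝕜 E f x = rightPull x (differential 𝓘(𝕜, E) f x) := by
  ext ξ; exact rightDer_eq hf ξ

theorem leftDer_eq_leftPull {f : G → 𝕜} {x : G}
    (hf : MDifferentiableAt 𝓘(𝕜, E) 𝓘(𝕜, 𝕜) f x) :
    leftDer 𝕜 E f x = leftPull x (differential 𝓘(𝕜, E) f x) := by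
  ext ξ; exact leftDer_eq hf ξ

theorem IsRMatrix.sharp_skew (h : IsRMatrix G B r) (S T : E →L[𝕜] 𝕜) : T (sharp B hB r S) = -S (sharp B hB r T) := by
  rw [← apply_sharp_one B hB T, ← apply_sharp_one B hB S, sharp_eq, sharp_eq B hB r T, h.symm]
  exact h.skew _ _

/-- `Ad`-invariance of `B` identifies the coadjoint with the adjoint action. -/
theorem IsRMatrix.sharp_comp_adj (h : IsRMatrix G B r) (g : G) (S : E →L[𝕜] 𝕜) :
    sharp B hB 1 (S.comp (adj 𝕜 E g)) = adj 𝕜 E g⁻¹ (sharp B hB 1 S) := by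
  have key : ∀ v : E, B (sharp B hB 1 (S.comp (adj 𝕜 E g))) v =
      B (adj 𝕜 E g⁻¹ (sharp B hB 1 S)) v := fun v ↦ by
    rw [apply_sharp_one, ContinuousLinearMap.comp_apply, ← apply_sharp_one B hB S,
      ← h.inv_adj g (adj 𝕜 E g⁻¹ (sharp B hB 1 S)) v, adj_adj_inv]
  exact (B.toDual hB).injective (LinearMap.ext key)

theorem IsRMatrix.cyclic (h : IsRMatrix G B r) (S T U : E →L[𝕜] 𝕜) :
    U (lieE 𝕜 G (sharp B hB r S) (sharp B hB r T)) +
      S (lieE 𝕜 G (sharp B hB r T) (sharp B hB r U)) +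
      T (lieE 𝕜 G (sharp B hB r U) (sharp B hB r S)) =
    -B (sharp B hB 1 U) (lieE 𝕜 G (sharp B hB 1 S) (sharp B hB 1 T)) := by
  simp only [sharp_eq B hB r]
  rw [← apply_sharp_one B hB U, ← apply_sharp_one B hB S, ← apply_sharp_one B hB T]
  generalize sharp B hB 1 S = X
  generalize sharp B hB 1 T = Y
  generalize sharp B hB 1 U = Z
  -- Invariance and skewness bring all three summands to the form `B(Z, ·)`, where the Yang–Baxter
  -- expression in `X` and `Y` appears.
  have e1 : B X (lieE 𝕜 G (r Y) (r Z)) = -B Z (r (lieE 𝕜 G X (r Y))) := by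
    rw [← h.inv, h.symm, ← h.skew]
  have e2 : B Y (lieE 𝕜 G (r Z) (r X)) = -B Z (r (lieE 𝕜 G (r X) Y)) := by
    rw [h.symm, h.inv, ← h.skew]
  rw [e1, e2]
  have e3 := congrArg (B Z) (h.yangBaxter X Y)
  simp only [map_sub, map_neg] at e3
  linear_combination e3

theorem IsRMatrix.cyclic_adj (h : IsRMatrix G B r) (g : G) (S T U : E →L[𝕜] 𝕜) :
    B (sharp B hB 1 (U.comp (adj 𝕜 E g))) (lieE 𝕜 G (sharp B hB 1 (S.comp (adj 𝕜 E g)))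
      (sharp B hB 1 (T.comp (adj 𝕜 E g)))) =
    B (sharp B hB 1 U) (lieE 𝕜 G (sharp B hB 1 S) (sharp B hB 1 T)) := by
  rw [h.sharp_comp_adj, h.sharp_comp_adj, h.sharp_comp_adj, ← adj_lieE, h.inv_adj]

/-- Pairing with a gradient is evaluation of the functional, so only one of the two gradients has to
be kept. -/
theorem IsRMatrix.tensor_apply (h : IsRMatrix G B r) (x : G) (α β : Cotangent 𝓘(𝕜, E) x) :
    poissonLieTensor (G := G) B hB r x α β =
      (1 / 2) * rightPull x β (sharp B hB r (rightPull x α)) -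
      (1 / 2) * leftPull x β (sharp B hB r (leftPull x α)) := by
  rw [← apply_sharp_one B hB (rightPull x β), ← apply_sharp_one B hB (leftPull x β), h.symm,
    h.symm (sharp B hB 1 (leftPull x β))]
  rfl

theorem IsRMatrix.bracket_eq (h : IsRMatrix G B r) {f g : G → 𝕜} {x : G}
    (hf : MDifferentiableAt 𝓘(𝕜, E) 𝓘(𝕜, 𝕜) f x) (hg : MDifferentiableAt 𝓘(𝕜, E) 𝓘(𝕜, 𝕜) g x) :
    bracket (poissonLieTensor (G := G) B hB r) f g x = translationBracket (sharp B hB r) f g x := by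
  rw [bracket, h.tensor_apply, translationBracket, rightDer_eq_rightPull hf,
    rightDer_eq_rightPull hg, leftDer_eq_leftPull hf, leftDer_eq_leftPull hg]

theorem IsRMatrix.isPoisson (h : IsRMatrix G B r) : IsPoisson (poissonLieTensor (G := G) B hB r) where
  skew x α β := by
    rw [h.tensor_apply, h.tensor_apply, h.sharp_skew hB, h.sharp_skew hB (leftPull x α)]
    ring
  smooth U hU f g hf hg x hx := by
    have hf' : ∀ y ∈ U, SmoothAt 𝕜 E f y := fun y hy ↦ (hf y hy).contMDiffAt (hU.mem_nhds hy)
    have hg' : ∀ y ∈ U, SmoothAt 𝕜 E g y := fun y hy ↦ (hg y hy).contMDiffAt (hU.mem_nhds hy)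
    refine ContMDiffAt.contMDiffWithinAt (ContMDiffAt.congr_of_eventuallyEq
      (smoothAt_translationBracket (sharp B hB r) (hf' x hx) (hg' x hx)) ?_)
    filter_upwards [hU.mem_nhds hx] with y hy
    exact h.bracket_eq hB (hf' y hy).mdiff (hg' y hy).mdiff
  jacobi U hU f₁ f₂ f₃ h₁ h₂ h₃ x hx := by
    have h₁' : ∀ y ∈ U, SmoothAt 𝕜 E f₁ y := fun y hy ↦ (h₁ y hy).contMDiffAt (hU.mem_nhds hy)
    have h₂' : ∀ y ∈ U, SmoothAt 𝕜 E f₂ y := fun y hy ↦ (h₂ y hy).contMDiffAt (hU.mem_nhds hy)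
    have h₃' : ∀ y ∈ U, SmoothAt 𝕜 E f₃ y := fun y hy ↦ (h₃ y hy).contMDiffAt (hU.mem_nhds hy)
    have key : ∀ {f g k : G → 𝕜}, (∀ y ∈ U, SmoothAt 𝕜 E f y) → (∀ y ∈ U, SmoothAt 𝕜 E g y) →
        (∀ y ∈ U, SmoothAt 𝕜 E k y) →
        bracket (poissonLieTensor (G := G) B hB r) f (bracket (poissonLieTensor (G := G) B hB r) g k) x =
          translationBracket (sharp B hB r) f (translationBracket (sharp B hB r) g k) x := by
      intro f g k hf hg hk
      -- The functions are smooth only on `U`, so the inner brackets are compared near `x`; this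
      -- suffices for their differentials at `x`.
      have e : bracket (poissonLieTensor (G := G) B hB r) g k =ᶠ[𝓝 x]
          translationBracket (sharp B hB r) g k := by
        filter_upwards [hU.mem_nhds hx] with y hy
        exact h.bracket_eq hB (hg y hy).mdiff (hk y hy).mdiff
      rw [← h.bracket_eq hB (hf x hx).mdiff
        (smoothAt_translationBracket (sharp B hB r) (hg x hx) (hk x hx)).mdiff]
      have e2 : differential 𝓘(𝕜, E) (bracket (poissonLieTensor (G := G) B hB r) g k) x =
        differential 𝓘(𝕜, E) (translationBracket (sharp B hB r) g k) x :=
        totalDeriv_congr e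
      rw [bracket, e2, bracket]
    rw [key h₁' h₂' h₃', key h₂' h₃' h₁', key h₃' h₁' h₂']
    refine translationBracket_jacobi (h.sharp_skew hB) (fun g S T U ↦ ?_) (h₁' x hx) (h₂' x hx)
      (h₃' x hx)
    rw [h.cyclic hB, h.cyclic hB, h.cyclic_adj hB]

end PoissonLie

/-! ### Partial derivatives of maps on products, along curves or maps in one factor -/

section PartialDerivatives

variable {𝕜 : Type*} [RCLike 𝕜] {E : Type*} [NormedAddCommGroup E] [NormedSpace 𝕜 E]
  {P : Type*} [TopologicalSpace P] [ChartedSpace E P]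
  {F : Type*} [NormedAddCommGroup F] [NormedSpace 𝕜 F]
  {M : Type*} [TopologicalSpace M] [ChartedSpace F M]
  {F' : Type*} [NormedAddCommGroup F'] [NormedSpace 𝕜 F']
  {M' : Type*} [TopologicalSpace M'] [ChartedSpace F' M']
  {F'' : Type*} [NormedAddCommGroup F''] [NormedSpace 𝕜 F'']
  {M'' : Type*} [TopologicalSpace M''] [ChartedSpace F'' M'']

theorem mfderiv_prod_comp_left {Φ : M × M' → M''} {γ : P → M} {p : P} {x : M} (hx : γ p = x) {y : M'}
    (hΦ : MDifferentiableAt (𝓘(𝕜, F).prod 𝓘(𝕜, F')) 𝓘(𝕜, F'') Φ (x, y))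
    (hγ : MDifferentiableAt 𝓘(𝕜, E) 𝓘(𝕜, F) γ p) (v : E) :
    (mfderiv (𝓘(𝕜, F).prod 𝓘(𝕜, F')) 𝓘(𝕜, F'') Φ (x, y) : F × F' →L[𝕜] F'')
      ((mfderiv 𝓘(𝕜, E) 𝓘(𝕜, F) γ p : E →L[𝕜] F) v, 0) =
    (mfderiv 𝓘(𝕜, E) 𝓘(𝕜, F'') (fun q ↦ Φ (γ q, y)) p : E →L[𝕜] F'') v := by
  subst hx
  have h1 : HasMFDerivAt 𝓘(𝕜, E) (𝓘(𝕜, F).prod 𝓘(𝕜, F')) (fun q ↦ (γ q, y)) p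
      ((mfderiv 𝓘(𝕜, E) 𝓘(𝕜, F) γ p).prod (0 : E →L[𝕜] F')) :=
    hγ.hasMFDerivAt.prodMk (hasMFDerivAt_const y p)
  have h2 := (HasMFDerivAt.comp p hΦ.hasMFDerivAt h1).mfderiv
  exact (congrArg (fun L : E →L[𝕜] F'' ↦ L v) h2).symm

theorem mfderiv_prod_comp_right {Φ : M × M' → M''} {γ : P → M'} {p : P} {x : M} {y : M'} (hy : γ p = y)
    (hΦ : MDifferentiableAt (𝓘(𝕜, F).prod 𝓘(𝕜, F')) 𝓘(𝕜, F'') Φ (x, y))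
    (hγ : MDifferentiableAt 𝓘(𝕜, E) 𝓘(𝕜, F') γ p) (v : E) :
    (mfderiv (𝓘(𝕜, F).prod 𝓘(𝕜, F')) 𝓘(𝕜, F'') Φ (x, y) : F × F' →L[𝕜] F'')
      (0, (mfderiv 𝓘(𝕜, E) 𝓘(𝕜, F') γ p : E →L[𝕜] F') v) =
    (mfderiv 𝓘(𝕜, E) 𝓘(𝕜, F'') (fun q ↦ Φ (x, γ q)) p : E →L[𝕜] F'') v := by
  subst hy
  have h1 : HasMFDerivAt 𝓘(𝕜, E) (𝓘(𝕜, F).prod 𝓘(𝕜, F')) (fun q ↦ (x, γ q)) p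
      ((0 : E →L[𝕜] F).prod (mfderiv 𝓘(𝕜, E) 𝓘(𝕜, F') γ p)) :=
    (hasMFDerivAt_const x p).prodMk hγ.hasMFDerivAt
  have h2 := (HasMFDerivAt.comp p hΦ.hasMFDerivAt h1).mfderiv
  exact (congrArg (fun L : E →L[𝕜] F'' ↦ L v) h2).symm

end PartialDerivatives

/-! ### Multiplicativity -/

section Multiplicative

variable {𝕜 : Type*} [RCLike 𝕜] {E : Type*} [NormedAddCommGroup E] [NormedSpace 𝕜 E]
  [FiniteDimensional 𝕜 E] [CompleteSpace E]
  {G : Type*} [TopologicalSpace G] [ChartedSpace E G] [Group G] [LieGroup 𝓘(𝕜, E) ω G]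
  {B : LinearMap.BilinForm 𝕜 E} (hB : B.Nondegenerate) {r : Module.End 𝕜 E}

variable (𝕜 E G) in
theorem mdifferentiable_mul : MDifferentiable (𝓘(𝕜, E).prod 𝓘(𝕜, E)) 𝓘(𝕜, E)
    (fun p : G × G ↦ p.1 * p.2) :=
  (contMDiff_mul 𝓘(𝕜, E) ω).mdifferentiable (by simp)

/-- On the product, the right term at `x` and the left term at `y` give the two terms at `xy`. The
left term at `x` and the right term at `y` enter with opposite signs and cancel. -/
theorem IsRMatrix.isPoissonMap_mul (h : IsRMatrix G B r) :
    IsPoissonMap (prodTensor (poissonLieTensor (G := G) B hB r) (poissonLieTensor (G := G) B hB r))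
      (poissonLieTensor (G := G) B hB r) fun p : G × G ↦ p.1 * p.2 where
  smooth := (contMDiff_mul 𝓘(𝕜, E) ω).of_le (by simp)
  map_eq p α β := by
    obtain ⟨x, y⟩ := p
    have hm := mdifferentiable_mul 𝕜 E G (x, y)
    have hl : ∀ z : G, MDifferentiableAt 𝓘(𝕜, E) 𝓘(𝕜, E) (fun w : G ↦ z * w) 1 := fun z ↦
      (contMDiff_mul_left' z).mdifferentiable (by simp) 1
    have hr : ∀ z : G, MDifferentiableAt 𝓘(𝕜, E) 𝓘(𝕜, E) (fun w : G ↦ w * z) 1 := fun z ↦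
      (contMDiff_mul_right' z).mdifferentiable (by simp) 1
    set D : E × E →L[𝕜] E := mfderiv (𝓘(𝕜, E).prod 𝓘(𝕜, E)) 𝓘(𝕜, E)
      (fun p : G × G ↦ p.1 * p.2) (x, y)
    have hc : ∀ {f g : G → G} (_ : f = g) (ξ : E), (mfderiv 𝓘(𝕜, E) 𝓘(𝕜, E) f 1 : E →L[𝕜] E) ξ =
      (mfderiv 𝓘(𝕜, E) 𝓘(𝕜, E) g 1 : E →L[𝕜] E) ξ := by rintro f g rfl ξ; rfl
    have k1 : ∀ ξ : E, D (rightTranslation (𝕜 := 𝕜) (E := E) x ξ, 0) =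
        rightTranslation (𝕜 := 𝕜) (E := E) (x * y) ξ := fun ξ ↦
      (mfderiv_prod_comp_left (γ := fun w : G ↦ w * x) (one_mul x) hm (hr x) ξ).trans
        (hc (funext fun w ↦ mul_assoc w x y) ξ)
    have k2 : ∀ ξ : E, D (0, leftTranslation (𝕜 := 𝕜) (E := E) y ξ) =
        leftTranslation (𝕜 := 𝕜) (E := E) (x * y) ξ := fun ξ ↦
      (mfderiv_prod_comp_right (γ := fun w : G ↦ y * w) (mul_one y) hm (hl y) ξ).trans
        (hc (funext fun w ↦ (mul_assoc x y w).symm) ξ)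
    -- The identity `(xw)y = x(wy)`: a factor inserted in the middle may be attached to either side.
    have k3 : ∀ ξ : E, D (leftTranslation (𝕜 := 𝕜) (E := E) x ξ, 0) =
        D (0, rightTranslation (𝕜 := 𝕜) (E := E) y ξ) := fun ξ ↦
      (mfderiv_prod_comp_left (γ := fun w : G ↦ x * w) (mul_one x) hm (hl x) ξ).trans
        ((hc (funext fun w ↦ mul_assoc x w y) ξ).trans
          (mfderiv_prod_comp_right (γ := fun w : G ↦ w * y) (one_mul y) hm (hr y) ξ).symm)
    let l (α : E →L[𝕜] 𝕜) : Cotangent 𝓘(𝕜, E) x := (α.comp D).comp (ContinuousLinearMap.inl 𝕜 E E)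
    let m (α : E →L[𝕜] 𝕜) : Cotangent 𝓘(𝕜, E) y := (α.comp D).comp (ContinuousLinearMap.inr 𝕜 E E)
    change poissonLieTensor (G := G) B hB r (x * y) α β =
      poissonLieTensor (G := G) B hB r x (l α) (l β) + poissonLieTensor (G := G) B hB r y (m α) (m β)
    have e1 : ∀ α : Cotangent 𝓘(𝕜, E) (x * y), rightPull x (l α) = rightPull (x * y) α := fun α ↦
      ContinuousLinearMap.ext fun ξ ↦ congrArg α (k1 ξ)
    have e2 : ∀ α : Cotangent 𝓘(𝕜, E) (x * y), leftPull y (m α) = leftPull (x * y) α := fun α ↦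
      ContinuousLinearMap.ext fun ξ ↦ congrArg α (k2 ξ)
    have e3 : ∀ α : Cotangent 𝓘(𝕜, E) (x * y), leftPull x (l α) = rightPull y (m α) := fun α ↦
      ContinuousLinearMap.ext fun ξ ↦ congrArg α (k3 ξ)
    rw [h.tensor_apply, h.tensor_apply, h.tensor_apply, e1, e1, e2, e2, e3, e3]
    ring

theorem IsRMatrix.isPoissonLie (h : IsRMatrix G B r) : IsPoissonLie (poissonLieTensor (G := G) B hB r) :=
  ⟨h.isPoisson hB, h.isPoissonMap_mul hB⟩

end Multiplicative

/-! ### Admissibility and conjugation invariants -/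

section Coisotropic

variable {𝕜 : Type*} [RCLike 𝕜] {E : Type*} [NormedAddCommGroup E] [NormedSpace 𝕜 E]
  [FiniteDimensional 𝕜 E] [CompleteSpace E]
  {G : Type*} [TopologicalSpace G] [ChartedSpace E G] [Group G] [LieGroup 𝓘(𝕜, E) ω G]

/-- The subgroup `K` integrates the `r`-invariant isotropic subspace `n`, and its elements act on
the orthogonal complement of `n` trivially modulo `n`. -/
structure IsIsotropicSubgroup (B : LinearMap.BilinForm 𝕜 E) (r : Module.End 𝕜 E) (n : Set E)
    (K : Subgroup G) : Prop where
  deriv_eq_zero : ∀ v ∈ n, ∀ φ : G → 𝕜, MDifferentiableAt 𝓘(𝕜, E) 𝓘(𝕜, 𝕜) φ 1 →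
    (∀ k ∈ K, φ k = φ 1) → totalDeriv 𝕜 E φ 1 v = 0
  adj_sub_mem : ∀ k ∈ K, ∀ X : E, (∀ v ∈ n, B X v = 0) → adj 𝕜 E k X - X ∈ n
  map_mem : ∀ v ∈ n, r v ∈ n
  isotropic : ∀ v ∈ n, ∀ w ∈ n, B v w = 0

variable {B : LinearMap.BilinForm 𝕜 E} (hB : B.Nondegenerate) {r : Module.End 𝕜 E}
  {n : Set E} {K : Subgroup G}

/-- The vectors representing `S` and `T` are orthogonal to `n`, so composing with `Ad k` changes
them only by elements of `n`. The cross terms vanish because `r` is skew and preserves `n`, the last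
one because `n` is isotropic. -/
theorem IsRMatrix.pairing_comp_adj (h : IsRMatrix G B r)
    (hK : IsIsotropicSubgroup B r n K) {k : G} (hk : k ∈ K) {S T : E →L[𝕜] 𝕜} (hS : ∀ v ∈ n, S v = 0)
    (hT : ∀ v ∈ n, T v = 0) :
    T.comp (adj 𝕜 E k) (sharp B hB r (S.comp (adj 𝕜 E k))) = T (sharp B hB r S) := by
  have key : ∀ {S : E →L[𝕜] 𝕜}, (∀ v ∈ n, S v = 0) → ∃ v ∈ n,
      sharp B hB 1 (S.comp (adj 𝕜 E k)) = sharp B hB 1 S + v := fun {S} hS ↦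
    ⟨_, hK.adj_sub_mem k⁻¹ (inv_mem hk) (sharp B hB 1 S)
      fun v hv ↦ (apply_sharp_one B hB S v).trans (hS v hv), by rw [h.sharp_comp_adj]; abel⟩
  obtain ⟨v, hv, ev⟩ := key hS
  obtain ⟨w, hw, ew⟩ := key hT
  rw [← apply_sharp_one B hB (T.comp _), ← apply_sharp_one B hB T, sharp_eq B hB r S,
    sharp_eq B hB r (S.comp _), ev, ew]
  have e1 : B (sharp B hB 1 T) (r v) = 0 := (apply_sharp_one B hB T _).trans (hT _ (hK.map_mem v hv))
  have e2 : B w (r (sharp B hB 1 S)) = 0 := by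
    rw [← neg_eq_zero, ← h.skew, h.symm, apply_sharp_one, hS _ (hK.map_mem w hw)]
  have e3 := hK.isotropic w hw (r v) (hK.map_mem v hv)
  simp only [map_add, LinearMap.add_apply, e1, e2, e3, add_zero]

theorem IsRMatrix.isAdmissible (h : IsRMatrix G B r)
    (hK : IsIsotropicSubgroup B r n K) : IsAdmissible.{u, v} (poissonLieTensor (G := G) B hB r) K := by
  intro F _ _ _ M _ _ _ _ ρ hρ ha f g hf hg hfK hgK
  refine ⟨contMDiffOn_univ.1 (hρ.smooth univ isOpen_univ f g hf.contMDiffOn hg.contMDiffOn), ?_⟩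
  intro k hk x
  have hd : ∀ {f : M → 𝕜}, ContMDiff 𝓘(𝕜, F) 𝓘(𝕜, 𝕜) ∞ f →
      MDifferentiableAt (𝓘(𝕜, E).prod 𝓘(𝕜, F)) 𝓘(𝕜, 𝕜) (fun p : G × M ↦ f (p.1 • p.2)) (k, x) :=
    fun hf ↦ (hf.comp ha.smooth).mdifferentiableAt (by simp)
  have horb : ContMDiff 𝓘(𝕜, E) 𝓘(𝕜, F) ∞ (fun y : G ↦ y • x) :=
    ha.smooth.comp (contMDiff_id.prodMk contMDiff_const)
  have hφ : ∀ {f : M → 𝕜}, ContMDiff 𝓘(𝕜, F) 𝓘(𝕜, 𝕜) ∞ f →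
      SmoothAt 𝕜 E (fun y : G ↦ f (y • x)) k := fun hf ↦ (hf.comp horb).contMDiffAt
  set D : E × F →L[𝕜] F := mfderiv (𝓘(𝕜, E).prod 𝓘(𝕜, F)) 𝓘(𝕜, F)
    (fun p : G × M ↦ p.1 • p.2) (k, x)
  let l (α : F →L[𝕜] 𝕜) : Cotangent 𝓘(𝕜, E) k := (α.comp D).comp (ContinuousLinearMap.inl 𝕜 E F)
  let m (α : F →L[𝕜] 𝕜) : Cotangent 𝓘(𝕜, F) x := (α.comp D).comp (ContinuousLinearMap.inr 𝕜 E F)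
  have hcomp : ∀ {f : M → 𝕜}, ContMDiff 𝓘(𝕜, F) 𝓘(𝕜, 𝕜) ∞ f → ∀ v : E × F,
      (mfderiv (𝓘(𝕜, E).prod 𝓘(𝕜, F)) 𝓘(𝕜, 𝕜) (fun p : G × M ↦ f (p.1 • p.2)) (k, x) :
        E × F →L[𝕜] 𝕜) v = (differential 𝓘(𝕜, F) f (k • x) : F →L[𝕜] 𝕜) (D v) := fun {f} hf v ↦ by
    have := mfderiv_comp (I := 𝓘(𝕜, E).prod 𝓘(𝕜, F)) (I' := 𝓘(𝕜, F)) (I'' := 𝓘(𝕜, 𝕜)) (k, x)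
      (g := f) (f := fun p : G × M ↦ p.1 • p.2) (hf.mdifferentiableAt (by simp))
      (ha.smooth.mdifferentiableAt (by simp))
    exact congrArg (fun L : E × F →L[𝕜] 𝕜 ↦ L v) this
  -- The group component of the pulled-back differential is that of the orbit function; by
  -- invariance, the component along `M` (`hm`) is the differential of `f` at `x`.
  have hl : ∀ {f : M → 𝕜}, ContMDiff 𝓘(𝕜, F) 𝓘(𝕜, 𝕜) ∞ f →
      l (differential 𝓘(𝕜, F) f (k • x)) = differential 𝓘(𝕜, E) (fun y : G ↦ f (y • x)) k := by
    intro f hf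
    refine ContinuousLinearMap.ext fun ξ ↦ ?_
    refine (hcomp hf (ξ, 0)).symm.trans ?_
    have := mfderiv_prod_comp_left (γ := fun y : G ↦ y) rfl (hd hf) mdifferentiableAt_id ξ
    refine Eq.trans ?_ this
    have e : (mfderiv 𝓘(𝕜, E) 𝓘(𝕜, E) (fun y : G ↦ y) k : E →L[𝕜] E) ξ = ξ :=
      congrArg (fun L : E →L[𝕜] E ↦ L ξ) mfderiv_id
    rw [e]
  have hm : ∀ {f : M → 𝕜}, ContMDiff 𝓘(𝕜, F) 𝓘(𝕜, 𝕜) ∞ f → (∀ k ∈ K, ∀ x, f (k • x) = f x) →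
      m (differential 𝓘(𝕜, F) f (k • x)) = differential 𝓘(𝕜, F) f x := by
    intro f hf hfK
    refine ContinuousLinearMap.ext fun ξ ↦ ?_
    refine (hcomp hf (0, ξ)).symm.trans ?_
    have := mfderiv_prod_comp_right (γ := fun y : M ↦ y) rfl (hd hf) mdifferentiableAt_id ξ
    have e : (mfderiv 𝓘(𝕜, F) 𝓘(𝕜, F) (fun y : M ↦ y) x : F →L[𝕜] F) ξ = ξ :=
      congrArg (fun L : F →L[𝕜] F ↦ L ξ) mfderiv_id
    rw [e] at this
    exact this.trans (congrArg (fun φ : M → 𝕜 ↦ totalDeriv 𝕜 F φ x ξ) (funext (hfK k hk)))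
  -- The function `y ↦ f((yk)x)` is constant on `K`, so its derivative at the unit kills `n`.
  have hann : ∀ {f : M → 𝕜}, ContMDiff 𝓘(𝕜, F) 𝓘(𝕜, 𝕜) ∞ f → (∀ k ∈ K, ∀ x, f (k • x) = f x) →
      ∀ v ∈ n, rightDer 𝕜 E (fun y : G ↦ f (y • x)) k v = 0 := by
    intro f hf hfK v hv
    refine hK.deriv_eq_zero v hv _
      (((hφ hf).comp (contMDiff_mul_right' k) (one_mul k)).mdiff) fun k' hk' ↦ ?_
    simp only [mul_smul, one_smul, hfK k' hk']
  -- The left differentials are the right ones composed with `Ad k`, so the two halves of the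
  -- bracket are equal.
  have hz : bracket (poissonLieTensor (G := G) B hB r) (fun y : G ↦ f (y • x))
      (fun y : G ↦ g (y • x)) k = 0 := by
    rw [h.bracket_eq hB (hφ hf).mdiff (hφ hg).mdiff, translationBracket,
      leftDer_eq_rightDer_comp_adj (hφ hf).mdiff, leftDer_eq_rightDer_comp_adj (hφ hg).mdiff,
      h.pairing_comp_adj hB hK hk (hann hf hfK) (hann hg hgK), sub_self]
  have e := ha.map_eq (k, x) (differential 𝓘(𝕜, F) f (k • x)) (differential 𝓘(𝕜, F) g (k • x))
  refine e.trans ?_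
  change poissonLieTensor (G := G) B hB r k (l _) (l _) + ρ x (m _) (m _) = _
  rw [hl hf, hl hg, hm hf hfK, hm hg hgK]
  refine (congrArg (· + _) hz).trans (zero_add _)

/-- The `r`-parts of the four terms assemble into a pairing of differences; the identity parts of
`r₊` and `r₋` leave two terms without `r`. Only the former needs the annihilation of `n`. -/
theorem IsRMatrix.dual_apply (h : IsRMatrix G B r) (x : G) (α β : Cotangent 𝓘(𝕜, E) x) :
    dualTensor (G := G) B hB r x α β =
      (rightPull x β - leftPull x β) (sharp B hB r (rightPull x α - leftPull x α)) -
        rightPull x β (sharp B hB 1 (leftPull x α)) + leftPull x β (sharp B hB 1 (rightPull x α)) := by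
  have e : dualTensor (G := G) B hB r x α β =
      B (r (sharp B hB 1 (rightPull x α))) (sharp B hB 1 (rightPull x β)) +
      B (r (sharp B hB 1 (leftPull x α))) (sharp B hB 1 (leftPull x β)) -
      2 * B ((1 / 2 : 𝕜) • (r (sharp B hB 1 (leftPull x α)) + sharp B hB 1 (leftPull x α)))
        (sharp B hB 1 (rightPull x β)) -
      2 * B ((1 / 2 : 𝕜) • (r (sharp B hB 1 (rightPull x α)) - sharp B hB 1 (rightPull x α)))
        (sharp B hB 1 (leftPull x β)) := rfl
  have e' : ∀ (S : E →L[𝕜] 𝕜) v, B v (sharp B hB 1 S) = S v := fun S v ↦ by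
    rw [h.symm, apply_sharp_one]
  rw [e]
  simp only [e', map_sub, map_add, map_smul, sub_apply, LinearMap.sub_apply, LinearMap.add_apply,
    LinearMap.smul_apply, smul_eq_mul, sharp_eq B hB r]
  ring

/-- The bracket of `dualTensor` in terms of derivatives along translations. -/
def dualBracket (B : LinearMap.BilinForm 𝕜 E) (hB : B.Nondegenerate) (r : Module.End 𝕜 E)
    (f g : G → 𝕜) (x : G) : 𝕜 :=
  (rightDer 𝕜 E g x - leftDer 𝕜 E g x) (sharp B hB r (rightDer 𝕜 E f x - leftDer 𝕜 E f x)) -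
    rightDer 𝕜 E g x (sharp B hB 1 (leftDer 𝕜 E f x)) +
    leftDer 𝕜 E g x (sharp B hB 1 (rightDer 𝕜 E f x))

theorem IsRMatrix.bracket_dual_eq (h : IsRMatrix G B r) {f g : G → 𝕜} {x : G}
    (hf : MDifferentiableAt 𝓘(𝕜, E) 𝓘(𝕜, 𝕜) f x) (hg : MDifferentiableAt 𝓘(𝕜, E) 𝓘(𝕜, 𝕜) g x) :
    bracket (dualTensor (G := G) B hB r) f g x = dualBracket B hB r f g x := by
  rw [bracket, h.dual_apply, dualBracket, rightDer_eq_rightPull hf,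
    rightDer_eq_rightPull hg, leftDer_eq_leftPull hf, leftDer_eq_leftPull hg]

theorem IsRMatrix.invariantsClosed_conj (h : IsRMatrix G B r)
    (hK : IsIsotropicSubgroup B r n K) :
    InvariantsClosed (fun g x : G ↦ g * x * g⁻¹) (K : Set G) (dualTensor (G := G) B hB r) := by
  intro f g hf hg hfK hgK
  have hs : ∀ {f : G → 𝕜}, ContMDiff 𝓘(𝕜, E) 𝓘(𝕜, 𝕜) ∞ f → ∀ x, SmoothAt 𝕜 E f x :=
    fun hf x ↦ hf.contMDiffAt
  have hb : bracket (dualTensor (G := G) B hB r) f g = dualBracket B hB r f g :=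
    funext fun x ↦ h.bracket_dual_eq hB (hs hf x).mdiff (hs hg x).mdiff
  rw [hb]
  constructor
  · intro x
    have hR : ∀ {f : G → 𝕜}, ContMDiff 𝓘(𝕜, E) 𝓘(𝕜, 𝕜) ∞ f →
      SmoothAt 𝕜 E (fun y ↦ rightDer 𝕜 E f y) x := fun hf ↦ SmoothAt.rightDer (hs hf x)
    have hL : ∀ {f : G → 𝕜}, ContMDiff 𝓘(𝕜, E) 𝓘(𝕜, 𝕜) ∞ f →
      SmoothAt 𝕜 E (fun y ↦ leftDer 𝕜 E f y) x := fun hf ↦ SmoothAt.leftDer (hs hf x)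
    have hD : ∀ {f : G → 𝕜}, ContMDiff 𝓘(𝕜, E) 𝓘(𝕜, 𝕜) ∞ f →
      SmoothAt 𝕜 E (fun y ↦ rightDer 𝕜 E f y - leftDer 𝕜 E f y) x :=
        fun hf ↦ ContMDiffAt.sub (hR hf) (hL hf)
    exact ContMDiffAt.add (smoothAt_sub (smoothAt_pairing _ (hD hf) (hD hg))
      (smoothAt_pairing _ (hL hf) (hR hg))) (smoothAt_pairing _ (hR hf) (hL hg))
  · intro k hk x
    have hR : ∀ {f : G → 𝕜}, ContMDiff 𝓘(𝕜, E) 𝓘(𝕜, 𝕜) ∞ f →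
        (∀ k ∈ K, ∀ x, f (k * x * k⁻¹) = f x) →
        rightDer 𝕜 E f (k * x * k⁻¹) = (rightDer 𝕜 E f x).comp (adj 𝕜 E k⁻¹) := by
      intro f hf hfK
      ext ξ
      have := rightDer_conj (g := k) (y := x) (hs hf _).mdiff (adj 𝕜 E k⁻¹ ξ)
      rw [adj_adj_inv] at this
      rw [← this]
      simp only [hfK k hk]
      rfl
    have hL : ∀ {f : G → 𝕜}, ContMDiff 𝓘(𝕜, E) 𝓘(𝕜, 𝕜) ∞ f →
        (∀ k ∈ K, ∀ x, f (k * x * k⁻¹) = f x) →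
        leftDer 𝕜 E f (k * x * k⁻¹) = (leftDer 𝕜 E f x).comp (adj 𝕜 E k⁻¹) := by
      intro f hf hfK
      ext ξ
      have := leftDer_conj (g := k) (y := x) (hs hf _).mdiff (adj 𝕜 E k⁻¹ ξ)
      rw [adj_adj_inv] at this
      rw [← this]
      simp only [hfK k hk]
      rfl
    have hann : ∀ {f : G → 𝕜}, ContMDiff 𝓘(𝕜, E) 𝓘(𝕜, 𝕜) ∞ f →
        (∀ k ∈ K, ∀ x, f (k * x * k⁻¹) = f x) → ∀ v ∈ n,
        (rightDer 𝕜 E f x - leftDer 𝕜 E f x) v = 0 := by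
      intro f hf hfK v hv
      have s1 : SmoothAt 𝕜 E (fun y ↦ f (y * x)) 1 :=
        (hs hf x).comp (contMDiff_mul_right' x) (one_mul x)
      have s2 : SmoothAt 𝕜 E (fun y ↦ f (x * y)) 1 :=
        (hs hf x).comp (contMDiff_mul_left' x) (mul_one x)
      -- The function `y ↦ f(yx) - f(xy)` vanishes on `K`, because `k'x = k'(xk')k'⁻¹`.
      have e := hK.deriv_eq_zero v hv _ (smoothAt_sub s1 s2).mdiff fun k' hk' ↦ by
        have := hfK k' hk' (x * k')
        rw [← mul_assoc, mul_inv_cancel_right] at this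
        simp [this]
      rw [totalDeriv_sub s1 s2] at e
      exact e
    rw [dualBracket, dualBracket, hR hf hfK, hR hg hgK, hL hf hfK, hL hg hgK,
      ← ContinuousLinearMap.sub_comp, ← ContinuousLinearMap.sub_comp,
      h.pairing_comp_adj hB hK (inv_mem hk) (hann hf hfK) (hann hg hgK), h.sharp_comp_adj,
      h.sharp_comp_adj, ContinuousLinearMap.comp_apply, ContinuousLinearMap.comp_apply,
      adj_adj_inv, adj_adj_inv]

end Coisotropic

/-! ### The underlying real Lie group -/

section RealStructure

variable {E : Type*} [NormedAddCommGroup E] [NormedSpace ℂ E]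
  {F : Type*} [NormedAddCommGroup F] [NormedSpace ℂ F]

theorem isManifold_real {n : ℕ∞ω} (M : Type*) [TopologicalSpace M] [ChartedSpace E M]
    [IsManifold 𝓘(ℂ, E) n M] : IsManifold 𝓘(ℝ, E) n M := by
  refine isManifold_of_contDiffOn 𝓘(ℝ, E) n M fun e e' he he' ↦ ?_
  have h := mem_groupoid_of_pregroupoid.1
    (HasGroupoid.compatible (G := contDiffGroupoid n 𝓘(ℂ, E)) he he')
  exact ContDiffOn.restrict_scalars ℝ h.1

theorem contMDiff_real {M : Type*} [TopologicalSpace M] [ChartedSpace E M]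
    {N : Type*} [TopologicalSpace N] [ChartedSpace F N] {n : ℕ∞ω} {f : M → N}
    (hf : ContMDiff 𝓘(ℂ, E) 𝓘(ℂ, F) n f) : ContMDiff 𝓘(ℝ, E) 𝓘(ℝ, F) n f := fun x ↦ by
  have h := contMDiffAt_iff.1 (hf x)
  exact contMDiffAt_iff.2 ⟨h.1, h.2.restrict_scalars ℝ⟩

theorem mdifferentiableAt_real {M : Type*} [TopologicalSpace M] [ChartedSpace E M]
    {f : M → F} {x : M}
    (hf : MDifferentiableAt 𝓘(ℂ, E) 𝓘(ℂ, F) f x) : MDifferentiableAt 𝓘(ℝ, E) 𝓘(ℝ, F) f x := by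
  rw [mdifferentiableAt_iff] at hf ⊢
  exact ⟨hf.1, hf.2.restrictScalars ℝ⟩

/-- The charts are the same maps over `ℝ` and over `ℂ`, so the comparison is restriction of scalars
in the model space. -/
theorem totalDeriv_real [CompleteSpace E] {M : Type*} [TopologicalSpace M] [ChartedSpace E M]
    [IsManifold 𝓘(ℂ, E) ω M] {f : M → F} {x : M}
    (hf : MDifferentiableAt 𝓘(ℂ, E) 𝓘(ℂ, F) f x) (v : E) :
    totalDeriv ℝ E f x v = totalDeriv ℂ E f x v := by
  have := isManifold_real (E := E) (n := ω) M
  rw [totalDeriv_eq_fderiv hf, totalDeriv_eq_fderiv (mdifferentiableAt_real hf)]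
  have h : HasFDerivWithinAt (f ∘ (extChartAt 𝓘(ℂ, E) x).symm) (totalDeriv ℂ E f x)
      (range 𝓘(ℂ, E)) (extChartAt 𝓘(ℂ, E) x x) := hf.hasMFDerivAt.2
  rw [modelWithCornersSelf_coe, range_id, hasFDerivWithinAt_univ] at h
  have h2 := h.differentiableAt.fderiv_restrictScalars ℝ
  exact congrArg (fun L : E →L[ℝ] F ↦ L v) h2

variable {G : Type*} [TopologicalSpace G] [ChartedSpace E G] [Group G]

variable (E G) in
theorem lieGroup_real [LieGroup 𝓘(ℂ, E) ω G] : LieGroup 𝓘(ℝ, E) ω G :=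
  haveI := isManifold_real (E := E) (n := ω) G
  { contMDiff_mul := fun x ↦ by
      have h := contMDiffAt_iff.1 (contMDiff_mul 𝓘(ℂ, E) ω (G := G) x)
      exact contMDiffAt_iff.2 ⟨h.1, h.2.restrict_scalars ℝ⟩
    contMDiff_inv := contMDiff_real (contMDiff_inv 𝓘(ℂ, E) ω) }

variable [LieGroup 𝓘(ℂ, E) ω G] [CompleteSpace E]

theorem leftDer_real {f : G → F} {x : G} (hf : MDifferentiableAt 𝓘(ℂ, E) 𝓘(ℂ, F) f x) (v : E) :
    leftDer ℝ E f x v = leftDer ℂ E f x v :=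
  totalDeriv_real (mdifferentiableAt_comp_smooth hf (contMDiff_mul_left' x) (mul_one x)) v

theorem adj_real (g : G) (v : E) : adj ℝ E g v = adj ℂ E g v := by
  have := lieGroup_real E G
  rw [adj_eq, adj_eq, ← totalDeriv_real]
  · rfl
  · exact ((smoothAt_unitChart (𝕜 := ℂ) (E := E) (G := G)).comp (contMDiff_conj g) (by simp)).mdiff

/-- The formula `lieE_eq` involves only derivatives of a holomorphic chart, and these do not depend
on the scalar field. -/
theorem lieE_real [LieGroup 𝓘(ℝ, E) ω G] (v w : E) : lieE ℝ G v w = lieE ℂ G v w := by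
  have hs := smoothAt_unitChart (𝕜 := ℂ) (E := E) (G := G)
  have key : ∀ v w : E, leftDer ℝ E (fun y ↦ leftDer ℝ E (unitChart ℝ E G) y w) 1 v =
      leftDer ℂ E (fun y ↦ leftDer ℂ E (unitChart ℂ E G) y w) 1 v := by
    intro v w
    rw [← leftDer_real ((SmoothAt.leftDer hs).apply_const w).mdiff]
    refine congrArg (fun L : E →L[ℝ] E ↦ L v) (leftDer_congr ?_)
    filter_upwards [eventually_smoothAt hs] with y hy
    exact leftDer_real hy w
  rw [lieE_eq, lieE_eq, key, key]

end RealStructure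

/-! ### One-parameter subgroups and the exponential formula for `Ad` -/

section IntegralCurves

variable {E : Type*} [NormedAddCommGroup E] [NormedSpace ℝ E] [CompleteSpace E]
  {F : Type*} [NormedAddCommGroup F] [NormedSpace ℝ F]
  {G : Type*} [TopologicalSpace G] [ChartedSpace E G] [Group G] [LieGroup 𝓘(ℝ, E) ω G]

theorem isMIntegralCurveOn_mul_left {γ : ℝ → G} {v : E} {s : Set ℝ}
    (hγ : IsMIntegralCurveOn (I := 𝓘(ℝ, E)) γ (mulInvariantVectorField (I := 𝓘(ℝ, E)) (G := G) v) s) (x : G) :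
    IsMIntegralCurveOn (I := 𝓘(ℝ, E)) (fun t ↦ x * γ t) (mulInvariantVectorField (I := 𝓘(ℝ, E)) (G := G) v) s := by
  intro t ht
  have hx : ∀ x y : G, MDifferentiableAt 𝓘(ℝ, E) 𝓘(ℝ, E) (fun y : G ↦ x * y) y := fun x y ↦
    (contMDiff_mul_left' x).mdifferentiableAt (by simp)
  have h := (hx x (γ t)).hasMFDerivAt.comp_hasMFDerivWithinAt t (hγ t ht)
  have e : (mfderiv 𝓘(ℝ, E) 𝓘(ℝ, E) (fun y : G ↦ x * y) (γ t) : E →L[ℝ] E)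
        (mulInvariantVectorField (I := 𝓘(ℝ, E)) (G := G) v (γ t)) =
        mulInvariantVectorField (I := 𝓘(ℝ, E)) (G := G) v (x * γ t) := by
    have h1 : HasMFDerivAt 𝓘(ℝ, E) 𝓘(ℝ, E) (fun y : G ↦ x * y) (γ t * 1)
        (mfderiv 𝓘(ℝ, E) 𝓘(ℝ, E) (fun y : G ↦ x * y) (γ t) : E →L[ℝ] E) := by
      rw [mul_one]; exact (hx x (γ t)).hasMFDerivAt
    have h2 := (h1.comp (1 : G) (f := fun y : G ↦ γ t * y) (hx (γ t) 1).hasMFDerivAt).mfderiv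
    have h3 : ((fun y : G ↦ x * y) ∘ fun y : G ↦ γ t * y) = fun y : G ↦ x * γ t * y :=
      funext fun y ↦ (mul_assoc x (γ t) y).symm
    have h4 : ∀ {f g : G → G} (_ : f = g), (mfderiv 𝓘(ℝ, E) 𝓘(ℝ, E) f 1 : E →L[ℝ] E) =
      (mfderiv 𝓘(ℝ, E) 𝓘(ℝ, E) g 1 : E →L[ℝ] E) := by rintro f g rfl; rfl
    have h5 := h4 h3
    exact congrArg (fun L : E →L[ℝ] E ↦ L v) (h2.symm.trans h5)
  refine HasMFDerivWithinAt.congr_mfderiv h ?_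
  ext
  refine Eq.trans ?_ ((one_smul ℝ _).symm.trans (congrArg (fun z : E ↦ (1 : ℝ) • z) e))
  change (mfderiv 𝓘(ℝ, E) 𝓘(ℝ, E) (fun y : G ↦ x * y) (γ t) : E →L[ℝ] E)
    ((1 : ℝ) • (mulInvariantVectorField (I := 𝓘(ℝ, E)) (G := G) v (γ t) : E)) = _
  rw [one_smul]

/-- Left translates of a local integral curve at the unit give integral curves through every point
on one common time interval, and this uniformity yields completeness. -/
theorem exists_isMIntegralCurve_one (v : E) :
    ∃ γ : ℝ → G, γ 0 = 1 ∧ IsMIntegralCurve (I := 𝓘(ℝ, E)) γ (mulInvariantVectorField (I := 𝓘(ℝ, E)) (G := G) v) := by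
  have : IsTopologicalGroup G := topologicalGroup_of_lieGroup 𝓘(ℝ, E) ω
  have : T1Space G := ChartedSpace.t1Space E G
  have : T2Space G := inferInstance
  have h12 : (1 : ℕ∞ω) ≤ minSmoothness ℝ 2 := by
    rw [minSmoothness_of_isRCLikeNormedField]; norm_num
  have hv := (contMDiff_mulInvariantVectorField (I := 𝓘(ℝ, E)) (G := G) v).of_le h12
  obtain ⟨γ, h0, hγ⟩ := exists_isMIntegralCurveAt_of_contMDiffAt_boundaryless (t₀ := 0)
    (hv.contMDiffAt (x := 1))
  obtain ⟨ε, hε, hγ⟩ := isMIntegralCurveAt_iff'.1 hγ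
  rw [Real.ball_eq_Ioo, zero_sub, zero_add] at hγ
  exact exists_isMIntegralCurve_of_isMIntegralCurveOn hv hε (fun x ↦
    ⟨fun t ↦ x * γ t, by simp [h0], isMIntegralCurveOn_mul_left hγ x⟩) 1

theorem hasDerivAt_comp_curve {γ : ℝ → G} {v : E}
    (hγ : IsMIntegralCurve (I := 𝓘(ℝ, E)) γ (mulInvariantVectorField (I := 𝓘(ℝ, E)) (G := G) v)) {f : G → F} {t : ℝ}
    (hf : MDifferentiableAt 𝓘(ℝ, E) 𝓘(ℝ, F) f (γ t)) :
    HasDerivAt (fun s ↦ f (γ s)) (leftDer ℝ E f (γ t) v) t := by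
  have h : HasFDerivAt (fun s ↦ f (γ s)) ((totalDeriv ℝ E f (γ t)).comp
      ((1 : ℝ →L[ℝ] ℝ).smulRight (mulInvariantVectorField (I := 𝓘(ℝ, E)) (G := G) v (γ t) : E))) t :=
    (hf.hasMFDerivAt.comp t (hγ t)).hasFDerivAt
  refine h.hasDerivAt.congr_deriv (Eq.symm ((leftDer_eq hf v).trans ?_))
  change totalDeriv ℝ E f (γ t) _ = totalDeriv ℝ E f (γ t)
    ((1 : ℝ) • (mulInvariantVectorField (I := 𝓘(ℝ, E)) (G := G) v (γ t) : E))
  rw [one_smul]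
  rfl

variable (G) in
/-- The operator `ad v` on the model space. -/
def adE (v : E) : E →L[ℝ] E := leftDer ℝ E (adj ℝ E : G → E →L[ℝ] E) 1 v

theorem hasDerivAt_adj_apply {γ : ℝ → G} {v : E}
    (hγ : IsMIntegralCurve (I := 𝓘(ℝ, E)) γ (mulInvariantVectorField (I := 𝓘(ℝ, E)) (G := G) v)) (t : ℝ) (w : E) :
    HasDerivAt (fun s ↦ adj ℝ E (γ s) w) (adj ℝ E (γ t) (lieE ℝ G v w)) t := by
  have h := hasDerivAt_comp_curve hγ ((smoothAt_adj (𝕜 := ℝ) (E := E) (γ t)).apply_const w).mdiff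
  exact h.congr_deriv (leftDer_adj (γ t) v w)

/-- The operator-valued derivative and the derivative of its value at `w` are compared along the
integral curve through the unit. -/
theorem adE_apply (v w : E) : adE G v w = lieE ℝ G v w := by
  obtain ⟨γ, h0, hγ⟩ := exists_isMIntegralCurve_one (G := G) v
  have h1 := hasDerivAt_comp_curve hγ (smoothAt_adj (𝕜 := ℝ) (E := E) (γ 0)).mdiff
  have h2 := hasDerivAt_adj_apply hγ 0 w
  have h3 := (h1.clm_apply (hasDerivAt_const 0 w)).unique h2
  rw [h0] at h3
  simpa [adE, adj_one] using h3

theorem exp_neg_mul_exp (A : E →L[ℝ] E) : NormedSpace.exp (-A) * NormedSpace.exp A = 1 := by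
  let _ : NormedAlgebra ℚ (E →L[ℝ] E) := NormedAlgebra.restrictScalars ℚ ℝ (E →L[ℝ] E)
  rw [← NormedSpace.exp_add_of_commute (Commute.neg_left (Commute.refl A)), neg_add_cancel,
    NormedSpace.exp_zero]

theorem adj_curve_one {γ : ℝ → G} {v : E} (h0 : γ 0 = 1)
    (hγ : IsMIntegralCurve (I := 𝓘(ℝ, E)) γ (mulInvariantVectorField (I := 𝓘(ℝ, E)) (G := G) v)) :
    adj ℝ E (γ 1) = NormedSpace.exp (adE G v) := by
  have ha : ∀ t, HasDerivAt (fun s ↦ (adj ℝ E (γ s) : E →L[ℝ] E))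
      (adj ℝ E (γ t) * adE G v : E →L[ℝ] E) t := fun t ↦ by
    have h1 := hasDerivAt_comp_curve hγ (smoothAt_adj (𝕜 := ℝ) (E := E) (γ t)).mdiff
    refine h1.congr_deriv (ContinuousLinearMap.ext fun w ↦ ?_)
    have h2 := hasDerivAt_adj_apply hγ t w
    have h3 := (h1.clm_apply (hasDerivAt_const t w)).unique h2
    rw [mul_apply_eq_comp, adE_apply]
    simpa using h3
  -- `Ad(γ s) exp(-s ad v)` is constant; its values at times 1 and 0 give the claim. The derivative
  -- of the exponential is written with the generator on the left, next to the one produced by `Ad`.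
  have hp : ∀ t, HasDerivAt (fun s ↦ (adj ℝ E (γ s) : E →L[ℝ] E) *
      NormedSpace.exp (s • (-adE G v))) 0 t := fun t ↦ by
    have := (ha t).mul (hasDerivAt_exp_smul_const' (-adE G v) t)
    refine this.congr_deriv ?_
    noncomm_ring
  have hc := is_const_of_deriv_eq_zero (fun t ↦ (hp t).differentiableAt) (fun t ↦ (hp t).deriv) 1 0
  have e1 : (adj ℝ E (1 : G) : E →L[ℝ] E) = 1 := by ext w; exact adj_one w
  simp only [h0, zero_smul, NormedSpace.exp_zero, mul_one, e1, one_smul] at hc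
  have e2 := exp_neg_mul_exp (adE G v)
  calc adj ℝ E (γ 1) = adj ℝ E (γ 1) * (NormedSpace.exp (-adE G v) * NormedSpace.exp (adE G v)) := by
        rw [e2, mul_one]
    _ = NormedSpace.exp (adE G v) := by rw [← mul_assoc, hc, one_mul]

/-- Every term of the exponential series after the zeroth maps `p` into `n`, and `n` is closed
because the dimension is finite. -/
theorem exp_apply_sub_mem [FiniteDimensional ℝ E] {A : E →L[ℝ] E} {n p : Submodule ℝ E} (hnp : n ≤ p)
    (hA : ∀ X ∈ p, A X ∈ n) {X : E} (hX : X ∈ p) : NormedSpace.exp A X - X ∈ n := by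
  have h := (ContinuousLinearMap.apply ℝ E X).hasSum (NormedSpace.exp_series_hasSum_exp' (𝕂 := ℝ) A)
  have h2 := (hasSum_nat_add_iff' 1).2 h
  have hmem : ∀ k : ℕ, (A ^ (k + 1)) X ∈ n := by
    intro k
    induction k with
    | zero => simpa using hA X hX
    | succ k ih =>
      rw [pow_succ', mul_apply_eq_comp]
      exact hA _ (hnp ih)
  have h3 : NormedSpace.exp A X - X ∈ closure (n : Set E) := by
    refine mem_closure_of_tendsto (b := atTop)
      (f := fun s : Finset ℕ ↦ ∑ k ∈ s, ((k + 1).factorial⁻¹ : ℝ) • (A ^ (k + 1)) X) ?_ ?_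
    · simpa [HasSum, Function.comp_def] using h2
    · exact Eventually.of_forall fun s ↦ sum_mem fun k _ ↦ n.smul_mem _ (hmem k)
  rwa [(Submodule.closed_of_finiteDimensional n).closure_eq] at h3

end IntegralCurves

/-! ### The subgroup generated by exponentials -/

section ExponentialSubgroup

variable {E : Type*} [NormedAddCommGroup E] [NormedSpace ℂ E] [CompleteSpace E]
  {F : Type*} [NormedAddCommGroup F] [NormedSpace ℝ F]
  {G : Type*} [TopologicalSpace G] [ChartedSpace E G] [Group G] [LieGroup 𝓘(ℝ, E) ω G]

theorem totalDeriv_eq_zero_of_const {n : Submodule ℂ (GroupLieAlgebra 𝓘(ℂ, E) G)} {v : E}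
    (hv : v ∈ n) {φ : G → F} (hφ : MDifferentiableAt 𝓘(ℝ, E) 𝓘(ℝ, F) φ 1)
    (hc : ∀ k ∈ lieSubgroup n, φ k = φ 1) : totalDeriv ℝ E φ 1 v = 0 := by
  obtain ⟨γ, h0, hγ⟩ := exists_isMIntegralCurve_one (G := G) (E := E) v
  have hmem : ∀ t, γ t ∈ lieSubgroup n := fun t ↦ by
    -- `γ t` is the exponential of `t v`, by the reparametrised curve `s ↦ γ(st)`.
    refine Subgroup.subset_closure ⟨(t • v : E), ?_, fun s ↦ γ (s * t), by simp [h0], ?_, by simp⟩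
    · exact n.smul_mem (t : ℂ) hv
    · have := hγ.comp_mul t
      exact (congrArg (IsMIntegralCurve (I := 𝓘(ℝ, E)) fun s ↦ γ (s * t))
        (mulInvariantVectorField_smul (I := 𝓘(ℝ, E)) (G := G) t v)).mpr this
  have h := hasDerivAt_comp_curve hγ (t := 0) (by rwa [h0])
  rw [h0, leftDer_one] at h
  refine h.unique ?_
  have : (fun s ↦ φ (γ s)) = fun _ ↦ φ 1 := funext fun s ↦ hc _ (hmem s)
  rw [this]
  exact hasDerivAt_const _ _

theorem adj_sub_mem_of_mem_lieSubgroup [FiniteDimensional ℝ E]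
    {n : Submodule ℂ (GroupLieAlgebra 𝓘(ℂ, E) G)} {p : Submodule ℝ E}
    (hnp : ∀ v : E, v ∈ n → v ∈ p) (hA : ∀ v : E, v ∈ n → ∀ X ∈ p, (lieE ℝ G v X : E) ∈ n) {k : G}
    (hk : k ∈ lieSubgroup n) {X : E} (hX : X ∈ p) : (adj ℝ E k X - X : E) ∈ n := by
  let n' : Submodule ℝ E := Submodule.restrictScalars ℝ (show Submodule ℂ E from n)
  have hnp' : n' ≤ p := hnp
  -- Carrying the inverse along makes the inverse step of the induction a swap; products work
  -- because `n ≤ p` keeps `Ad` inside `p`.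
  suffices h : (∀ X ∈ p, adj ℝ E k X - X ∈ n') ∧ (∀ X ∈ p, adj ℝ E k⁻¹ X - X ∈ n') from h.1 X hX
  have hmul : ∀ g h : G, (∀ X ∈ p, adj ℝ E g X - X ∈ n') → (∀ X ∈ p, adj ℝ E h X - X ∈ n') →
      ∀ X ∈ p, adj ℝ E (g * h) X - X ∈ n' := fun g h hg hh X hX ↦ by
    have h1 := hh X hX
    have h2 : adj ℝ E h X ∈ p := by simpa using p.add_mem (hnp' h1) hX
    have h3 := n'.add_mem (hg _ h2) h1
    rw [adj_mul]
    simpa using h3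
  induction hk using Subgroup.closure_induction with
  | mem g hg =>
    have hgen : ∀ v : E, v ∈ n → ∀ γ : ℝ → G, γ 0 = 1 →
        IsMIntegralCurve (I := 𝓘(ℝ, E)) γ (mulInvariantVectorField (I := 𝓘(ℝ, E)) (G := G) v) →
        (∀ X ∈ p, adj ℝ E (γ 1) X - X ∈ n') ∧ (∀ X ∈ p, adj ℝ E (γ 1)⁻¹ X - X ∈ n') := by
      intro v hv γ h0 hγ
      have e := adj_curve_one h0 hγ
      have hA1 : ∀ X ∈ p, adE G v X ∈ n' := fun X hX ↦ by
        rw [adE_apply]; exact hA v hv X hX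
      have hA2 : ∀ X ∈ p, (-adE G v) X ∈ n' := fun X hX ↦ n'.neg_mem (hA1 X hX)
      refine ⟨fun X hX ↦ ?_, fun X hX ↦ ?_⟩
      · rw [e]; exact exp_apply_sub_mem hnp' hA1 hX
      · have e2 : adj ℝ E (γ 1)⁻¹ X = NormedSpace.exp (-adE G v) X := by
          have e3 := exp_neg_mul_exp (-adE G v)
          rw [neg_neg, ← e] at e3
          have e4 := congrArg (fun L : E →L[ℝ] E ↦ L X) e3
          simp only [mul_apply_eq_comp, one_apply_eq_self] at e4
          conv_lhs => rw [← e4]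
          rw [adj_inv_adj]
        rw [e2]; exact exp_apply_sub_mem hnp' hA2 hX
    obtain ⟨v, hv, γ, h0, hγ, rfl⟩ := hg
    exact hgen v hv γ h0 hγ
  | one => simp [adj_one]
  | mul g h _ _ hg hh =>
    refine ⟨hmul g h hg.1 hh.1, ?_⟩
    rw [mul_inv_rev]
    exact hmul _ _ hh.2 hg.2
  | inv g _ hg => exact ⟨hg.2, by simpa using hg.1⟩

end ExponentialSubgroup

/-! ### The r-matrix in terms of root spaces -/

section RootAlgebra

open LieAlgebra LieAlgebra.IsKilling LieModule

variable {L : Type*} [LieRing L] [LieAlgebra ℂ L] [FiniteDimensional ℂ L] [IsKilling ℂ L]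
  {H : LieSubalgebra ℂ L} [H.IsCartanSubalgebra]

variable (H) in
/-- The sum of the weight spaces of `H` in `L` whose weight satisfies `P`. -/
def weightSum (P : (H → ℂ) → Prop) : Submodule ℂ L :=
  ⨆ α : {α : Weight ℂ H L // P α}, (rootSpace H α.1).toSubmodule

/-- The function `χ` need not be a weight, since otherwise its space is zero; thus sums of weights
require no case distinction. -/
theorem mem_weightSum {P : (H → ℂ) → Prop} {χ : H → ℂ} (hχ : P χ) {x : L}
    (hx : x ∈ rootSpace H χ) : x ∈ weightSum H P := by
  by_cases h : rootSpace H χ = ⊥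
  · rw [h, LieSubmodule.mem_bot] at hx
    rw [hx]; exact zero_mem _
  · exact Submodule.mem_iSup_of_mem (p := fun α : {α : Weight ℂ H L // P α} ↦
      (rootSpace H α.1).toSubmodule) ⟨⟨χ, h⟩, hχ⟩ hx

theorem weightSum_induction {P : (H → ℂ) → Prop} {p : L → Prop}
    (hmem : ∀ α : Weight ℂ H L, P α → ∀ x ∈ rootSpace H α, p x) (hzero : p 0)
    (hadd : ∀ x y, p x → p y → p (x + y)) {x : L} (hx : x ∈ weightSum H P) : p x :=
  Submodule.iSup_induction _ (motive := p) hx (fun α x hx ↦ hmem α.1 α.2 x hx) hzero hadd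

theorem lie_mem_weightSum {P Q R : (H → ℂ) → Prop} (h : ∀ χ ψ, P χ → Q ψ → R (χ + ψ)) {x y : L}
    (hx : x ∈ weightSum H P) (hy : y ∈ weightSum H Q) : ⁅x, y⁆ ∈ weightSum H R := by
  refine weightSum_induction (p := fun x ↦ ⁅x, y⁆ ∈ weightSum H R) (fun α hα x hx ↦ ?_) (by simp)
    (fun x x' h h' ↦ by rw [add_lie]; exact add_mem h h') hx
  refine weightSum_induction (p := fun y ↦ ⁅x, y⁆ ∈ weightSum H R) (fun β hβ y hy ↦ ?_) (by simp)
    (fun y y' h h' ↦ by rw [lie_add]; exact add_mem h h') hy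
  exact mem_weightSum (h _ _ hα hβ) (lie_mem_genWeightSpace_of_mem_genWeightSpace hx hy)

theorem killingForm_weightSum {P Q : (H → ℂ) → Prop} (h : ∀ χ ψ, P χ → Q ψ → χ + ψ ≠ 0) {x y : L}
    (hx : x ∈ weightSum H P) (hy : y ∈ weightSum H Q) : killingForm ℂ L x y = 0 := by
  refine weightSum_induction (p := fun x ↦ killingForm ℂ L x y = 0) (fun α hα x hx ↦ ?_) (by simp)
    (fun x x' h h' ↦ by rw [map_add, LinearMap.add_apply, h, h', add_zero]) hx
  refine weightSum_induction (p := fun y ↦ killingForm ℂ L x y = 0) (fun β hβ y hy ↦ ?_) (by simp)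
    (fun y y' h h' ↦ by rw [map_add, h, h', add_zero]) hy
  exact killingForm_apply_eq_zero_of_mem_rootSpace_of_add_ne_zero ℂ L H hx hy (h _ _ hα hβ)

theorem weightSum_sup_eq_top {P Q : (H → ℂ) → Prop} (h : ∀ α : Weight ℂ H L, P α ∨ Q α) :
    weightSum H P ⊔ weightSum H Q = ⊤ := by
  rw [eq_top_iff, ← LieSubmodule.iSup_toSubmodule_eq_top.mpr (iSup_genWeightSpace_eq_top' ℂ H L)]
  refine iSup_le fun α x hx ↦ ?_
  rcases h α with h | h
  · exact Submodule.mem_sup_left (mem_weightSum h hx)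
  · exact Submodule.mem_sup_right (mem_weightSum h hx)

theorem mem_weightSum_zero (x : H) : (x : L) ∈ weightSum H (fun χ ↦ χ = 0) := by
  refine mem_weightSum (P := fun χ ↦ χ = 0) (χ := 0) rfl ?_
  have h : (x : L) ∈ H.toSubmodule := x.2
  rwa [cartan_eq_rootSpace_zero] at h

/-- The weight decomposition refines the eigenspace decomposition of `ad h`. The part of an
eigenvector in the other weight spaces lies in the span of the other eigenspaces, hence is zero by
independence. -/
theorem eigenspace_le_weightSum (h : H) (m : ℂ) :
    (ad ℂ L (h : L)).eigenspace m ≤ weightSum H (fun χ ↦ χ h = m) := by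
  have hle : ∀ α : Weight ℂ H L, ∀ x ∈ rootSpace H α,
      x ∈ (ad ℂ L (h : L)).eigenspace (α h) := fun α x hx ↦
    Module.End.mem_eigenspace_iff.2 (lie_eq_smul_of_mem_rootSpace hx h)
  intro x hx
  have htop : x ∈ weightSum H (fun χ ↦ χ h = m) ⊔ weightSum H (fun χ ↦ χ h ≠ m) := by
    rw [weightSum_sup_eq_top fun α ↦ em _]; trivial
  obtain ⟨a, ha, b, hb, rfl⟩ := Submodule.mem_sup.1 htop
  have ha' : a ∈ (ad ℂ L (h : L)).eigenspace m :=
    weightSum_induction (p := (· ∈ (ad ℂ L (h : L)).eigenspace m))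
      (fun α hα x hx ↦ by
        have := hle α x hx
        rwa [show α h = m from hα] at this) (zero_mem _) (fun _ _ ↦ add_mem) ha
  have hb' : b ∈ ⨆ μ ≠ m, (ad ℂ L (h : L)).eigenspace μ :=
    weightSum_induction (p := (· ∈ ⨆ μ ≠ m, (ad ℂ L (h : L)).eigenspace μ))
      (fun α hα x hx ↦ Submodule.mem_iSup_of_mem (α h) (Submodule.mem_iSup_of_mem hα (hle α x hx)))
      (zero_mem _) (fun _ _ ↦ add_mem) hb
  have hb'' : b ∈ (ad ℂ L (h : L)).eigenspace m := by
    have := sub_mem hx ha'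
    rwa [add_sub_cancel_left] at this
  have := Submodule.disjoint_def.1 ((ad ℂ L (h : L)).eigenspaces_iSupIndep m) b hb'' hb'
  rw [this, add_zero]
  exact ha

theorem weightSum_mono {P Q : (H → ℂ) → Prop} (h : ∀ α : Weight ℂ H L, P α → Q α) :
    weightSum H P ≤ weightSum H Q := fun _ hx ↦
  weightSum_induction (p := (· ∈ weightSum H Q)) (fun α hα _ hx ↦ mem_weightSum (h α hα) hx)
    (zero_mem _) (fun _ _ ↦ add_mem) hx

/-- The Cayley transform in terms of `1 - s`. -/
theorem exists_cayley (s : weylGroup H) (x : H) : ∃ u f : H, u ∈ movedSpace s ∧ s.1 f = f ∧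
    x = u - s.1 u + f ∧ cayley s x = u + s.1 u := by
  set m := (movedSpace s).projectionOnto (fixedSpace s) (isCompl_movedSpace s) x with hm
  set u := Ring.inverse (1 - onMoved s) m with hu
  refine ⟨u, x - m, u.2, ?_, ?_, rfl⟩
  · rw [← mem_fixedSpace, ← Submodule.projectionOnto_apply_eq_zero_iff (isCompl_movedSpace s),
      map_sub, ← hm, Submodule.projectionOnto_apply_left, sub_self]
  · have h1 : (1 - onMoved s) u = m := by
      rw [hu, ← Module.End.mul_apply, Ring.mul_inverse_cancel _ (isUnit_one_sub_onMoved s)]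
      rfl
    have h2 : (u : H) - s.1 u = m := congrArg Subtype.val h1
    rw [h2, add_sub_cancel]

/-- Write the moved parts as `u - su` and `u' - su'`. Since `s` is orthogonal, `κ(u + su, u' - su')
= κ(su, u') - κ(u, su')`, which changes sign when the two are exchanged; the fixed parts are
orthogonal to everything moved. -/
theorem cayley_skew (s : weylGroup H) (x y : H) :
    killingForm ℂ L (cayley s x) y = -killingForm ℂ L x (cayley s y) := by
  obtain ⟨u, f, hu, hf, hx, hcx⟩ := exists_cayley s x
  obtain ⟨u', f', hu', hf', hy, hcy⟩ := exists_cayley s y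
  rw [hcx, hcy, hx, hy]
  have hsu := movedSpace_invariant s u hu
  have hsu' := movedSpace_invariant s u' hu'
  have e1 : killingForm ℂ L u f' = 0 := by
    rw [LieModule.traceForm_comm]; exact mem_movedSpace.1 hu f' hf'
  have e2 : killingForm ℂ L (s.1 u) f' = 0 := by
    rw [LieModule.traceForm_comm]; exact mem_movedSpace.1 hsu f' hf'
  have e3 : killingForm ℂ L f u' = 0 := mem_movedSpace.1 hu' f hf
  have e4 : killingForm ℂ L f (s.1 u') = 0 := mem_movedSpace.1 hsu' f hf
  have e5 := killingForm_weyl s u u'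
  simp only [AddMemClass.coe_add, AddSubgroupClass.coe_sub, map_add, map_sub, LinearMap.add_apply,
    LinearMap.sub_apply, e1, e2, e3, e4, e5]
  ring

namespace SliceDatum

variable {s : weylGroup H} (D : SliceDatum H s)

theorem borelNilradical_eq :
    D.borelNilradical = weightSum H (fun χ ↦ (χ D.hBar).re < 0) := by
  apply le_antisymm
  · exact iSup_le fun α x hx ↦ mem_weightSum (P := fun χ : H → ℂ ↦ (χ D.hBar).re < 0) α.2.2.2 hx
  · refine iSup_le fun α ↦ ?_
    have h0 : α.1.IsNonZero := fun h ↦ by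
      have h2 : (α.1 D.hBar).re < 0 := α.2
      rw [h.eq] at h2
      simp at h2
    exact le_iSup (fun α : {α : Weight ℂ H L // α.IsNonZero ∧ α ∈ D.negativeRoots} ↦
      (rootSpace H α.1).toSubmodule) ⟨α.1, h0, h0, α.2⟩

theorem oppositeNilradical_eq :
    D.oppositeNilradical = weightSum H (fun χ ↦ 0 < (χ D.hBar).re) := by
  apply le_antisymm
  · exact iSup_le fun α x hx ↦ mem_weightSum (P := fun χ : H → ℂ ↦ 0 < (χ D.hBar).re) α.2.2.2 hx
  · refine iSup_le fun α ↦ ?_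
    have h0 : α.1.IsNonZero := fun h ↦ by
      have h2 : 0 < (α.1 D.hBar).re := α.2
      rw [h.eq] at h2
      simp at h2
    exact le_iSup (fun α : {α : Weight ℂ H L // α.IsNonZero ∧ α ∈ D.positiveRoots} ↦
      (rootSpace H α.1).toSubmodule) ⟨α.1, h0, h0, α.2⟩

theorem rMatrix_borel {x : L} (hx : x ∈ D.borelNilradical) : D.rMatrix x = x := by
  simp only [rMatrix, LinearMap.add_apply, LinearMap.sub_apply, LinearMap.comp_apply]
  rw [Submodule.projection_apply_of_mem_left _ hx,
    Submodule.projection_apply_of_mem_right _ (Submodule.mem_sup_left hx),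
    Submodule.projectionOnto_apply_of_mem_right _ (Submodule.mem_sup_left hx)]
  simp

theorem rMatrix_opposite {x : L} (hx : x ∈ D.oppositeNilradical) : D.rMatrix x = -x := by
  simp only [rMatrix, LinearMap.add_apply, LinearMap.sub_apply, LinearMap.comp_apply]
  rw [Submodule.projection_apply_of_mem_left _ hx,
    Submodule.projection_apply_of_mem_right _ (Submodule.mem_sup_left hx),
    Submodule.projectionOnto_apply_of_mem_right _ (Submodule.mem_sup_right hx)]
  simp

theorem rMatrix_cartan (x : H) : D.rMatrix x = cayley s x := by
  have hx : (x : L) ∈ H.toSubmodule := x.2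
  simp only [rMatrix, LinearMap.add_apply, LinearMap.sub_apply, LinearMap.comp_apply]
  rw [Submodule.projection_apply_of_mem_right _ (Submodule.mem_sup_right hx),
    Submodule.projection_apply_of_mem_right _ (Submodule.mem_sup_right hx),
    Submodule.projectionOnto_apply_of_mem_left _ hx]
  simp

theorem exists_decomposition (x : L) : ∃ a ∈ D.borelNilradical, ∃ b ∈ D.oppositeNilradical,
    ∃ h : H, x = a + (b + h) := by
  have hx : x ∈ D.borelNilradical ⊔ (D.oppositeNilradical ⊔ H.toSubmodule) := by
    rw [D.isCompl_borelNilradical.sup_eq_top]; trivial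
  obtain ⟨a, ha, y, hy, rfl⟩ := Submodule.mem_sup.1 hx
  obtain ⟨b, hb, h, hh, rfl⟩ := Submodule.mem_sup.1 hy
  exact ⟨a, ha, b, hb, ⟨h, hh⟩, rfl⟩

/-- Only `𝔨` with `𝔨̄` and the Cartan subalgebra with itself pair nontrivially. On the former `r` is
`1` and `-1`, on the latter it is the skew Cayley transform. -/
theorem rMatrix_skew (x y : L) :
    killingForm ℂ L (D.rMatrix x) y = -killingForm ℂ L x (D.rMatrix y) := by
  obtain ⟨a, ha, b, hb, h, rfl⟩ := D.exists_decomposition x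
  obtain ⟨a', ha', b', hb', h', rfl⟩ := D.exists_decomposition y
  have r1 := D.rMatrix_borel ha
  have r2 := D.rMatrix_opposite hb
  have r3 := D.rMatrix_cartan h
  have r1' := D.rMatrix_borel ha'
  have r2' := D.rMatrix_opposite hb'
  have r3' := D.rMatrix_cartan h'
  rw [borelNilradical_eq] at ha ha'
  rw [oppositeNilradical_eq] at hb hb'
  have c0 : ∀ χ ψ : H → ℂ, ((χ D.hBar).re + (ψ D.hBar).re ≠ 0) → χ + ψ ≠ 0 := fun χ ψ h h' ↦ by
    apply h
    have := congrArg Complex.re (congrFun h' D.hBar)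
    simpa using this
  have z0 : ∀ ψ : H → ℂ, ψ = 0 → (ψ D.hBar).re = 0 := by rintro _ rfl; rfl
  have e1 := killingForm_weightSum (fun χ ψ h1 h2 ↦ c0 χ ψ (add_neg h1 h2).ne) ha ha'
  have e2 := killingForm_weightSum (fun χ ψ h1 h2 ↦ c0 χ ψ (add_pos h1 h2).ne') hb hb'
  have e3 : ∀ z : H, killingForm ℂ L a z = 0 := fun z ↦ killingForm_weightSum
    (fun χ ψ h1 h2 ↦ c0 χ ψ (by rw [z0 ψ h2, add_zero]; exact h1.ne)) ha (mem_weightSum_zero z)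
  have e4 : ∀ z : H, killingForm ℂ L b z = 0 := fun z ↦ killingForm_weightSum
    (fun χ ψ h1 h2 ↦ c0 χ ψ (by rw [z0 ψ h2, add_zero]; exact h1.ne')) hb (mem_weightSum_zero z)
  have e5 : ∀ z : H, killingForm ℂ L z a' = 0 := fun z ↦ killingForm_weightSum
    (fun χ ψ h1 h2 ↦ c0 χ ψ (by rw [z0 χ h1, zero_add]; exact h2.ne)) (mem_weightSum_zero z) ha'
  have e6 : ∀ z : H, killingForm ℂ L z b' = 0 := fun z ↦ killingForm_weightSum
    (fun χ ψ h1 h2 ↦ c0 χ ψ (by rw [z0 χ h1, zero_add]; exact h2.ne')) (mem_weightSum_zero z) hb'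
  have e7 := cayley_skew s h h'
  simp only [map_add, map_neg, LinearMap.add_apply, LinearMap.neg_apply, r1, r2, r3, r1', r2', r3',
    e1, e2, e3, e4, e5, e6, e7]
  ring

/-- It suffices that `r` is `1` and `-1` on two subalgebras normalised by the Cartan subalgebra and
maps that abelian subalgebra to itself; the form of the Cayley transform plays no role. -/
theorem rMatrix_yangBaxter (x y : L) :
    ⁅D.rMatrix x, D.rMatrix y⁆ - D.rMatrix ⁅D.rMatrix x, y⁆ - D.rMatrix ⁅x, D.rMatrix y⁆ =
      -⁅x, y⁆ := by
  obtain ⟨a, ha, b, hb, h, rfl⟩ := D.exists_decomposition x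
  obtain ⟨a', ha', b', hb', h', rfl⟩ := D.exists_decomposition y
  have r1 := D.rMatrix_borel ha
  have r2 := D.rMatrix_opposite hb
  have r3 := D.rMatrix_cartan h
  have r1' := D.rMatrix_borel ha'
  have r2' := D.rMatrix_opposite hb'
  have r3' := D.rMatrix_cartan h'
  have z0 : ∀ ψ : H → ℂ, ψ = 0 → (ψ D.hBar).re = 0 := by rintro _ rfl; rfl
  have kk : ∀ {a a' : L}, a ∈ D.borelNilradical → a' ∈ D.borelNilradical →
      ⁅a, a'⁆ ∈ D.borelNilradical := fun ha ha' ↦ by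
    rw [borelNilradical_eq] at *
    exact lie_mem_weightSum (fun χ ψ h1 h2 ↦ by simpa using add_neg h1 h2) ha ha'
  have oo : ∀ {a a' : L}, a ∈ D.oppositeNilradical → a' ∈ D.oppositeNilradical →
      ⁅a, a'⁆ ∈ D.oppositeNilradical := fun ha ha' ↦ by
    rw [oppositeNilradical_eq] at *
    exact lie_mem_weightSum (fun χ ψ h1 h2 ↦ by simpa using add_pos h1 h2) ha ha'
  have kh : ∀ {a : L}, a ∈ D.borelNilradical → ∀ z : H, D.rMatrix ⁅a, (z : L)⁆ = ⁅a, (z : L)⁆ :=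
    fun ha z ↦ D.rMatrix_borel (by
      rw [borelNilradical_eq] at *
      exact lie_mem_weightSum (fun χ ψ h1 h2 ↦ by simpa [z0 ψ h2] using h1) ha
        (mem_weightSum_zero z))
  have oh : ∀ {a : L}, a ∈ D.oppositeNilradical → ∀ z : H,
      D.rMatrix ⁅a, (z : L)⁆ = -⁅a, (z : L)⁆ :=
    fun ha z ↦ D.rMatrix_opposite (by
      rw [oppositeNilradical_eq] at *
      exact lie_mem_weightSum (fun χ ψ h1 h2 ↦ by simpa [z0 ψ h2] using h1) ha
        (mem_weightSum_zero z))
  have hk : ∀ {a : L}, a ∈ D.borelNilradical → ∀ z : H, D.rMatrix ⁅(z : L), a⁆ = ⁅(z : L), a⁆ :=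
    fun {a} ha z ↦ by rw [← lie_skew, map_neg, kh ha z]
  have ho : ∀ {a : L}, a ∈ D.oppositeNilradical → ∀ z : H,
      D.rMatrix ⁅(z : L), a⁆ = -⁅(z : L), a⁆ :=
    fun {a} ha z ↦ by rw [← lie_skew, map_neg, oh ha z]
  have hh : ∀ z w : H, ⁅(z : L), (w : L)⁆ = 0 := fun z w ↦ by
    rw [← LieSubalgebra.coe_bracket, trivial_lie_zero, ZeroMemClass.coe_zero]
  have e1 := D.rMatrix_borel (kk ha ha')
  have e2 := D.rMatrix_opposite (oo hb hb')
  simp only [map_add, map_neg, r1, r2, r3, r1', r2', r3', add_lie, lie_add, neg_lie, lie_neg, e1,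
    e2, kh ha, oh hb, hk ha', ho hb', hh, map_zero]
  abel

end SliceDatum

end RootAlgebra

/-! ### The nilradical and its orthogonal complement -/

section Nilradical

open LieAlgebra LieAlgebra.IsKilling LieModule

theorem add_re_neg_iff {z w : ℂ} (hz : z.im = 0) (h : ‖w‖ < ‖z‖) :
    (z + w).re < 0 ↔ z.re < 0 := by
  have h1 : |w.re| < |z.re| := by
    refine (Complex.abs_re_le_norm w).trans_lt (h.trans_le ?_)
    rw [show z = (z.re : ℂ) from Complex.ext rfl (by simpa using hz), Complex.norm_real]
    simp
  rw [Complex.add_re]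
  constructor
  · intro h2
    by_contra! h3
    rw [abs_of_nonneg h3] at h1
    linarith [neg_abs_le w.re]
  · intro h2
    rw [abs_of_neg h2] at h1
    linarith [le_abs_self w.re]

variable {L : Type*} [LieRing L] [LieAlgebra ℂ L] [FiniteDimensional ℂ L] [IsKilling ℂ L]
  {H : LieSubalgebra ℂ L} [H.IsCartanSubalgebra]

namespace SliceDatum

variable {s : weylGroup H} (D : SliceDatum H s)

theorem hBarZero_mem : D.hBarZero ∈ realCartan H := Submodule.sum_mem _ fun i _ ↦ D.hmem i

/-- Weights are real on `h̄₀`, so comparing real parts loses nothing and the real eigenvalues in the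
definition are exactly the values of weights. -/
theorem nilradical_eq : D.nilradical = weightSum H (fun χ ↦ (χ D.hBarZero).re < 0) := by
  apply le_antisymm
  · refine iSup_le fun m ↦ (eigenspace_le_weightSum D.hBarZero _).trans (weightSum_mono fun α hα ↦ ?_)
    rw [hα]
    exact m.2
  · refine iSup_le fun α x hx ↦ ?_
    refine Submodule.mem_iSup_of_mem (⟨(α.1 D.hBarZero).re, α.2⟩ : {m : ℝ // m < 0}) ?_
    rw [show (((α.1 D.hBarZero).re : ℝ) : ℂ) = α.1 D.hBarZero from
      Complex.ext rfl (by simpa using (im_eq_zero α.1 _ D.hBarZero_mem).symm)]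
    exact Module.End.mem_eigenspace_iff.2 (lie_eq_smul_of_mem_rootSpace hx _)

/-- For the last index `i` with `α(h_i) ≠ 0`, dominance makes `α(h_i)` outweigh the earlier terms
both in `α(h̄)` and in `α(h̄₀)`. Here `i` is positive because `α(h̄₀) ≠ 0`, so both sums contain
this term and share its sign. -/
theorem re_hBar_neg (α : Weight ℂ H L) (hα : (α D.hBarZero).re < 0) : (α D.hBar).re < 0 := by
  classical
  have hsum : ∀ S : Finset (Fin (D.K + 1)), α (∑ j ∈ S, D.h j) = ∑ j ∈ S, α (D.h j) :=
    fun S ↦ map_sum α.toLinear _ _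
  have hnz : α.IsNonZero := fun h ↦ by
    rw [h.eq] at hα
    simp at hα
  obtain ⟨j, hj, hj0⟩ : ∃ j, j ≠ 0 ∧ α (D.h j) ≠ 0 := by
    by_contra! hcon
    rw [hBarZero, hsum, Finset.sum_eq_zero fun j hj ↦ hcon j (Finset.ne_of_mem_erase hj)] at hα
    simp at hα
  obtain ⟨i, hi, hmax⟩ := Finset.exists_max_image
    (Finset.univ.filter fun i ↦ α (D.h i) ≠ 0) id ⟨j, by simpa using hj0⟩
  replace hi : α (D.h i) ≠ 0 := by simpa using hi
  replace hmax : ∀ k, i < k → α (D.h k) = 0 := fun k hk ↦ by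
    by_contra h
    exact absurd (hmax k (by simpa using h)) (not_le.2 hk)
  have hi0 : 0 < i := by
    by_contra h
    exact hj0 (hmax j ((not_lt.1 h).trans_lt (Fin.pos_iff_ne_zero.2 hj)))
  have hlay : α ∈ layer D.h i := ⟨hnz, hmax, hi⟩
  have hind : i ∈ indices D.h := by
    simp only [indices, Finset.mem_filter, Finset.mem_univ, true_and]
    exact Or.inr ⟨α, hlay⟩
  have him : (α (D.h i)).im = 0 := im_eq_zero α _ (D.hmem i)
  have hsplit : ∀ S : Finset (Fin (D.K + 1)), i ∈ S →
      α (∑ j ∈ S, D.h j) = α (D.h i) + ∑ j ∈ S.filter (· < i), α (D.h j) := by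
    intro S hS
    rw [hsum, ← Finset.add_sum_erase _ _ hS]
    congr 1
    symm
    apply Finset.sum_subset
    · intro j hj
      simp only [Finset.mem_filter, Finset.mem_erase] at hj ⊢
      exact ⟨hj.2.ne, hj.1⟩
    · intro j hj hj'
      simp only [Finset.mem_filter, Finset.mem_erase, not_and, not_lt] at hj hj'
      exact hmax j (lt_of_le_of_ne (hj' hj.2) (Ne.symm hj.1))
  -- Upward closure makes the part of `S` below `i` a window `l ≤ j < i` with `l` its least element,
  -- as in the dominance condition; if that part is empty there is nothing to outweigh.
  have hdom : ∀ S : Finset (Fin (D.K + 1)), S ⊆ indices D.h → i ∈ S →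
      (∀ l ∈ S, ∀ j ∈ indices D.h, l ≤ j → j ∈ S) →
      ((α (∑ j ∈ S, D.h j)).re < 0 ↔ (α (D.h i)).re < 0) := by
    intro S hS hiS hup
    rw [hsplit S hiS]
    refine add_re_neg_iff him ?_
    by_cases hne : (S.filter (· < i)).Nonempty
    · obtain ⟨l, hl, hmin⟩ := Finset.exists_min_image (S.filter (· < i)) id hne
      simp only [Finset.mem_filter, id] at hl hmin
      have hd := D.dominance i hind α hlay l (hS hl.1) hl.2
      have e : (indices D.h).filter (fun j ↦ l ≤ j ∧ j < i) = S.filter (· < i) := by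
        ext j
        simp only [Finset.mem_filter]
        exact ⟨fun h ↦ ⟨hup l hl.1 j h.1 h.2.1, h.2.2⟩, fun h ↦ ⟨hS h.1, hmin j h, h.2⟩⟩
      rwa [e] at hd
    · rw [Finset.not_nonempty_iff_eq_empty.1 hne, Finset.sum_empty, norm_zero]
      exact norm_pos_iff.2 hi
  have h1 := hdom (indices D.h) (Finset.Subset.refl _) hind (fun _ _ j hj _ ↦ hj)
  have h2 := hdom ((indices D.h).erase 0) (Finset.erase_subset _ _)
    (Finset.mem_erase.2 ⟨hi0.ne', hind⟩) (fun l hl j hj hlj ↦ Finset.mem_erase.2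
      ⟨((Fin.pos_iff_ne_zero.2 (Finset.ne_of_mem_erase hl)).trans_le hlj).ne', hj⟩)
  exact h1.2 (h2.1 hα)

theorem rMatrix_nilradical {x : L} (hx : x ∈ D.nilradical) : D.rMatrix x = x := by
  apply D.rMatrix_borel
  rw [borelNilradical_eq]
  rw [nilradical_eq] at hx
  exact weightSum_mono (D.re_hBar_neg) hx

theorem add_ne_zero_of_re {x : H} {χ ψ : H → ℂ} (h : (χ x).re + (ψ x).re ≠ 0) : χ + ψ ≠ 0 := by
  intro h'
  apply h
  have := congrArg Complex.re (congrFun h' x)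
  simpa using this

theorem killingForm_nilradical {x y : L} (hx : x ∈ D.nilradical) (hy : y ∈ D.nilradical) :
    killingForm ℂ L x y = 0 := by
  rw [nilradical_eq] at hx hy
  exact killingForm_weightSum (fun χ ψ h1 h2 ↦ add_ne_zero_of_re (add_neg h1 h2).ne) hx hy

/-- The orthogonal complement of `𝔫` lies in `𝔭`: the component of `x` of positive weight on `h̄₀`
is orthogonal to `𝔫` by hypothesis and to the nonnegative weights by grading, hence vanishes. Then
`[𝔫, 𝔭] ⊆ 𝔫`. -/
theorem lie_mem_nilradical {v x : L} (hv : v ∈ D.nilradical)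
    (hx : ∀ w ∈ D.nilradical, killingForm ℂ L x w = 0) : ⁅v, x⁆ ∈ D.nilradical := by
  have hx' : x ∈ weightSum H (fun χ ↦ (χ D.hBarZero).re ≤ 0) ⊔
      weightSum H (fun χ ↦ 0 < (χ D.hBarZero).re) := by
    rw [weightSum_sup_eq_top fun α ↦ le_or_gt _ _]; trivial
  obtain ⟨y, hy, z, hz, rfl⟩ := Submodule.mem_sup.1 hx'
  rw [nilradical_eq] at *
  have hz0 : z = 0 := by
    have hall : ∀ w, killingForm ℂ L z w = 0 := by
      intro w
      have hw : w ∈ weightSum H (fun χ ↦ (χ D.hBarZero).re < 0) ⊔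
          weightSum H (fun χ ↦ 0 ≤ (χ D.hBarZero).re) := by
        rw [weightSum_sup_eq_top fun α ↦ lt_or_ge _ _]; trivial
      obtain ⟨a, ha, b, hb, rfl⟩ := Submodule.mem_sup.1 hw
      have e1 := hx a ha
      have e2 := killingForm_weightSum
        (fun χ ψ h1 h2 ↦ add_ne_zero_of_re (x := D.hBarZero) (add_neg_of_nonpos_of_neg h1 h2).ne) hy ha
      have e3 := killingForm_weightSum
        (fun χ ψ h1 h2 ↦ add_ne_zero_of_re (x := D.hBarZero) (add_pos_of_pos_of_nonneg h1 h2).ne') hz hb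
      rw [map_add, LinearMap.add_apply, e2, zero_add] at e1
      rw [map_add, e1, e3, add_zero]
    exact (LieAlgebra.IsKilling.killingForm_nondegenerate ℂ L).1 z hall
  rw [hz0, add_zero]
  exact lie_mem_weightSum (fun χ ψ h1 h2 ↦ by simpa using add_neg_of_neg_of_nonpos h1 h2) hv hy

end SliceDatum

end Nilradical

/-! ### Verification for the Killing form and its real part -/

section Main

variable {E : Type*} [NormedAddCommGroup E] [NormedSpace ℂ E] [FiniteDimensional ℂ E]
  [CompleteSpace E]
  {G : Type*} [TopologicalSpace G] [ChartedSpace E G] [Group G] [LieGroup 𝓘(ℂ, E) ω G]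
  [LieAlgebra.IsSimple ℂ (GroupLieAlgebra 𝓘(ℂ, E) G)]

variable (E) in
/-- The adjoint action as an automorphism of the Lie algebra. -/
def adjEquiv (g : G) : GroupLieAlgebra 𝓘(ℂ, E) G ≃ₗ⁅ℂ⁆ GroupLieAlgebra 𝓘(ℂ, E) G where
  toFun := adj ℂ E g
  map_add' := (adj ℂ E g).map_add
  map_smul' := (adj ℂ E g).map_smul
  map_lie' := fun {v w} ↦ adj_lieE (𝕜 := ℂ) (E := E) g v w
  invFun := adj ℂ E g⁻¹
  left_inv := adj_inv_adj (𝕜 := ℂ) (E := E) g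
  right_inv := adj_adj_inv (𝕜 := ℂ) (E := E) g

theorem killing_adj (g : G) (a b : E) :
    killing E G (adj ℂ E g a) (adj ℂ E g b) = killing E G a b :=
  LieAlgebra.killingForm_of_equiv_apply (R := ℂ) (adjEquiv E g) a b

theorem killing_lie (a b c : GroupLieAlgebra 𝓘(ℂ, E) G) :
    killing E G ⁅a, b⁆ c = killing E G a ⁅b, c⁆ :=
  LieModule.traceForm_apply_lie_apply ℂ (GroupLieAlgebra 𝓘(ℂ, E) G)
    (GroupLieAlgebra 𝓘(ℂ, E) G) a b c

namespace SliceDatum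

variable {H : LieSubalgebra ℂ (GroupLieAlgebra 𝓘(ℂ, E) G)} [H.IsCartanSubalgebra]
  {s : weylGroup H} (D : SliceDatum H s)

theorem isRMatrix_complex : IsRMatrix (𝕜 := ℂ) (E := E) G (killing E G) D.rMatrix where
  symm := LieModule.traceForm_comm ℂ (GroupLieAlgebra 𝓘(ℂ, E) G) (GroupLieAlgebra 𝓘(ℂ, E) G)
  inv a b c := killing_lie (E := E) (G := G) a b c
  inv_adj := killing_adj
  skew := D.rMatrix_skew
  yangBaxter := D.rMatrix_yangBaxter

theorem isRMatrix_real [LieGroup 𝓘(ℝ, E) ω G] :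
    IsRMatrix (𝕜 := ℝ) (E := E) G (realForm (killing E G)) (realEnd D.rMatrix) where
  symm a b := congrArg Complex.re (D.isRMatrix_complex.symm a b)
  inv a b c := by
    rw [lieE_real, lieE_real]
    exact congrArg Complex.re (D.isRMatrix_complex.inv a b c)
  inv_adj g a b := by
    rw [adj_real, adj_real]
    exact congrArg Complex.re (D.isRMatrix_complex.inv_adj g a b)
  skew a b := congrArg Complex.re (D.isRMatrix_complex.skew a b)
  yangBaxter a b := by
    rw [lieE_real, lieE_real, lieE_real, lieE_real]
    exact D.isRMatrix_complex.yangBaxter a b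

/-- The orthogonal complement of the nilradical, as a real subspace. -/
def nilradicalOrthogonal : Submodule ℝ E where
  carrier := {X | ∀ v : E, v ∈ D.nilradical → killing E G X v = 0}
  add_mem' := fun {X Y} hX hY v hv ↦ by
    have e : killing E G (X + Y : E) v = killing E G X v + killing E G Y v :=
      LinearMap.map_add₂ (killing E G) X Y v
    rw [e, hX v hv, hY v hv, add_zero]
  zero_mem' := fun v _ ↦ LinearMap.map_zero₂ (killing E G) v
  smul_mem' := fun c X hX v hv ↦ by
    have e : killing E G ((c : ℂ) • X : E) v = (c : ℂ) • killing E G X v :=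
      LinearMap.map_smul₂ (killing E G) (c : ℂ) X v
    exact e.trans (by rw [hX v hv, smul_zero])

theorem adj_sub_mem_nilradical {k : G} (hk : k ∈ D.unipotentRadical) {X : E}
    (hX : ∀ v : E, v ∈ D.nilradical → killing E G X v = 0) :
    (adj ℝ E k X - X : E) ∈ D.nilradical := by
  have := lieGroup_real E G
  have : FiniteDimensional ℝ E := FiniteDimensional.complexToReal E
  refine adj_sub_mem_of_mem_lieSubgroup (p := D.nilradicalOrthogonal)
    (fun v hv w hw ↦ D.killingForm_nilradical hv hw) (fun v hv X hX ↦ ?_) hk hX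
  rw [lieE_real]
  exact D.lie_mem_nilradical hv hX

/-- The subgroup is generated by real-time exponentials, so the holomorphic case passes through the
underlying real group for both the derivative and the adjoint action. -/
theorem isIsotropicSubgroup_complex : IsIsotropicSubgroup (𝕜 := ℂ) (E := E) (killing E G) D.rMatrix
    {v : E | v ∈ D.nilradical} D.unipotentRadical where
  deriv_eq_zero v hv φ hφ hc := by
    have := lieGroup_real E G
    rw [← totalDeriv_real hφ]
    exact totalDeriv_eq_zero_of_const hv (mdifferentiableAt_real hφ) hc
  adj_sub_mem k hk X hX := by
    rw [← adj_real]
    exact D.adj_sub_mem_nilradical hk hX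
  map_mem v hv := by
    have e := D.rMatrix_nilradical hv
    exact (congrArg (· ∈ D.nilradical) e).mpr hv
  isotropic v hv w hw := D.killingForm_nilradical hv hw

theorem isIsotropicSubgroup_real [LieGroup 𝓘(ℝ, E) ω G] : IsIsotropicSubgroup (𝕜 := ℝ) (E := E)
    (realForm (killing E G)) (realEnd D.rMatrix) {v : E | v ∈ D.nilradical}
    D.unipotentRadical where
  deriv_eq_zero v hv φ hφ hc := totalDeriv_eq_zero_of_const hv hφ hc
  adj_sub_mem k hk X hX := D.adj_sub_mem_nilradical hk fun v hv ↦ by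
    refine Complex.ext (hX v hv) ?_
    -- The nilradical is a complex subspace; testing against `i v` shows that the imaginary part of
    -- `κ(X, v)` vanishes too, so real and complex orthogonality to it agree.
    have h1 : (killing E G X (Complex.I • v : E)).re = 0 :=
      hX (Complex.I • v : E) (D.nilradical.smul_mem Complex.I hv)
    have e : killing E G X (Complex.I • v : E) = Complex.I • killing E G X v :=
      map_smul (killing E G X) Complex.I v
    rw [e] at h1
    simpa using h1
  map_mem v hv := by
    have e := D.rMatrix_nilradical hv
    exact (congrArg (· ∈ D.nilradical) e).mpr hv
  isotropic v hv w hw := congrArg Complex.re (D.killingForm_nilradical hv hw)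

end SliceDatum

end Main

end PoissonSlices

theorem mainTheorem2
    {E : Type*} [NormedAddCommGroup E] [NormedSpace ℂ E] [FiniteDimensional ℂ E] [CompleteSpace E]
    {G : Type*} [TopologicalSpace G] [ChartedSpace E G] [Group G] [LieGroup 𝓘(ℂ, E) ω G]
    [ConnectedSpace G] [LieAlgebra.IsSimple ℂ (GroupLieAlgebra 𝓘(ℂ, E) G)]
    (H : LieSubalgebra ℂ (GroupLieAlgebra 𝓘(ℂ, E) G)) [H.IsCartanSubalgebra]
    (s : PoissonSlices.weylGroup H) (D : PoissonSlices.SliceDatum H s) :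
    (PoissonSlices.IsPoissonLie D.complexPoisson ∧
      PoissonSlices.IsAdmissible.{u, v} D.complexPoisson D.unipotentRadical ∧
      PoissonSlices.InvariantsClosed (fun g x : G ↦ g * x * g⁻¹) (D.unipotentRadical : Set G)
        D.complexDual) ∧
    (PoissonSlices.IsPoissonLie D.realPoisson ∧
      PoissonSlices.IsAdmissible.{u, v} D.realPoisson D.unipotentRadical ∧
      PoissonSlices.InvariantsClosed (fun g x : G ↦ g * x * g⁻¹) (D.unipotentRadical : Set G)
        D.realDual) := by
  have := PoissonSlices.lieGroup_real E G
  have hB := PoissonSlices.killing_nondegenerate E G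
  have hB' := PoissonSlices.realForm_nondegenerate hB
  have hc := D.isRMatrix_complex
  have hr := D.isRMatrix_real
  have nc := D.isIsotropicSubgroup_complex
  have nr := D.isIsotropicSubgroup_real
  exact ⟨⟨hc.isPoissonLie (E := E) hB, hc.isAdmissible (E := E) hB nc,
      hc.invariantsClosed_conj (E := E) hB nc⟩,
    hr.isPoissonLie (E := E) hB', hr.isAdmissible (E := E) hB' nr,
    hr.invariantsClosed_conj (E := E) hB' nr⟩
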